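/- Let $n\ge 2$ and $1\le p,q<\infty$. Let $w:[0,\infty)\to[0,\infty]$ be such that $x\mapsto w(|x|)$ is (measurable and) locally integrable on $\mathbf{R}^n$, and assume that the radial measure $d\mu=w(|x|)\,dx$ is doubling on $\mathbf{R}^n$, i.e. there is $C>0$ such that $0<\mu(B(x,2r))\le C\mu(B(x,r))<\infty$ for all $x\in\mathbf{R}^n$ and $r>0$. Let $$X_+=\{(x_1,\dots,x_n)\in\mathbf{R}^n : x_j\ge 0,\ j=1,\dots,n\},$$ equipped with the Euclidean distance and the restriction of $\mu$. Then the following are equivalent: 1. $\mu$ supports a $(q,p)$-Poincaré inequality on $X_+$; 2. $\mu$ supports a $(q,p)$-Poincaré inequality on $X_+$ with dilation $\lambda=1$; 3. $\mu$ supports a $(q,p)$-Poincaré inequality on $\mathbf{R}^n$; 4. $\mu$ supports a $(q,p)$-Poincaré inequality on $\mathbf{R}^n$ with dilation $\lambda=1$. Here $\mu$ supports a $(q,p)$-Poincaré inequality with dilation $\lambda\ge1$ on a metric space $X$ if there is $C>0$ such that for all balls $B=B(x,r)=\{y\in X:d(x,y)<r\}$, all integrable $f:X\to[-\infty,\infty]$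 and all upper gradients $g$ of $f$ on $X$, $$\Bigl(\frac{1}{\mu(B)}\int_B|f-f_B|^q\,d\mu\Bigr)^{1/q}\le Cr\Bigl(\frac{1}{\mu(\lambda B)}\int_{\lambda B}g^p\,d\mu\Bigr)^{1/p},\qquad f_B=\frac{1}{\mu(B)}\int_B f\,d\mu,\quad \lambda B=B(x,\lambda r),$$ and it supports a $(q,p)$-Poincaré inequality if it does so for some $\lambda\ge1$. A Borel function $g:X\to[0,\infty]$ is an upper gradient of $f$ on $X$ if $|f(\gamma(0))-f(\gamma(l))|\le\int_\gamma g\,ds$ for every nonconstant compact rectifiable curve $\gamma:[0,l]\to X$ parameterized by arc length, where the left-hand side is $\infty$ if $f(\gamma(0))$ or $f(\gamma(l))$ is infinite. -/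

import Mathlib

open MeasureTheory Set
open scoped ENNReal NNReal

namespace BowTie

section MetricMeasureSpace

variable {X : Type*} [MetricSpace X] [MeasurableSpace X]

/-- `μ` is doubling: there is `C > 0` with `0 < μ(B(x,2r)) ≤ C μ(B(x,r)) < ∞` for all balls. -/
def IsDoubling (μ : Measure X) : Prop :=
  ∃ C : ℝ, 0 < C ∧ ∀ (x : X) (r : ℝ), 0 < r →
    0 < μ (Metric.ball x (2 * r)) ∧
    μ (Metric.ball x (2 * r)) ≤ ENNReal.ofReal C * μ (Metric.ball x r) ∧
    ENNReal.ofReal C * μ (Metric.ball x r) < ∞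

/-- The Borel function `g : X → [0,∞]` is an upper gradient of `f : X → [-∞,∞]`: the inequality
`|f(γ(0)) - f(γ(l))| ≤ ∫_γ g ds` holds for every nonconstant compact rectifiable curve `γ`,
parameterized by arc length on `[0,l]`, `l > 0`.
In `EReal` one has `⊤ - ⊤ = ⊥ - ⊥ = ⊥`, and `EReal.abs` takes the value `∞` at `⊤` and `⊥`, so the
left-hand side is `∞` whenever at least one of the two terms is infinite. -/
def IsUpperGradient (g : X → ℝ≥0∞) (f : X → EReal) : Prop :=
  Measurable g ∧ ∀ (l : ℝ) (γ : ℝ → X), 0 < l → HasUnitSpeedOn γ (Icc 0 l) →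
    (f (γ 0) - f (γ l)).abs ≤ ∫⁻ t in Icc 0 l, g (γ t)

/-- Integrability of an extended real-valued function: `f` is `μ`-measurable, `∫ |f| dμ < ∞`. -/
def IsIntegrable (f : X → EReal) (μ : Measure X) : Prop :=
  AEMeasurable f μ ∧ ∫⁻ x, (f x).abs ∂μ < ∞

/-- The mean value `f_B = μ(B)⁻¹ ∫_B f dμ` of an integrable extended real-valued function.
Such an `f` is finite almost everywhere, so that `f = f.toReal` almost everywhere. -/
noncomputable def mean (f : X → EReal) (μ : Measure X) (B : Set X) : ℝ :=
  ⨍ x in B, (f x).toReal ∂μ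

/-- `μ` supports a `(q,p)`-Poincaré inequality with dilation `lam`. -/
def SupportsPoincareWithDilation (q p lam : ℝ) (μ : Measure X) : Prop :=
  ∃ C : ℝ, 0 < C ∧ ∀ (x : X) (r : ℝ), 0 < r →
    ∀ f : X → EReal, IsIntegrable f μ → ∀ g : X → ℝ≥0∞, IsUpperGradient g f →
      (⨍⁻ y in Metric.ball x r,
          (f y - (mean f μ (Metric.ball x r) : EReal)).abs ^ q ∂μ) ^ (1 / q) ≤
        ENNReal.ofReal (C * r) *
          (⨍⁻ y in Metric.ball x (lam * r), g y ^ p ∂μ) ^ (1 / p)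

/-- `μ` supports a `(q,p)`-Poincaré inequality, with some dilation `lam ≥ 1`. -/
def SupportsPoincare (q p : ℝ) (μ : Measure X) : Prop :=
  ∃ lam : ℝ, 1 ≤ lam ∧ SupportsPoincareWithDilation q p lam μ

end MetricMeasureSpace

/-- `μ` is a radial measure on `ℝⁿ`: `dμ = w(|x|) dx` for some `w : [0,∞) → [0,∞]` such that
`x ↦ w(|x|)` is Lebesgue measurable and locally integrable. -/
def IsRadialMeasure {n : ℕ} (μ : Measure (EuclideanSpace ℝ (Fin n))) : Prop :=
  ∃ w : ℝ≥0 → ℝ≥0∞,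
    AEMeasurable (fun x : EuclideanSpace ℝ (Fin n) => w ‖x‖₊) volume ∧
    (∀ K : Set (EuclideanSpace ℝ (Fin n)), IsCompact K → ∫⁻ x in K, w ‖x‖₊ < ∞) ∧
    μ = volume.withDensity (fun x => w ‖x‖₊)

/-- The closed positive hyperquadrant `X₊` in `ℝⁿ`. -/
def posHyperquadrant (n : ℕ) : Set (EuclideanSpace ℝ (Fin n)) :=
  {x | ∀ j, 0 ≤ x j}

/-- The measure `μ` on the metric space `X₊` (with the Euclidean distance): a Borel set `A ⊆ X₊`
has measure `μ(A)`. -/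
noncomputable def onPosHyperquadrant {n : ℕ} (μ : Measure (EuclideanSpace ℝ (Fin n))) :
    Measure (posHyperquadrant n) :=
  μ.comap ((↑) : posHyperquadrant n → EuclideanSpace ℝ (Fin n))

end BowTie

/-! The cycle proved is 1 → 3 → 4 → 2 → 1, with 4 → 3 as a trivial extra. Every inequality is first
rewritten without mean values, as a bound on `∫_B ∫_B |F(a) - F(b)|^q` for bounded real
representatives `F` (`PairPoincare`). This form is monotone in the sets and obeys a triangle
inequality through an intermediate set (`pairIntegral_trans`), so estimates can be chained across
sets of comparable measure.

From `X₊` to `ℝⁿ`: a radial measure is invariant under linear isometries, so the inequality on `X₊`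
holds on every rotated copy of it. A ball `B(x,r)` with `√n r ≤ |x|` lies in the copy whose diagonal
points towards `x`. Any other ball lies in a comparable ball about the origin. That ball is covered
by narrow sectors; neighbouring sectors share a rotated quadrant, and since the sphere is connected
for `n ≥ 2` any two sectors are joined by a chain (`PairPoincare.of_onPosHyperquadrant`).

Dilation 1 on `ℝⁿ`: away from the boundary of a ball the inequality follows by chaining small balls
inside the ball, which is convex. In a thin boundary layer, `F(y)` is compared with values at points
`4^i` times deeper, for `M` different `i`. The sets of points `y` paired with a given deeper point
are disjoint for different `i`, so averaging over `i` gains a factor `M`, and for large `M` the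
error is absorbed. The Whitney-type local terms sum up by Jensen if `q ≤ p`, and otherwise by a
lower bound on the decay of measures of balls that the Poincaré inequality itself implies
(`PairPoincare.measureDecay`, `PairPoincare.dilation_one`).

From `ℝⁿ` to `X₊`: compose `f` and `g` with the folding map `x ↦ (|x₁|, …, |xₙ|)`. It preserves arc
length parametrizations, hence upper gradients; it is 1-Lipschitz and fixes `X₊`, hence keeps
dilation 1; and it multiplies measure by at most `2^n` (`PairPoincare.onPosHyperquadrant`). -/

namespace BowTie

/-! ### Double integrals of differences, and truncation. -/

section PairIntegral

variable {X : Type*} [MeasurableSpace X]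

/-- The double integral `∫_A ∫_B |F(a) - F(b)|^q dμ(b) dμ(a)`. -/
noncomputable def pairIntegral (μ : Measure X) (q : ℝ) (F : X → ℝ) (A B : Set X) : ℝ≥0∞ :=
  ∫⁻ a in A, ∫⁻ b in B, edist (F a) (F b) ^ q ∂μ ∂μ

lemma measurable_edist_rpow {F : X → ℝ} (hF : Measurable F) (q : ℝ) :
    Measurable fun z : X × X => edist (F z.1) (F z.2) ^ q :=
  ((hF.comp measurable_fst).edist (hF.comp measurable_snd)).pow_const q

lemma measurable_edist_rpow_right {F : X → ℝ} (hF : Measurable F) (q : ℝ) (c : ℝ) :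
    Measurable fun b : X => edist c (F b) ^ q :=
  (measurable_const.edist hF).pow_const q

lemma measurable_edist_rpow_left {F : X → ℝ} (hF : Measurable F) (q : ℝ) (c : ℝ) :
    Measurable fun b : X => edist (F b) c ^ q :=
  (hF.edist measurable_const).pow_const q

lemma edist_rpow_le {q : ℝ} (hq : 1 ≤ q) (a b c : ℝ) :
    edist a c ^ q ≤ 2 ^ (q - 1) * (edist a b ^ q + edist b c ^ q) :=
  (ENNReal.rpow_le_rpow (edist_triangle a b c) (by linarith)).trans
    (ENNReal.rpow_add_le_mul_rpow_add_rpow _ _ hq)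

lemma two_rpow_ne_top (q : ℝ) : (2 : ℝ≥0∞) ^ q ≠ ∞ :=
  ENNReal.rpow_ne_top_of_ne_zero (by norm_num) (by norm_num)

variable {μ : Measure X} {q : ℝ} {F : X → ℝ}

lemma pairIntegral_mono {A A' B B' : Set X} (hA : A ⊆ A') (hB : B ⊆ B') :
    pairIntegral μ q F A B ≤ pairIntegral μ q F A' B' :=
  lintegral_mono' (Measure.restrict_mono_set μ hA) fun _ => lintegral_mono_set hB

lemma pairIntegral_comm [SFinite μ] (hF : Measurable F) (A B : Set X) :
    pairIntegral μ q F A B = pairIntegral μ q F B A := by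
  unfold pairIntegral
  rw [lintegral_lintegral_swap (measurable_edist_rpow hF q).aemeasurable]
  simp_rw [edist_comm]

/-- Insert a point of `M` between `a` and `b` and integrate over `A × B × M`. When the three sets
have comparable measure, this is the link used in every chaining argument. -/
lemma pairIntegral_trans [SFinite μ] (hF : Measurable F) (hq : 1 ≤ q) (A B M : Set X) :
    pairIntegral μ q F A B * μ M ≤
      2 ^ (q - 1) * (pairIntegral μ q F A M * μ B + pairIntegral μ q F M B * μ A) := by
  have hk := measurable_edist_rpow hF q
  have hM : ∀ a b, edist (F a) (F b) ^ q * μ M ≤ 2 ^ (q - 1) *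
      ((∫⁻ m in M, edist (F a) (F m) ^ q ∂μ) + ∫⁻ m in M, edist (F m) (F b) ^ q ∂μ) := by
    intro a b
    rw [← lintegral_add_left (measurable_edist_rpow_right hF q _),
      ← lintegral_const_mul (f := fun m => edist (F a) (F m) ^ q + edist (F m) (F b) ^ q) _
        ((measurable_edist_rpow_right hF q _).add (measurable_edist_rpow_left hF q _))]
    calc edist (F a) (F b) ^ q * μ M = ∫⁻ m in M, edist (F a) (F b) ^ q ∂μ := by simp
      _ ≤ _ := lintegral_mono fun m => edist_rpow_le hq _ _ _
  have h1 : Measurable fun a => ∫⁻ m in M, edist (F a) (F m) ^ q ∂μ := hk.lintegral_prod_right'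
  have h2 : Measurable fun b => ∫⁻ m in M, edist (F m) (F b) ^ q ∂μ := hk.lintegral_prod_left'
  have h3 : Measurable fun a => ∫⁻ b in B, edist (F a) (F b) ^ q ∂μ := hk.lintegral_prod_right'
  calc pairIntegral μ q F A B * μ M
      = ∫⁻ a in A, ∫⁻ b in B, edist (F a) (F b) ^ q * μ M ∂μ ∂μ := by
        unfold pairIntegral
        rw [← lintegral_mul_const _ h3]
        refine lintegral_congr fun a => ?_
        rw [← lintegral_mul_const _ (measurable_edist_rpow_right hF q _)]
    _ ≤ ∫⁻ a in A, ∫⁻ b in B, 2 ^ (q - 1) * ((∫⁻ m in M, edist (F a) (F m) ^ q ∂μ) +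
          ∫⁻ m in M, edist (F m) (F b) ^ q ∂μ) ∂μ ∂μ :=
        lintegral_mono fun a => lintegral_mono fun b => hM a b
    _ = 2 ^ (q - 1) * ∫⁻ a in A, ((∫⁻ m in M, edist (F a) (F m) ^ q ∂μ) * μ B +
          pairIntegral μ q F M B) ∂μ := by
        rw [← lintegral_const_mul _ ((h1.mul_const _).add_const _)]
        refine lintegral_congr fun a => ?_
        rw [lintegral_const_mul _ (h2.const_add _), lintegral_add_left measurable_const]
        congr 2
        · simp
        · rw [pairIntegral, lintegral_lintegral_swap (f := fun a b => edist (F a) (F b) ^ q)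
            hk.aemeasurable]
    _ = _ := by
        rw [lintegral_add_right _ measurable_const, lintegral_mul_const _ h1]
        simp [pairIntegral]

lemma pairIntegral_biUnion_left_le {ι : Type*} (t : Finset ι) (A : ι → Set X) (B : Set X)
    {K : ℝ≥0∞} (h : ∀ i ∈ t, pairIntegral μ q F (A i) B ≤ K) :
    pairIntegral μ q F (⋃ i ∈ t, A i) B ≤ t.card * K := by
  classical
  induction t using Finset.induction_on with
  | empty => simp [pairIntegral]
  | insert i t hi ih =>
    rw [Finset.set_biUnion_insert, Finset.card_insert_of_notMem hi]
    refine (lintegral_union_le _ _ _).trans ?_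
    push_cast
    rw [add_mul, one_mul, add_comm]
    exact add_le_add (ih fun j hj => h j (Finset.mem_insert_of_mem hj))
      (h i (Finset.mem_insert_self i t))

lemma pairIntegral_biUnion_le [SFinite μ] {ι κ : Type*} (t : Finset ι) (s : Finset κ)
    (A : ι → Set X) (B : κ → Set X) (hF : Measurable F) {K : ℝ≥0∞}
    (h : ∀ i ∈ t, ∀ j ∈ s, pairIntegral μ q F (A i) (B j) ≤ K) :
    pairIntegral μ q F (⋃ i ∈ t, A i) (⋃ j ∈ s, B j) ≤ t.card * (s.card * K) := by
  refine pairIntegral_biUnion_left_le t A _ fun i hi => ?_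
  rw [pairIntegral_comm hF]
  refine pairIntegral_biUnion_left_le s B _ fun j hj => ?_
  rw [pairIntegral_comm hF]
  exact h i hi j hj

/-- Hölder's inequality against the constant 1, that is, Jensen's inequality without normalization.
-/
lemma lintegral_rpow_le_rpow_measure_mul {ν : Measure X} {h : X → ℝ≥0∞} (hq : 1 ≤ q)
    (hh : AEMeasurable h ν) :
    (∫⁻ x, h x ∂ν) ^ q ≤ ν univ ^ (q - 1) * ∫⁻ x, h x ^ q ∂ν := by
  have hq0 : (0 : ℝ) < q := by linarith
  have h1 := eLpNorm'_le_eLpNorm'_mul_rpow_measure_univ (μ := ν) (p := 1) (q := q) one_pos hq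
    hh.aestronglyMeasurable
  simp only [eLpNorm', enorm_eq_self, ENNReal.rpow_one, div_one] at h1
  have h2 := ENNReal.rpow_le_rpow h1 hq0.le
  rw [ENNReal.mul_rpow_of_nonneg _ _ hq0.le, ← ENNReal.rpow_mul, ← ENNReal.rpow_mul,
    one_div_mul_cancel hq0.ne', ENNReal.rpow_one, mul_comm] at h2
  convert h2 using 3
  field_simp

lemma ereal_abs_coe_sub_coe (a b : ℝ) : ((a : EReal) - (b : EReal)).abs = edist a b := by
  rw [← EReal.coe_sub, EReal.abs_def, edist_dist, Real.dist_eq]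

/-- Truncation of an extended real number at the levels `±N`. -/
noncomputable def clamp (N : ℝ) (a : EReal) : EReal := max (-N : ℝ) (min (N : ℝ) a)

lemma clamp_coe (N a : ℝ) : clamp N (a : EReal) = ((max (-N) (min N a) : ℝ) : EReal) := by
  rw [clamp, EReal.coe_strictMono.monotone.map_max, EReal.coe_strictMono.monotone.map_min]

lemma edist_clamp_le (N a b : ℝ) :
    edist (max (-N) (min N a)) (max (-N) (min N b)) ≤ edist a b := by
  have h1 := (LipschitzWith.id.const_min N (α := ℝ)).const_max (-N)
  simpa using h1 a b

/-- An infinite argument makes the right-hand side `∞`, also for `⊤ - ⊤`; for finite ones truncation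
is 1-Lipschitz. Hence truncation keeps upper gradients. -/
lemma ereal_abs_clamp_sub_le {N : ℝ} (a b : EReal) :
    (clamp N a - clamp N b).abs ≤ (a - b).abs := by
  induction a with
  | bot => simp
  | top =>
    induction b with
    | bot => simp
    | coe b => simp
    | top => simp
  | coe a =>
    induction b with
    | bot => simp
    | top => simp
    | coe b => 
      rw [clamp_coe, clamp_coe, ereal_abs_coe_sub_coe, ereal_abs_coe_sub_coe]
      exact edist_clamp_le _ _ _

lemma ereal_abs_clamp_le {N : ℝ} (hN : 0 ≤ N) (a : EReal) : (clamp N a).abs ≤ a.abs := by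
  have := ereal_abs_clamp_sub_le (N := N) a 0
  have h0 : clamp N 0 = 0 := by
    have := clamp_coe N 0
    simpa [hN] using this
  simpa [h0] using this

lemma measurable_clamp (N : ℝ) : Measurable (clamp N) := by
  unfold clamp
  exact measurable_const.max (measurable_const.min measurable_id)

lemma IsIntegrable.clamp {f : X → EReal} (hf : IsIntegrable f μ) {N : ℝ} (hN : 0 ≤ N) :
    IsIntegrable (fun x => clamp N (f x)) μ :=
  ⟨(measurable_clamp N).comp_aemeasurable hf.1,
    (lintegral_mono fun x => ereal_abs_clamp_le hN (f x)).trans_lt hf.2⟩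

lemma measurable_ereal_abs : Measurable EReal.abs := by
  have h : Measurable fun a : ℝ => (a : EReal).abs := by
    simp_rw [EReal.abs_def]
    exact measurable_norm.ennreal_ofReal
  exact EReal.measurable_of_measurable_real h

lemma IsIntegrable.exists_real_representative {f : X → EReal} (hf : IsIntegrable f μ) :
    ∃ F : X → ℝ, Measurable F ∧ Integrable F μ ∧ ∀ᵐ x ∂μ, f x = F x := by
  have h1 : ∀ᵐ x ∂μ, (f x).abs < ∞ :=
    ae_lt_top' (measurable_ereal_abs.comp_aemeasurable hf.1) hf.2.ne
  have h2 : ∀ᵐ x ∂μ, f x = ((hf.1.mk f x).toReal : EReal) := by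
    filter_upwards [h1, hf.1.ae_eq_mk] with x hx hx'
    rw [← hx']
    refine (EReal.coe_toReal ?_ ?_).symm
    · rintro h; simp [h] at hx
    · rintro h; simp [h] at hx
  have hm : Measurable fun x => (hf.1.mk f x).toReal :=
    measurable_ereal_toReal.comp hf.1.measurable_mk
  refine ⟨_, hm, ⟨hm.aestronglyMeasurable, ?_⟩, h2⟩
  rw [hasFiniteIntegral_iff_norm]
  refine lt_of_le_of_lt (le_of_eq (lintegral_congr_ae ?_)) hf.2
  filter_upwards [h2] with x hx
  rw [hx, EReal.abs_def, Real.norm_eq_abs]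

/-- Fatou's lemma: at each pair of points the truncations are eventually exact. This is what allows
`PairPoincare` to speak of bounded functions only. -/
lemma pairIntegral_le_of_clamp [SFinite μ] {F : X → ℝ} (hF : Measurable F)
    (A B : Set X) {c : ℝ≥0∞}
    (h : ∀ N : ℕ, pairIntegral μ q (fun x => max (-(N : ℝ)) (min N (F x))) A B ≤ c) :
    pairIntegral μ q F A B ≤ c := by
  have hm : ∀ N : ℕ, Measurable fun x => max (-(N : ℝ)) (min N (F x)) := fun N =>
    measurable_const.max (measurable_const.min hF)
  have hI : ∀ G : X → ℝ, Measurable G → pairIntegral μ q G A B =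
      ∫⁻ z, edist (G z.1) (G z.2) ^ q ∂((μ.restrict A).prod (μ.restrict B)) := fun G hG => by
    rw [lintegral_prod _ (measurable_edist_rpow hG q).aemeasurable]; rfl
  rw [hI F hF]
  have hlim : ∀ z : X × X, Filter.liminf (fun N : ℕ =>
      edist (max (-(N : ℝ)) (min N (F z.1))) (max (-(N : ℝ)) (min N (F z.2))) ^ q) Filter.atTop =
      edist (F z.1) (F z.2) ^ q := by
    intro z
    refine Filter.Tendsto.liminf_eq (tendsto_nhds_of_eventually_eq ?_)
    obtain ⟨N, hN⟩ := exists_nat_ge (max |F z.1| |F z.2|)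
    filter_upwards [Filter.eventually_ge_atTop N] with k hk
    have hk' : (N : ℝ) ≤ k := by exact_mod_cast hk
    have e1 := abs_le.1 (((le_max_left _ _).trans hN).trans hk')
    have e2 := abs_le.1 (((le_max_right _ _).trans hN).trans hk')
    rw [min_eq_right e1.2, min_eq_right e2.2, max_eq_right e1.1, max_eq_right e2.1]
  simp_rw [← hlim]
  refine (lintegral_liminf_le fun N => measurable_edist_rpow (hm N) q).trans ?_
  refine Filter.liminf_le_of_le ⟨0, by simp⟩ fun b hb => ?_
  obtain ⟨N, hN⟩ := hb.exists
  exact hN.trans ((hI _ (hm N)).symm.le.trans (h N))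

end PairIntegral

/-! ### Equivalence of the mean value form and the double integral form. -/

section Poincare

variable {X : Type*} [MetricSpace X] [MeasurableSpace X]

/-- The right-hand side of the Poincaré inequality in double integral form: with `B = B(x,r)`,
this is `μ(B)² r^q (μ(B)⁻¹ ∫_U G dμ)^(q/p)`. -/
noncomputable def poincareBound (μ : Measure X) (q p : ℝ) (G : X → ℝ≥0∞) (x : X) (r : ℝ)
    (U : Set X) : ℝ≥0∞ :=
  μ (Metric.ball x r) ^ 2 * ENNReal.ofReal r ^ q *
    ((μ (Metric.ball x r))⁻¹ * ∫⁻ w in U, G w ∂μ) ^ (q / p)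

/-- The Poincaré inequality in double integral form for bounded functions. -/
def PairPoincare (q p lam : ℝ) (μ : Measure X) : Prop :=
  ∃ C : ℝ≥0∞, C ≠ ∞ ∧ ∀ (f : X → EReal) (g : X → ℝ≥0∞) (F : X → ℝ), IsIntegrable f μ →
    IsUpperGradient g f → Measurable F → (∃ N : ℝ, ∀ x, |F x| ≤ N) → (∀ᵐ x ∂μ, f x = F x) →
    ∀ (x : X) (r : ℝ), 0 < r → pairIntegral μ q F (Metric.ball x r) (Metric.ball x r) ≤
      C * poincareBound μ q p (fun y => g y ^ p) x r (Metric.ball x (lam * r))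

lemma IsUpperGradient.clamp {f : X → EReal} {g : X → ℝ≥0∞} (hg : IsUpperGradient g f) (N : ℝ) :
    IsUpperGradient g (fun x => clamp N (f x)) :=
  ⟨hg.1, fun l γ hl hγ => (ereal_abs_clamp_sub_le _ _).trans (hg.2 l γ hl hγ)⟩

variable {μ : Measure X} {q p lam : ℝ}

/-- Compare both `F(a)` and `F(b)` with the mean value over the ball. -/
lemma pairPoincare_of_supportsPoincare [SFinite μ] (hq : 1 ≤ q) (hp : 1 ≤ p) (hlam : 1 ≤ lam)
    (hpos : ∀ (x : X) (r : ℝ), 0 < r → 0 < μ (Metric.ball x r))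
    (hfin : ∀ (x : X) (r : ℝ), μ (Metric.ball x r) < ∞)
    (h : SupportsPoincareWithDilation q p lam μ) : PairPoincare q p lam μ := by
  obtain ⟨C, hC, h⟩ := h
  have hq0 : (0 : ℝ) < q := by linarith
  have hp0 : (0 : ℝ) < p := by linarith
  refine ⟨2 ^ (q - 1) * (2 * ENNReal.ofReal C ^ q), ENNReal.mul_ne_top (two_rpow_ne_top _)
    (ENNReal.mul_ne_top (by norm_num) (ENNReal.rpow_ne_top_of_nonneg hq0.le
      ENNReal.ofReal_ne_top)), ?_⟩
  intro f g F hf hg hF _ hfF x r hr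
  have key := h x r hr f hf g hg
  set c := mean f μ (Metric.ball x r)
  set B := Metric.ball x r
  have hB0 : μ B ≠ 0 := (hpos x r hr).ne'
  have hBt : μ B ≠ ∞ := (hfin x r).ne
  have hbd : ∫⁻ y in B, edist (F y) c ^ q ∂μ ≤ μ B * (ENNReal.ofReal (C * r) ^ q *
      ((μ B)⁻¹ * ∫⁻ y in Metric.ball x (lam * r), g y ^ p ∂μ) ^ (q / p)) := by
    have h1 : (⨍⁻ y in B, (f y - (c : EReal)).abs ^ q ∂μ) =
        (μ B)⁻¹ * ∫⁻ y in B, edist (F y) c ^ q ∂μ := by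
      rw [setLAverage_eq, ENNReal.div_eq_inv_mul]
      congr 1
      refine lintegral_congr_ae (ae_restrict_of_ae ?_)
      filter_upwards [hfF] with y hy
      rw [hy, ereal_abs_coe_sub_coe]
    rw [h1] at key
    have h2 := ENNReal.rpow_le_rpow key hq0.le
    rw [← ENNReal.rpow_mul, one_div_mul_cancel hq0.ne', ENNReal.rpow_one,
      ENNReal.mul_rpow_of_nonneg _ _ hq0.le, ← ENNReal.rpow_mul, one_div_mul_eq_div] at h2
    calc ∫⁻ y in B, edist (F y) c ^ q ∂μ
        = μ B * ((μ B)⁻¹ * ∫⁻ y in B, edist (F y) c ^ q ∂μ) := by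
          rw [← mul_assoc, ENNReal.mul_inv_cancel hB0 hBt, one_mul]
      _ ≤ _ := by
          refine mul_le_mul_right (h2.trans ?_) _
          refine mul_le_mul_right (ENNReal.rpow_le_rpow ?_ (by positivity)) _
          rw [setLAverage_eq, ENNReal.div_eq_inv_mul]
          -- `poincareBound` normalizes by the measure of the undilated ball; since that measure is
          -- the smaller one, the right-hand side only grows.
          refine mul_le_mul_left (ENNReal.inv_le_inv.2 (measure_mono ?_)) _
          exact Metric.ball_subset_ball (by nlinarith)
  have hpair : pairIntegral μ q F B B ≤ 2 ^ (q - 1) * (2 * (μ B * ∫⁻ y in B, edist (F y) c ^ q ∂μ)) := by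
    have hm := measurable_edist_rpow_left hF q c
    calc pairIntegral μ q F B B
        ≤ ∫⁻ a in B, ∫⁻ b in B, 2 ^ (q - 1) * (edist (F a) c ^ q + edist (F b) c ^ q) ∂μ ∂μ :=
          lintegral_mono fun a => lintegral_mono fun b => by
            have := edist_rpow_le hq (F a) c (F b)
            rwa [edist_comm c] at this
      _ = _ := by
          have e : ∀ a, ∫⁻ b in B, 2 ^ (q - 1) * (edist (F a) c ^ q + edist (F b) c ^ q) ∂μ =
              2 ^ (q - 1) * (edist (F a) c ^ q * μ B + ∫⁻ b in B, edist (F b) c ^ q ∂μ) := by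
            intro a
            rw [lintegral_const_mul _ (hm.const_add _), lintegral_add_left measurable_const,
              lintegral_const, Measure.restrict_apply_univ]
          simp_rw [e]
          rw [lintegral_const_mul _ ((hm.mul_const _).add_const _),
            lintegral_add_right _ measurable_const, lintegral_mul_const _ hm]
          simp only [lintegral_const, Measure.restrict_apply_univ]
          ring
  refine hpair.trans ?_
  rw [mul_assoc]
  refine mul_le_mul_right ?_ _
  rw [mul_assoc]
  refine mul_le_mul_right ?_ _
  refine (mul_le_mul_right hbd _).trans (le_of_eq ?_)
  rw [poincareBound, ENNReal.ofReal_mul hC.le, ENNReal.mul_rpow_of_nonneg _ _ hq0.le]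
  ring

/-- With dilation 1 the two normalizations of the gradient integral coincide, so no doubling is
needed on the way back. -/
lemma supportsPoincare_of_pairPoincare [SFinite μ] (hq : 1 ≤ q) (hp : 1 ≤ p)
    (hpos : ∀ (x : X) (r : ℝ), 0 < r → 0 < μ (Metric.ball x r))
    (hfin : ∀ (x : X) (r : ℝ), μ (Metric.ball x r) < ∞)
    (h : PairPoincare q p 1 μ) : SupportsPoincareWithDilation q p 1 μ := by
  obtain ⟨C, hC, h⟩ := h
  have hq0 : (0 : ℝ) < q := by linarith
  have hp0 : (0 : ℝ) < p := by linarith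
  refine ⟨(C ^ (1 / q)).toReal + 1, by positivity, ?_⟩
  intro x r hr f hf g hg
  obtain ⟨F, hF, hFi, hfF⟩ := hf.exists_real_representative
  set B := Metric.ball x r
  have hB0 : μ B ≠ 0 := (hpos x r hr).ne'
  have hBt : μ B ≠ ∞ := (hfin x r).ne
  have hpair : pairIntegral μ q F B B ≤ C * poincareBound μ q p (fun y => g y ^ p) x r B := by
    refine pairIntegral_le_of_clamp hF B B fun N => ?_
    have := h _ g (fun x => max (-(N : ℝ)) (min N (F x))) (hf.clamp N.cast_nonneg)
      (hg.clamp N) (measurable_const.max (measurable_const.min hF))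
      ⟨N, fun x => abs_le.2 ⟨le_max_left _ _, max_le (by simp) (min_le_left _ _)⟩⟩ ?_ x r hr
    · simpa using this
    · filter_upwards [hfF] with y hy
      rw [hy, clamp_coe]
  have hmean : mean f μ B = ⨍ y in B, F y ∂μ := by
    unfold mean
    refine average_congr (ae_restrict_of_ae ?_)
    filter_upwards [hfF] with y hy
    rw [hy, EReal.toReal_coe]
  set c := mean f μ B
  -- `F(a) - c` is the mean over `b` of `F(a) - F(b)`; apply Jensen's inequality.
  have hpt : ∀ a, edist (F a) c ^ q ≤ (μ B)⁻¹ * ∫⁻ b in B, edist (F a) (F b) ^ q ∂μ := by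
    intro a
    have hme : Measurable fun b => edist (F a) (F b) := measurable_const.edist hF
    have h1 : edist (F a) c ≤ (μ B)⁻¹ * ∫⁻ b in B, edist (F a) (F b) ∂μ := by
      have hi : IntegrableOn F B μ := hFi.integrableOn
      have e1 : F a - c = ⨍ b in B, (F a - F b) ∂μ := by
        have : IsFiniteMeasure (μ.restrict B) := ⟨by simpa using hBt.lt_top⟩
        rw [hmean, setAverage_eq, setAverage_eq, integral_sub (integrable_const _) hi]
        rw [setIntegral_const, smul_sub, smul_smul, inv_mul_cancel₀, one_smul]
        exact (ENNReal.toReal_pos hB0 hBt).ne'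
      rw [edist_eq_enorm_sub, e1, setAverage_eq, enorm_smul]
      refine mul_le_mul' (le_of_eq ?_) ?_
      · rw [measureReal_def, ← ENNReal.toReal_inv, Real.enorm_eq_ofReal ENNReal.toReal_nonneg,
          ENNReal.ofReal_toReal (ENNReal.inv_ne_top.2 hB0)]
      · refine (enorm_integral_le_lintegral_enorm _).trans (le_of_eq ?_)
        simp_rw [edist_eq_enorm_sub]
    refine (ENNReal.rpow_le_rpow h1 hq0.le).trans ?_
    rw [ENNReal.mul_rpow_of_nonneg _ _ hq0.le]
    refine (mul_le_mul_right (lintegral_rpow_le_rpow_measure_mul hq hme.aemeasurable) _).trans ?_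
    rw [← mul_assoc, Measure.restrict_apply_univ]
    refine mul_le_mul_left (le_of_eq ?_) _
    rw [ENNReal.inv_rpow, ← ENNReal.rpow_neg, ← ENNReal.rpow_add _ _ hB0 hBt,
      ← ENNReal.rpow_neg_one]
    congr 1; ring
  have hk : Measurable fun a => ∫⁻ b in B, edist (F a) (F b) ^ q ∂μ :=
    (measurable_edist_rpow hF q).lintegral_prod_right'
  have hLHS : (⨍⁻ y in B, (f y - (c : EReal)).abs ^ q ∂μ) ≤
      C * (ENNReal.ofReal r ^ q * (⨍⁻ y in B, g y ^ p ∂μ) ^ (q / p)) := by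
    calc (⨍⁻ y in B, (f y - (c : EReal)).abs ^ q ∂μ)
        = (μ B)⁻¹ * ∫⁻ y in B, edist (F y) c ^ q ∂μ := by
          rw [setLAverage_eq, ENNReal.div_eq_inv_mul]
          congr 1
          refine lintegral_congr_ae (ae_restrict_of_ae ?_)
          filter_upwards [hfF] with y hy
          rw [hy, ereal_abs_coe_sub_coe]
      _ ≤ (μ B)⁻¹ * ((μ B)⁻¹ * pairIntegral μ q F B B) := by
          refine mul_le_mul_right ?_ _
          rw [pairIntegral, ← lintegral_const_mul _ hk]
          exact lintegral_mono fun a => hpt a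
      _ ≤ (μ B)⁻¹ * ((μ B)⁻¹ * (C * poincareBound μ q p (fun y => g y ^ p) x r B)) := by
          gcongr
      _ = ((μ B)⁻¹ * μ B) * ((μ B)⁻¹ * μ B) * (C * (ENNReal.ofReal r ^ q *
            ((μ B)⁻¹ * ∫⁻ y in B, g y ^ p ∂μ) ^ (q / p))) := by
          rw [poincareBound]; ring
      _ = _ := by
          rw [ENNReal.inv_mul_cancel hB0 hBt, setLAverage_eq, ENNReal.div_eq_inv_mul]; simp
  have := ENNReal.rpow_le_rpow hLHS (z := 1 / q) (by positivity)
  rw [one_mul]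
  refine this.trans ?_
  rw [ENNReal.mul_rpow_of_nonneg _ _ (by positivity), ENNReal.mul_rpow_of_nonneg _ _ (by positivity),
    ← ENNReal.rpow_mul, ← ENNReal.rpow_mul, mul_one_div_cancel hq0.ne', ENNReal.rpow_one,
    ENNReal.ofReal_mul (by positivity), mul_assoc]
  have e : q / p * (1 / q) = 1 / p := by field_simp
  rw [e]
  refine mul_le_mul_left ?_ _
  have hCt : C ^ (1 / q) ≠ ∞ := ENNReal.rpow_ne_top_of_nonneg (by positivity) hC
  calc C ^ (1 / q) = ENNReal.ofReal (C ^ (1 / q)).toReal := (ENNReal.ofReal_toReal hCt).symm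
    _ ≤ _ := ENNReal.ofReal_le_ofReal (by linarith)

end Poincare


/-! ### Doubling measures and comparison of nearby balls. -/

section Doubling

lemma ennreal_inv_le_mul_inv {m M c : ℝ≥0∞} (hM0 : M ≠ 0) (hMt : M ≠ ∞) (hm0 : m ≠ 0)
    (hmt : m ≠ ∞) (h : M ≤ c * m) : m⁻¹ ≤ c * M⁻¹ :=
  calc m⁻¹ = m⁻¹ * (M * M⁻¹) := by rw [ENNReal.mul_inv_cancel hM0 hMt, mul_one]
    _ ≤ m⁻¹ * (c * m * M⁻¹) := by gcongr
    _ = (m⁻¹ * m) * (c * M⁻¹) := by ring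
    _ = c * M⁻¹ := by rw [ENNReal.inv_mul_cancel hm0 hmt, one_mul]

lemma ennreal_le_of_mul_le_mul {a b m : ℝ≥0∞} (hm0 : m ≠ 0) (hmt : m ≠ ∞)
    (h : a * m ≤ b * m) : a ≤ b :=
  calc a = a * m * m⁻¹ := by rw [mul_assoc, ENNReal.mul_inv_cancel hm0 hmt, mul_one]
    _ ≤ b * m * m⁻¹ := by gcongr
    _ = b := by rw [mul_assoc, ENNReal.mul_inv_cancel hm0 hmt, mul_one]

variable {X : Type*} [MetricSpace X] [MeasurableSpace X]

/-- `μ` is doubling with constant `D`. -/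
structure DoublingWith (μ : Measure X) (D : ℝ≥0∞) : Prop where
  ne_top : D ≠ ∞
  pos : ∀ (x : X) (r : ℝ), 0 < r → 0 < μ (Metric.ball x r)
  lt_top : ∀ (x : X) (r : ℝ), μ (Metric.ball x r) < ∞
  le : ∀ (x : X) (r : ℝ), 0 < r → μ (Metric.ball x (2 * r)) ≤ D * μ (Metric.ball x r)

lemma IsDoubling.exists_doublingWith {μ : Measure X} (h : IsDoubling μ) :
    ∃ D, DoublingWith μ D := by
  obtain ⟨C, hC, h⟩ := h
  have hC0 : ENNReal.ofReal C ≠ 0 := by simpa using hC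
  refine ⟨ENNReal.ofReal C, ENNReal.ofReal_ne_top, fun x r hr => ?_, fun x r => ?_,
    fun x r hr => (h x r hr).2.1⟩
  · have := (h x (r / 2) (by positivity)).1
    rwa [mul_div_cancel₀ r two_ne_zero] at this
  · rcases le_or_gt r 0 with hr | hr
    · simp [Metric.ball_eq_empty.2 hr]
    · exact ENNReal.lt_top_of_mul_ne_top_right (h x r hr).2.2.ne hC0

variable {μ : Measure X} {D : ℝ≥0∞} {q p lam : ℝ}

lemma DoublingWith.ball_pow_le (h : DoublingWith μ D) (x : X) {r : ℝ} (hr : 0 < r) (k : ℕ) :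
    μ (Metric.ball x (2 ^ k * r)) ≤ D ^ k * μ (Metric.ball x r) := by
  induction k with
  | zero => simp
  | succ k ih =>
    calc μ (Metric.ball x (2 ^ (k + 1) * r)) = μ (Metric.ball x (2 * (2 ^ k * r))) := by
          congr 2; ring
      _ ≤ D * (D ^ k * μ (Metric.ball x r)) :=
          (h.le x _ (by positivity)).trans (mul_le_mul_right ih _)
      _ = _ := by ring

lemma DoublingWith.ball_le (h : DoublingWith μ D) {x y : X} {r s : ℝ} (hs : 0 < s) (k : ℕ)
    (hxy : dist x y + r ≤ 2 ^ k * s) :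
    μ (Metric.ball x r) ≤ D ^ k * μ (Metric.ball y s) :=
  (measure_mono (Metric.ball_subset_ball' (by linarith))).trans (h.ball_pow_le y hs k)

lemma DoublingWith.ball_ne_zero (h : DoublingWith μ D) (x : X) {r : ℝ} (hr : 0 < r) :
    μ (Metric.ball x r) ≠ 0 := (h.pos x r hr).ne'

lemma DoublingWith.ball_ne_top (h : DoublingWith μ D) (x : X) (r : ℝ) :
    μ (Metric.ball x r) ≠ ∞ := (h.lt_top x r).ne

lemma DoublingWith.pow_ne_top (h : DoublingWith μ D) (k : ℕ) : D ^ k ≠ ∞ :=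
  ENNReal.pow_ne_top h.ne_top

lemma DoublingWith.inv_ball_le (h : DoublingWith μ D) {x y : X} {r s : ℝ} (hr : 0 < r)
    (hs : 0 < s) (k : ℕ) (hxy : dist x y + r ≤ 2 ^ k * s) :
    (μ (Metric.ball y s))⁻¹ ≤ D ^ k * (μ (Metric.ball x r))⁻¹ :=
  ennreal_inv_le_mul_inv (h.ball_ne_zero x hr) (h.ball_ne_top x r) (h.ball_ne_zero y hs)
    (h.ball_ne_top y s) (h.ball_le hs k hxy)

lemma sigmaFinite_of_ball_lt_top (h : ∀ (x : X) (r : ℝ), μ (Metric.ball x r) < ∞) :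
    SigmaFinite μ := by
  rcases isEmpty_or_nonempty X with hX | ⟨⟨x⟩⟩
  · rw [Measure.eq_zero_of_isEmpty μ]; infer_instance
  · exact ⟨⟨⟨fun n : ℕ => Metric.ball x n, fun _ => trivial, fun n => h x n,
      Metric.iUnion_ball_nat x⟩⟩⟩

lemma poincareBound_le (hq : 0 ≤ q) (hp : 0 ≤ p) {G : X → ℝ≥0∞} {x y : X} {r s : ℝ}
    {U V : Set X} {c c' : ℝ≥0∞} {t : ℝ} (h1 : μ (Metric.ball x r) ≤ c * μ (Metric.ball y s))
    (h2 : (μ (Metric.ball x r))⁻¹ ≤ c' * (μ (Metric.ball y s))⁻¹) (hs : 0 ≤ s) (hr : r ≤ t * s)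
    (hUV : U ⊆ V) :
    poincareBound μ q p G x r U ≤
      c ^ 2 * ENNReal.ofReal t ^ q * c' ^ (q / p) * poincareBound μ q p G y s V := by
  have hqp : 0 ≤ q / p := by positivity
  have h3 : ENNReal.ofReal r ≤ ENNReal.ofReal t * ENNReal.ofReal s := by
    rw [← ENNReal.ofReal_mul' hs]
    exact ENNReal.ofReal_le_ofReal hr
  calc poincareBound μ q p G x r U
      ≤ (c * μ (Metric.ball y s)) ^ 2 * (ENNReal.ofReal t * ENNReal.ofReal s) ^ q *
        (c' * (μ (Metric.ball y s))⁻¹ * ∫⁻ w in V, G w ∂μ) ^ (q / p) := by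
        refine mul_le_mul' (mul_le_mul' (pow_le_pow_left' h1 2) (ENNReal.rpow_le_rpow h3 hq))
          (ENNReal.rpow_le_rpow (mul_le_mul' h2 (lintegral_mono_set hUV)) hqp)
    _ = _ := by
        rw [poincareBound, ENNReal.mul_rpow_of_nonneg _ _ hq, mul_assoc c' _ _,
          ENNReal.mul_rpow_of_nonneg _ _ hqp]
        ring

/-- The constant in the comparison of `poincareBound` for two comparable balls. -/
noncomputable def compareConst (D : ℝ≥0∞) (q p : ℝ) (k : ℕ) : ℝ≥0∞ :=
  (D ^ k) ^ 2 * ENNReal.ofReal (2 ^ k) ^ q * (D ^ k) ^ (q / p)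

lemma DoublingWith.compareConst_ne_top (h : DoublingWith μ D) (hq : 0 ≤ q) (hp : 0 ≤ p) (k : ℕ) :
    compareConst D q p k ≠ ∞ :=
  ENNReal.mul_ne_top (ENNReal.mul_ne_top (ENNReal.pow_ne_top (h.pow_ne_top k))
    (ENNReal.rpow_ne_top_of_nonneg hq ENNReal.ofReal_ne_top))
    (ENNReal.rpow_ne_top_of_nonneg (by positivity) (h.pow_ne_top k))

lemma DoublingWith.poincareBound_le (h : DoublingWith μ D) (hq : 0 ≤ q) (hp : 0 ≤ p)
    {G : X → ℝ≥0∞} {x y : X} {r s : ℝ} {U V : Set X} (hr : 0 < r) (hs : 0 < s) (k : ℕ)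
    (h1 : dist x y + r ≤ 2 ^ k * s) (h2 : dist x y + s ≤ 2 ^ k * r) (hUV : U ⊆ V) :
    poincareBound μ q p G x r U ≤ compareConst D q p k * poincareBound μ q p G y s V :=
  BowTie.poincareBound_le hq hp (h.ball_le hs k h1)
    (h.inv_ball_le hs hr k (by rwa [dist_comm])) hs.le
    (by linarith [dist_nonneg (x := x) (y := y)]) hUV

end Doubling

/-! ### Chaining balls inside a convex set. -/

section Chain

variable {E : Type*} [NormedAddCommGroup E] [NormedSpace ℝ E] [MeasurableSpace E]
  {μ : Measure E} [SFinite μ] {D : ℝ≥0∞} {q p lam : ℝ}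

/-- Induction on `J` by bisection. If the centres are within `ρ/(2λ)`, both balls lie in `B(a,ρ/λ)`,
whose dilation `B(a,ρ)` is inside `U`. Otherwise go through the ball at the midpoint, which halves
the distance. The constant does not depend on `U`, `ρ` or the centres. -/
lemma DoublingWith.exists_pairIntegral_ball_le (hμ : DoublingWith μ D) (hq : 1 ≤ q) (hp : 1 ≤ p)
    (hlam : 1 ≤ lam) {C : ℝ≥0∞} (hC : C ≠ ∞) (J : ℕ) :
    ∃ K : ℝ≥0∞, K ≠ ∞ ∧ ∀ (F : E → ℝ) (G : E → ℝ≥0∞), Measurable F →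
      (∀ (x : E) (r : ℝ), 0 < r → pairIntegral μ q F (Metric.ball x r) (Metric.ball x r) ≤
        C * poincareBound μ q p G x r (Metric.ball x (lam * r))) →
      ∀ (U : Set E), Convex ℝ U → ∀ (ρ : ℝ), 0 < ρ → ∀ (a b : E), Metric.ball a ρ ⊆ U →
      Metric.ball b ρ ⊆ U → dist a b ≤ 2 ^ J * (ρ / (2 * lam)) →
      pairIntegral μ q F (Metric.ball a (ρ / (2 * lam))) (Metric.ball b (ρ / (2 * lam))) ≤
        K * poincareBound μ q p G a ρ U := by
  have hq0 : 0 ≤ q := by linarith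
  have hp0 : 0 ≤ p := by linarith
  have hl0 : 0 < lam := by linarith
  induction J with
  | zero =>
    obtain ⟨k, hk⟩ := pow_unbounded_of_one_lt lam (one_lt_two)
    refine ⟨C * compareConst D q p k, ENNReal.mul_ne_top hC (hμ.compareConst_ne_top hq0 hp0 k), ?_⟩
    intro F G hF hFG U hU ρ hρ a b ha hb hab
    have e : lam * (ρ / lam) = ρ := by field_simp
    have e2 : ρ / (2 * lam) = (ρ / lam) / 2 := by field_simp
    have hs : 0 < ρ / lam := by positivity
    have h1 := hFG a (ρ / lam) hs
    rw [e] at h1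
    refine (pairIntegral_mono (Metric.ball_subset_ball (by linarith))
      (Metric.ball_subset_ball' ?_)).trans (h1.trans ?_)
    · rw [dist_comm]; linarith
    rw [mul_assoc]
    refine mul_le_mul_right (hμ.poincareBound_le hq0 hp0 hs hρ k ?_ ?_ ha) _
    · rw [dist_self, zero_add]
      have h2 : (1 : ℝ) ≤ 2 ^ k := one_le_pow₀ (by norm_num)
      have h3 : ρ / lam ≤ ρ := div_le_self hρ.le hlam
      nlinarith
    · rw [dist_self, zero_add]
      calc ρ = lam * (ρ / lam) := e.symm
        _ ≤ _ := by gcongr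
  | succ J ih =>
    obtain ⟨K, hK, ih⟩ := ih
    refine ⟨2 ^ (q - 1) * (K * D ^ (J + 1) + K * compareConst D q p (J + 1) * D ^ (J + 1)),
      ENNReal.mul_ne_top (two_rpow_ne_top _) (ENNReal.add_ne_top.2
        ⟨ENNReal.mul_ne_top hK (hμ.pow_ne_top _), ENNReal.mul_ne_top (ENNReal.mul_ne_top hK
          (hμ.compareConst_ne_top hq0 hp0 _)) (hμ.pow_ne_top _)⟩), ?_⟩
    intro F G hF hFG U hU ρ hρ a b ha hb hab
    set m := midpoint ℝ a b with hm
    set δ := ρ / (2 * lam) with hδ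
    have hδ0 : 0 < δ := by positivity
    have hδρ : δ ≤ ρ / 2 := by
      rw [hδ, div_le_div_iff₀ (by positivity) (by positivity)]; nlinarith
    have h2J : (1 : ℝ) ≤ 2 ^ J := one_le_pow₀ (by norm_num)
    have ham : dist a m ≤ 2 ^ J * δ := by
      rw [hm, dist_left_midpoint, Real.norm_ofNat]; rw [pow_succ] at hab; linarith
    have hmb : dist m b ≤ 2 ^ J * δ := by
      rw [hm, dist_midpoint_right, Real.norm_ofNat]; rw [pow_succ] at hab; linarith
    have hmU : Metric.ball m ρ ⊆ U := by
      intro z hz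
      -- A point of the ball about the midpoint is the midpoint of its translates in the two end
      -- balls, so convexity of `U` applies.
      have e : z = midpoint ℝ (a + (z - m)) (b + (z - m)) := by
        rw [midpoint_eq_smul_add, hm, midpoint_eq_smul_add, invOf_eq_inv]; module
      rw [e]
      rw [mem_ball_iff_norm] at hz
      exact hU.midpoint_mem (ha (by simpa [mem_ball_iff_norm] using hz))
        (hb (by simpa [mem_ball_iff_norm] using hz))
    have h1 := ih F G hF hFG U hU ρ hρ a m ha hmU ham
    have h2 := ih F G hF hFG U hU ρ hρ m b hmU hb hmb
    have h3 : poincareBound μ q p G m ρ U ≤ compareConst D q p (J + 1) *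
        poincareBound μ q p G a ρ U := by
      have : dist m a + ρ ≤ 2 ^ (J + 1) * ρ := by
        rw [dist_comm, pow_succ]; nlinarith
      exact hμ.poincareBound_le hq0 hp0 hρ hρ (J + 1) this this subset_rfl
    have hA : μ (Metric.ball a δ) ≤ D ^ (J + 1) * μ (Metric.ball m δ) :=
      hμ.ball_le hδ0 _ (by rw [pow_succ]; nlinarith)
    have hB : μ (Metric.ball b δ) ≤ D ^ (J + 1) * μ (Metric.ball m δ) :=
      hμ.ball_le hδ0 _ (by rw [dist_comm, pow_succ]; nlinarith)
    refine ennreal_le_of_mul_le_mul (hμ.ball_ne_zero m hδ0) (hμ.ball_ne_top m δ) ?_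
    refine (pairIntegral_trans hF hq _ _ (Metric.ball m δ)).trans ?_
    calc _ ≤ 2 ^ (q - 1) * (K * poincareBound μ q p G a ρ U * (D ^ (J + 1) * μ (Metric.ball m δ)) +
          K * (compareConst D q p (J + 1) * poincareBound μ q p G a ρ U) *
            (D ^ (J + 1) * μ (Metric.ball m δ))) := by
          have h4 := h2.trans (mul_le_mul_right h3 K)
          exact mul_le_mul_right (add_le_add (mul_le_mul' h1 hB) (mul_le_mul' h4 hA)) _
      _ = _ := by ring

/-- Cut `Z` into boundedly many pieces of diameter below `ρ/(2λ)` and chain between any two of them.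
-/
lemma DoublingWith.exists_pairIntegral_region_le [FiniteDimensional ℝ E] (hμ : DoublingWith μ D)
    (hq : 1 ≤ q) (hp : 1 ≤ p) (hlam : 1 ≤ lam) {C : ℝ≥0∞} (hC : C ≠ ∞) (L : ℝ) :
    ∃ K : ℝ≥0∞, K ≠ ∞ ∧ ∀ (F : E → ℝ) (G : E → ℝ≥0∞), Measurable F →
      (∀ (x : E) (r : ℝ), 0 < r → pairIntegral μ q F (Metric.ball x r) (Metric.ball x r) ≤
        C * poincareBound μ q p G x r (Metric.ball x (lam * r))) →
      ∀ (U : Set E), Convex ℝ U → ∀ (ρ : ℝ), 0 < ρ → ∀ (x : E) (Z : Set E),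
      Z ⊆ Metric.ball x (L * ρ) → (∀ b ∈ Z, Metric.ball b ρ ⊆ U) →
      pairIntegral μ q F Z Z ≤ K * poincareBound μ q p G x ρ U := by
  have hq0 : 0 ≤ q := by linarith
  have hp0 : 0 ≤ p := by linarith
  have hl0 : 0 < lam := by linarith
  have : ProperSpace E := FiniteDimensional.proper_real E
  -- The cover is chosen at unit scale, before `x` and `ρ`, so the number of pieces after rescaling
  -- is uniform.
  obtain ⟨t, -, ht⟩ := (isCompact_closedBall (0 : E) L).elim_nhds_subcover
    (fun c => Metric.ball c (1 / (4 * lam))) fun c _ => Metric.ball_mem_nhds c (by positivity)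
  obtain ⟨J, hJ⟩ := pow_unbounded_of_one_lt (4 * L * lam) (one_lt_two)
  obtain ⟨k, hk⟩ := pow_unbounded_of_one_lt (L + 1) (one_lt_two)
  obtain ⟨K, hK, H⟩ := hμ.exists_pairIntegral_ball_le hq hp hlam hC J
  refine ⟨t.card * (t.card * (K * compareConst D q p k)), ENNReal.mul_ne_top (by simp)
    (ENNReal.mul_ne_top (by simp) (ENNReal.mul_ne_top hK (hμ.compareConst_ne_top hq0 hp0 k))), ?_⟩
  intro F G hF hFG U hU ρ hρ x Z hZ hZU
  set A : E → Set E := fun c => Z ∩ Metric.ball (x + ρ • c) (ρ / (4 * lam)) with hA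
  have hcov : Z ⊆ ⋃ c ∈ t, A c := by
    intro z hz
    have hzL := mem_ball_iff_norm.1 (hZ hz)
    have h1 : ρ⁻¹ • (z - x) ∈ Metric.closedBall (0 : E) L := by
      rw [mem_closedBall_zero_iff, norm_smul, norm_inv, Real.norm_of_nonneg hρ.le,
        inv_mul_le_iff₀ hρ]
      linarith
    obtain ⟨c, hc, hzc⟩ := mem_iUnion₂.1 (ht h1)
    refine mem_iUnion₂.2 ⟨c, hc, hz, ?_⟩
    rw [mem_ball_iff_norm] at hzc ⊢
    have e : z - (x + ρ • c) = ρ • (ρ⁻¹ • (z - x) - c) := by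
      rw [smul_sub, smul_inv_smul₀ hρ.ne']; abel
    rw [e, norm_smul, Real.norm_of_nonneg hρ.le]
    calc ρ * ‖ρ⁻¹ • (z - x) - c‖ < ρ * (1 / (4 * lam)) := by gcongr
      _ = _ := by ring
  have hball : ∀ c, ∀ b ∈ A c, A c ⊆ Metric.ball b (ρ / (2 * lam)) := by
    intro c b hb z hz
    have h1 := Metric.mem_ball.1 hb.2
    have h2 := Metric.mem_ball.1 hz.2
    rw [Metric.mem_ball]
    have h3 := dist_triangle_right z b (x + ρ • c)
    have e : ρ / (2 * lam) = ρ / (4 * lam) + ρ / (4 * lam) := by field_simp; norm_num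
    linarith
  refine (pairIntegral_mono hcov hcov).trans ?_
  rw [mul_assoc, mul_assoc]
  refine pairIntegral_biUnion_le t t A A hF fun i _ j _ => ?_
  rcases (A i).eq_empty_or_nonempty with hi | ⟨a, ha⟩
  · simp [hi, pairIntegral]
  rcases (A j).eq_empty_or_nonempty with hj | ⟨b, hb⟩
  · simp [hj, pairIntegral]
  refine (pairIntegral_mono (hball i a ha) (hball j b hb)).trans ?_
  have hax := Metric.mem_ball.1 (hZ ha.1)
  have hbx := Metric.mem_ball.1 (hZ hb.1)
  refine (H F G hF hFG U hU ρ hρ a b (hZU a ha.1) (hZU b hb.1) ?_).trans ?_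
  · have h1 := dist_triangle_right a b x
    have h2 : 2 * L * ρ = (4 * L * lam) * (ρ / (2 * lam)) := by field_simp; ring
    have h3 : (4 * L * lam) * (ρ / (2 * lam)) ≤ 2 ^ J * (ρ / (2 * lam)) := by gcongr
    linarith
  · rw [mul_assoc]
    have : dist a x + ρ ≤ 2 ^ k * ρ := by nlinarith
    exact mul_le_mul_right (hμ.poincareBound_le hq0 hp0 hρ hρ k this this subset_rfl) _

end Chain


/-! ### Averaging kernels and the absorption argument. -/

section Kernel

variable {X : Type*} [MeasurableSpace X] {μ : Measure X} [SFinite μ]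

omit [SFinite μ] in
lemma lintegral_const_mul_add {a b : X → ℝ≥0∞} (ha : Measurable a) (hb : Measurable b)
    (c : ℝ≥0∞) : ∫⁻ z, c * (a z + b z) ∂μ = c * (∫⁻ z, a z ∂μ + ∫⁻ z, b z ∂μ) := by
  rw [← lintegral_add_left ha]
  exact lintegral_const_mul _ (ha.add hb)

/-- For each `i`, average `|F(y) - c|^q ≤ 2^(q-1) (|F(y) - F(z)|^q + |F(z) - c|^q)` over `z` with
weight `κ i (y, z)`, then sum over `i`. The left-hand side is counted `t.card` times, whereas by
`h2` the error term on `B` is paid for only once. -/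
lemma lintegral_le_of_kernel {ι : Type*} (t : Finset ι) {κ : ι → X × X → ℝ≥0∞}
    (hκ : ∀ i, Measurable (κ i)) {O B : Set X} (hO : MeasurableSet O) (hB : MeasurableSet B)
    {F : X → ℝ} (hF : Measurable F) {q : ℝ} (hq : 1 ≤ q) (c : ℝ) {c₁ c₂ : ℝ≥0∞}
    (h1 : ∀ i ∈ t, ∀ y ∈ O, 1 ≤ c₁ * ∫⁻ z, κ i (y, z) ∂μ)
    (h0 : ∀ i, ∀ y ∈ O, ∀ z, z ∉ B → κ i (y, z) = 0)
    (h2 : ∀ z ∈ B, ∑ i ∈ t, ∫⁻ y in O, κ i (y, z) ∂μ ≤ c₂) :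
    t.card * ∫⁻ y in O, edist (F y) c ^ q ∂μ ≤ c₁ * 2 ^ (q - 1) *
      (∑ i ∈ t, ∫⁻ y in O, ∫⁻ z, edist (F y) (F z) ^ q * κ i (y, z) ∂μ ∂μ +
        c₂ * ∫⁻ z in B, edist (F z) c ^ q ∂μ) := by
  have hk := measurable_edist_rpow hF q
  have hU := measurable_edist_rpow_left hF q c
  have hκy : ∀ i y, Measurable fun z => κ i (y, z) := fun i y => (hκ i).comp measurable_prodMk_left
  have hκz : ∀ i z, Measurable fun y => κ i (y, z) := fun i z => (hκ i).comp measurable_prodMk_right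
  have step : ∀ i ∈ t, ∫⁻ y in O, edist (F y) c ^ q ∂μ ≤ c₁ * 2 ^ (q - 1) *
      ((∫⁻ y in O, ∫⁻ z, edist (F y) (F z) ^ q * κ i (y, z) ∂μ ∂μ) +
        ∫⁻ z, edist (F z) c ^ q * ∫⁻ y in O, κ i (y, z) ∂μ ∂μ) := by
    intro i hi
    have m1 : Measurable fun w : X × X => edist (F w.1) (F w.2) ^ q * κ i w := hk.mul (hκ i)
    have m2 : Measurable fun w : X × X => edist (F w.2) c ^ q * κ i w :=
      (hU.comp measurable_snd).mul (hκ i)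
    have m1' : Measurable fun y => ∫⁻ z, edist (F y) (F z) ^ q * κ i (y, z) ∂μ :=
      m1.lintegral_prod_right'
    have m2' : Measurable fun y => ∫⁻ z, edist (F z) c ^ q * κ i (y, z) ∂μ :=
      m2.lintegral_prod_right'
    calc ∫⁻ y in O, edist (F y) c ^ q ∂μ
        ≤ ∫⁻ y in O, c₁ * 2 ^ (q - 1) * ((∫⁻ z, edist (F y) (F z) ^ q * κ i (y, z) ∂μ) +
            ∫⁻ z, edist (F z) c ^ q * κ i (y, z) ∂μ) ∂μ := by
          refine setLIntegral_mono' hO fun y hy => ?_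
          calc edist (F y) c ^ q ≤ edist (F y) c ^ q * (c₁ * ∫⁻ z, κ i (y, z) ∂μ) :=
                le_mul_of_one_le_right' (h1 i hi y hy)
            _ = c₁ * ∫⁻ z, edist (F y) c ^ q * κ i (y, z) ∂μ := by
                rw [lintegral_const_mul _ (hκy i y)]; ring
            _ ≤ c₁ * ∫⁻ z, 2 ^ (q - 1) * (edist (F y) (F z) ^ q * κ i (y, z) +
                  edist (F z) c ^ q * κ i (y, z)) ∂μ := by
                refine mul_le_mul_right (lintegral_mono fun z => ?_) _
                refine (mul_le_mul_left (edist_rpow_le hq (F y) (F z) c) _).trans (le_of_eq ?_)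
                ring
            _ = _ := by
                have a1 : Measurable fun z => edist (F y) (F z) ^ q * κ i (y, z) :=
                  m1.comp measurable_prodMk_left
                have a2 : Measurable fun z => edist (F z) c ^ q * κ i (y, z) :=
                  m2.comp measurable_prodMk_left
                rw [lintegral_const_mul_add a1 a2, mul_assoc]
      _ = _ := by
          rw [lintegral_const_mul_add m1' m2']
          congr 2
          rw [lintegral_lintegral_swap (f := fun y z => edist (F z) c ^ q * κ i (y, z))
            m2.aemeasurable]
          exact lintegral_congr fun z => lintegral_const_mul _ (hκz i z)
  have hsum := Finset.sum_le_sum step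
  rw [Finset.sum_const, nsmul_eq_mul, ← Finset.mul_sum, Finset.sum_add_distrib] at hsum
  refine hsum.trans (mul_le_mul_right (add_le_add le_rfl ?_) _)
  have m3 : ∀ i, Measurable fun z => edist (F z) c ^ q * ∫⁻ y in O, κ i (y, z) ∂μ := fun i =>
    hU.mul (hκ i).lintegral_prod_left'
  rw [← lintegral_finsetSum _ fun i _ => m3 i, ← lintegral_const_mul _ hU,
    ← lintegral_indicator hB]
  refine lintegral_mono fun z => ?_
  dsimp only
  rw [← Finset.mul_sum]
  by_cases hz : z ∈ B
  · rw [indicator_of_mem hz, mul_comm]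
    exact mul_le_mul_left (h2 z hz) _
  · rw [indicator_of_notMem hz]
    have : ∀ i, ∫⁻ y in O, κ i (y, z) ∂μ = 0 := fun i => by
      rw [setLIntegral_congr_fun hO (fun y hy => h0 i y hy z hz)]; simp
    simp [this]

/-- Here `X`, `I`, `Y` play the integrals over the boundary layer, the interior and the whole ball.
After doubling, the term in `Y` on the right is at most `M * Y`, which can be cancelled because `Y`
is finite. -/
lemma ennreal_absorb {X Y I S P a M : ℝ≥0∞} (hY : Y ≠ ∞) (hMt : M ≠ ∞) (hM1 : 1 ≤ M)
    (hM : 2 * (P * a) ≤ M) (h : M * X ≤ P * (S + a * Y)) (hYX : Y ≤ I + X) :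
    Y ≤ 2 * M * I + 2 * P * S := by
  have h1 : M * Y + M * Y ≤ (2 * M * I + 2 * P * S) + M * Y :=
    calc M * Y + M * Y = 2 * (M * Y) := by ring
      _ ≤ 2 * (M * (I + X)) := by gcongr
      _ = 2 * M * I + 2 * (M * X) := by ring
      _ ≤ 2 * M * I + 2 * (P * (S + a * Y)) := by gcongr
      _ = 2 * M * I + 2 * P * S + 2 * (P * a) * Y := by ring
      _ ≤ _ := by gcongr
  exact (le_mul_of_one_le_left' hM1).trans
    ((ENNReal.add_le_add_iff_right (ENNReal.mul_ne_top hMt hY)).1 h1)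

end Kernel

/-! ### Distance to the boundary of a ball. -/

section Depth

variable {E : Type*} [NormedAddCommGroup E]

/-- The distance from `z` to the complement of the ball `B(x₀,r)`, for `z` in the ball. -/
def depth (x₀ : E) (r : ℝ) (z : E) : ℝ := r - dist z x₀

variable {x₀ : E} {r : ℝ}

lemma continuous_depth : Continuous (depth x₀ r) := by unfold depth; fun_prop

lemma depth_le_add (z w : E) : depth x₀ r z ≤ depth x₀ r w + dist z w := by
  have := dist_triangle w z x₀
  rw [dist_comm w z] at this
  unfold depth; linarith

lemma depth_le (z : E) : depth x₀ r z ≤ r := by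
  unfold depth; linarith [dist_nonneg (x := z) (y := x₀)]

lemma mem_ball_iff_depth_pos {z : E} : z ∈ Metric.ball x₀ r ↔ 0 < depth x₀ r z := by
  rw [Metric.mem_ball, depth, sub_pos]

lemma exists_depth_eq [NormedSpace ℝ E] {y : E} {τ : ℝ} (h1 : depth x₀ r y ≤ τ) (h2 : τ ≤ r) :
    ∃ φ, depth x₀ r φ = τ ∧ dist y φ = τ - depth x₀ r y := by
  unfold depth at *
  rcases eq_or_ne y x₀ with rfl | hy
  · exact ⟨y, by simp at h1 ⊢; linarith, by simp at h1 ⊢; linarith⟩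
  · have hn : 0 < dist y x₀ := dist_pos.2 hy
    refine ⟨x₀ + ((r - τ) / dist y x₀) • (y - x₀), ?_, ?_⟩
    · rw [dist_eq_norm (x₀ + _), add_sub_cancel_left, norm_smul, ← dist_eq_norm y, norm_div,
        Real.norm_of_nonneg hn.le, div_mul_cancel₀ _ hn.ne', Real.norm_of_nonneg (by linarith)]
      ring
    · have e : y - (x₀ + ((r - τ) / dist y x₀) • (y - x₀)) =
          (1 - (r - τ) / dist y x₀) • (y - x₀) := by module
      have h3 : (r - τ) / dist y x₀ ≤ 1 := by rw [div_le_one hn]; linarith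
      rw [dist_eq_norm, e, norm_smul, ← dist_eq_norm y, Real.norm_of_nonneg (by linarith), sub_mul,
        div_mul_cancel₀ _ hn.ne']
      ring

end Depth

/-! ### Comparison with points deeper inside the ball. -/

section Whitney

variable {E : Type*} [NormedAddCommGroup E] [MeasurableSpace E] [BorelSpace E]
  [SecondCountableTopology E] {μ : Measure E} [SFinite μ] {D : ℝ≥0∞} {x₀ : E} {r : ℝ}

/-- The measure of the largest ball around `z` in the ball `B(x₀,r)`. -/
noncomputable def whitneyMeasure (μ : Measure E) (x₀ : E) (r : ℝ) (z : E) : ℝ≥0∞ :=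
  μ (Metric.ball z (depth x₀ r z))

lemma measurable_whitneyMeasure : Measurable (whitneyMeasure μ x₀ r) := by
  have h : MeasurableSet {w : E × E | dist w.2 w.1 < depth x₀ r w.1} :=
    measurableSet_lt (by fun_prop) (continuous_depth.measurable.comp measurable_fst)
  exact measurable_measure_prodMk_left h

/-- The pairs `(y,z)` such that `z` is deeper inside the ball than `y` by a factor `4^i`. -/
def shiftSet (x₀ : E) (r : ℝ) (i : ℕ) : Set (E × E) :=
  {w | dist w.2 w.1 < 4 ^ (i + 1) * depth x₀ r w.1 ∧ 4 ^ i * depth x₀ r w.1 ≤ depth x₀ r w.2 ∧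
    depth x₀ r w.2 < 4 ^ (i + 1) * depth x₀ r w.1}

omit [MeasurableSpace E] [BorelSpace E] [SecondCountableTopology E] in
lemma depth_pos_of_mem_shiftSet {i : ℕ} {w : E × E} (h : w ∈ shiftSet x₀ r i) :
    0 < depth x₀ r w.1 := by
  obtain ⟨-, h2, h3⟩ := h
  have h4 : (0 : ℝ) < 4 ^ i := by positivity
  rw [pow_succ] at h3
  nlinarith

lemma measurableSet_shiftSet (i : ℕ) : MeasurableSet (shiftSet x₀ r i) := by
  have h1 : Measurable fun w : E × E => depth x₀ r w.1 :=
    continuous_depth.measurable.comp measurable_fst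
  have h2 : Measurable fun w : E × E => depth x₀ r w.2 :=
    continuous_depth.measurable.comp measurable_snd
  exact (measurableSet_lt (by fun_prop) (h1.const_mul _)).inter
    ((measurableSet_le (h1.const_mul _) h2).inter (measurableSet_lt h2 (h1.const_mul _)))

/-- The averaging kernel over the pairs in `shiftSet`. -/
noncomputable def shiftKernel (μ : Measure E) (x₀ : E) (r : ℝ) (i : ℕ) (w : E × E) : ℝ≥0∞ :=
  (shiftSet x₀ r i).indicator (fun w => (whitneyMeasure μ x₀ r w.2)⁻¹) w

lemma measurable_shiftKernel (i : ℕ) : Measurable (shiftKernel μ x₀ r i) :=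
  ((measurable_whitneyMeasure.comp measurable_snd).inv).indicator (measurableSet_shiftSet i)

/-- With `s = 4^i · depth y`, move `y` radially to a point `φ` of depth `2s`, which exists since `2s
≤ r`. Every `z` in `B(φ,s)` is paired with `y`, and its Whitney ball has radius below `3s`, hence
measure at most `D^4 μ(B(φ,s))`. -/
lemma DoublingWith.one_le_lintegral_shiftKernel [NormedSpace ℝ E] (hμ : DoublingWith μ D) {i : ℕ}
    {y : E} (hy : 0 < depth x₀ r y) (hyr : 2 * (4 ^ i * depth x₀ r y) ≤ r) :
    1 ≤ D ^ 4 * ∫⁻ z, shiftKernel μ x₀ r i (y, z) ∂μ := by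
  set s := 4 ^ i * depth x₀ r y with hs
  have h4 : (1 : ℝ) ≤ 4 ^ i := one_le_pow₀ (by norm_num)
  have hs0 : 0 < s := by positivity
  have hys : depth x₀ r y ≤ s := by rw [hs]; nlinarith
  obtain ⟨φ, hφ, hyφ⟩ := exists_depth_eq (x₀ := x₀) (y := y) (τ := 2 * s) (by linarith) hyr
  have hpow : (4 : ℝ) ^ (i + 1) * depth x₀ r y = 4 * s := by rw [hs, pow_succ]; ring
  have key : ∀ z ∈ Metric.ball φ s, (μ (Metric.ball φ s))⁻¹ ≤
      D ^ 4 * shiftKernel μ x₀ r i (y, z) := by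
    intro z hz
    rw [Metric.mem_ball] at hz
    have d1 := depth_le_add (x₀ := x₀) (r := r) z φ
    have d2 := depth_le_add (x₀ := x₀) (r := r) φ z
    rw [dist_comm φ z] at d2
    have d3 := dist_triangle z φ y
    rw [dist_comm φ y] at d3
    have hmem : (y, z) ∈ shiftSet x₀ r i := by
      refine ⟨?_, ?_, ?_⟩ <;> dsimp only <;> (try rw [hpow]) <;> (try rw [← hs]) <;> linarith
    rw [shiftKernel, indicator_of_mem hmem]
    refine hμ.inv_ball_le (by linarith) hs0 4 ?_
    linarith
  calc 1 = (μ (Metric.ball φ s))⁻¹ * μ (Metric.ball φ s) :=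
        (ENNReal.inv_mul_cancel (hμ.ball_ne_zero φ hs0) (hμ.ball_ne_top φ s)).symm
    _ = ∫⁻ _ in Metric.ball φ s, (μ (Metric.ball φ s))⁻¹ ∂μ := by simp
    _ ≤ ∫⁻ z in Metric.ball φ s, D ^ 4 * shiftKernel μ x₀ r i (y, z) ∂μ :=
        setLIntegral_mono' Metric.isOpen_ball.measurableSet key
    _ ≤ ∫⁻ z, D ^ 4 * shiftKernel μ x₀ r i (y, z) ∂μ := setLIntegral_le_lintegral _ _
    _ = _ := lintegral_const_mul _ ((measurable_shiftKernel i).comp measurable_prodMk_left)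

-- The depths of the points `y` paired with `z` lie in disjoint ranges for different `i`, and all
-- these `y` lie in `B(z, 4 · depth z)`. The bound is therefore independent of `M`, which is the
-- gain that makes absorption possible.
omit [SFinite μ] in
lemma DoublingWith.sum_lintegral_shiftKernel_le (hμ : DoublingWith μ D) (M : ℕ) (O : Set E) {z : E}
    (hz : z ∈ Metric.ball x₀ r) :
    ∑ i ∈ Finset.range M, ∫⁻ y in O, shiftKernel μ x₀ r i (y, z) ∂μ ≤ D ^ 2 := by
  set T : ℕ → Set E := fun i => {y | (y, z) ∈ shiftSet x₀ r i} with hT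
  have hTm : ∀ i, MeasurableSet (T i) := fun i =>
    measurable_prodMk_right (measurableSet_shiftSet i)
  have hz0 := mem_ball_iff_depth_pos.1 hz
  have hint : ∀ i, ∫⁻ y in O, shiftKernel μ x₀ r i (y, z) ∂μ ≤
      (whitneyMeasure μ x₀ r z)⁻¹ * μ (T i) := by
    intro i
    refine (setLIntegral_le_lintegral _ _).trans (le_of_eq ?_)
    have e : (fun y => shiftKernel μ x₀ r i (y, z)) =
        (T i).indicator fun _ => (whitneyMeasure μ x₀ r z)⁻¹ := by
      ext y
      by_cases h : (y, z) ∈ shiftSet x₀ r i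
      · rw [shiftKernel, indicator_of_mem h, indicator_of_mem (show y ∈ T i from h)]
      · rw [shiftKernel, indicator_of_notMem h, indicator_of_notMem (show y ∉ T i from h)]
    rw [e, lintegral_indicator_const (hTm i)]
  have hdisj : Pairwise (Function.onFun Disjoint T) := by
    have : ∀ i j, i < j → Disjoint (T i) (T j) := by
      intro i j hij
      rw [Set.disjoint_left]
      intro y hi hj
      have h0 := depth_pos_of_mem_shiftSet hi
      have h1 := hi.2.2
      have h2 := hj.2.1
      dsimp only at h0 h1 h2
      have h3 : (4 : ℝ) ^ (i + 1) ≤ 4 ^ j := pow_le_pow_right₀ (by norm_num) hij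
      nlinarith
    intro i j hij
    rcases lt_or_gt_of_ne hij with h | h
    · exact this i j h
    · exact (this j i h).symm
  have hsub : (⋃ i ∈ Finset.range M, T i) ⊆ Metric.ball z (4 * depth x₀ r z) := by
    intro y hy
    obtain ⟨i, -, hi⟩ := mem_iUnion₂.1 hy
    have h1 := hi.1
    have h2 := hi.2.1
    dsimp only at h1 h2
    rw [Metric.mem_ball, dist_comm]
    rw [pow_succ] at h1
    linarith
  calc ∑ i ∈ Finset.range M, ∫⁻ y in O, shiftKernel μ x₀ r i (y, z) ∂μ
      ≤ ∑ i ∈ Finset.range M, (whitneyMeasure μ x₀ r z)⁻¹ * μ (T i) :=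
        Finset.sum_le_sum fun i _ => hint i
    _ = (whitneyMeasure μ x₀ r z)⁻¹ * μ (⋃ i ∈ Finset.range M, T i) := by
        rw [← Finset.mul_sum, measure_biUnion_finset (fun i _ j _ hij => hdisj hij)
          fun i _ => hTm i]
    _ ≤ (whitneyMeasure μ x₀ r z)⁻¹ * (D ^ 2 * whitneyMeasure μ x₀ r z) := by
        refine mul_le_mul_right ((measure_mono hsub).trans ?_) _
        refine hμ.ball_le hz0 2 ?_
        rw [dist_self]; linarith
    _ = D ^ 2 * ((whitneyMeasure μ x₀ r z)⁻¹ * whitneyMeasure μ x₀ r z) := by ring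
    _ = D ^ 2 := by
        rw [whitneyMeasure, ENNReal.inv_mul_cancel (hμ.ball_ne_zero z hz0) (hμ.ball_ne_top z _),
          mul_one]

end Whitney


/-! ### Local Poincaré estimates at the Whitney scale. -/

section Whitney

variable {E : Type*} [NormedAddCommGroup E]

/-- The part of the ball `B(x₀,r)` near `x` which is not much closer to the boundary than `x`. -/
def whitneyRegion (x₀ : E) (r : ℝ) (j : ℕ) (x : E) : Set E :=
  Metric.ball x₀ (r - depth x₀ r x / 4) ∩ Metric.ball x (4 ^ j * depth x₀ r x)

lemma mem_whitneyRegion {x₀ : E} {r : ℝ} {j : ℕ} {x w : E} : w ∈ whitneyRegion x₀ r j x ↔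
    depth x₀ r x / 4 < depth x₀ r w ∧ dist w x < 4 ^ j * depth x₀ r x := by
  rw [whitneyRegion, mem_inter_iff, Metric.mem_ball, Metric.mem_ball]
  unfold depth
  constructor <;> rintro ⟨h1, h2⟩ <;> exact ⟨by linarith, h2⟩

variable [MeasurableSpace E] [BorelSpace E] [SecondCountableTopology E] {μ : Measure E}
  [SFinite μ] {D : ℝ≥0∞} {x₀ : E} {r : ℝ} {q p lam : ℝ}

-- This lets one insert an average over base points `x` near `y`, a continuous substitute for a
-- Whitney covering.
omit [SFinite μ] [SecondCountableTopology E] in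
lemma DoublingWith.one_le_lintegral_ball_inv (hμ : DoublingWith μ D) {y : E}
    (hy : 0 < depth x₀ r y) :
    1 ≤ D ^ 3 * ∫⁻ x in Metric.ball y (depth x₀ r y / 4), (whitneyMeasure μ x₀ r x)⁻¹ ∂μ := by
  have hs : 0 < depth x₀ r y / 4 := by positivity
  have hD := hμ.pow_ne_top 3
  calc 1 = (μ (Metric.ball y (depth x₀ r y / 4)))⁻¹ * μ (Metric.ball y (depth x₀ r y / 4)) :=
        (ENNReal.inv_mul_cancel (hμ.ball_ne_zero y hs) (hμ.ball_ne_top y _)).symm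
    _ = ∫⁻ _ in Metric.ball y (depth x₀ r y / 4),
          (μ (Metric.ball y (depth x₀ r y / 4)))⁻¹ ∂μ := by simp
    _ ≤ ∫⁻ x in Metric.ball y (depth x₀ r y / 4), D ^ 3 * (whitneyMeasure μ x₀ r x)⁻¹ ∂μ := by
        refine setLIntegral_mono' Metric.isOpen_ball.measurableSet fun x hx => ?_
        rw [Metric.mem_ball] at hx
        have h1 := depth_le_add (x₀ := x₀) (r := r) x y
        have h2 := depth_le_add (x₀ := x₀) (r := r) y x
        rw [dist_comm y x] at h2
        exact hμ.inv_ball_le (by linarith) hs 3 (by linarith)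
    _ = _ := lintegral_const_mul' _ _ hD

/-- Insert the average over base points `x` and exchange the integrals. For fixed `x`, all relevant
`y` and `z` lie in a region `Z` of size and depth comparable to `depth x`, where the chaining
estimate applies. -/
lemma DoublingWith.exists_lintegral_shiftKernel_le [NormedSpace ℝ E] [FiniteDimensional ℝ E]
    (hμ : DoublingWith μ D) (hq : 1 ≤ q) (hp : 1 ≤ p) (hlam : 1 ≤ lam) {C : ℝ≥0∞} (hC : C ≠ ∞)
    (i : ℕ) :
    ∃ K : ℝ≥0∞, K ≠ ∞ ∧ ∀ (F : E → ℝ) (G : E → ℝ≥0∞), Measurable F →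
      (∀ (x : E) (r : ℝ), 0 < r → pairIntegral μ q F (Metric.ball x r) (Metric.ball x r) ≤
        C * poincareBound μ q p G x r (Metric.ball x (lam * r))) →
      ∀ (x₀ : E) (r : ℝ),
      ∫⁻ y in Metric.ball x₀ r, ∫⁻ z, edist (F y) (F z) ^ q * shiftKernel μ x₀ r i (y, z) ∂μ ∂μ ≤
        K * ∫⁻ x in Metric.ball x₀ r, ENNReal.ofReal (depth x₀ r x) ^ q *
          ((whitneyMeasure μ x₀ r x)⁻¹ * ∫⁻ w in whitneyRegion x₀ r (i + 3) x, G w ∂μ) ^ (q / p)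
            ∂μ := by
  have hq0 : 0 ≤ q := by linarith
  have hp0 : 0 ≤ p := by linarith
  obtain ⟨K, hK, H⟩ := hμ.exists_pairIntegral_region_le hq hp hlam hC (4 ^ (i + 3))
  have hKt : D ^ 6 * (K * compareConst D q p 2) ≠ ∞ :=
    ENNReal.mul_ne_top (hμ.pow_ne_top 6) (ENNReal.mul_ne_top hK (hμ.compareConst_ne_top hq0 hp0 2))
  refine ⟨_, hKt, ?_⟩
  intro F G hF hFG x₀ r
  have hk := measurable_edist_rpow hF q
  set B := Metric.ball x₀ r
  have hB : MeasurableSet B := Metric.isOpen_ball.measurableSet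
  set d := depth x₀ r with hd
  set m := whitneyMeasure μ x₀ r with hm
  have hmm : Measurable m := measurable_whitneyMeasure
  set Φ : E → ℝ≥0∞ := fun y => ∫⁻ z, edist (F y) (F z) ^ q * shiftKernel μ x₀ r i (y, z) ∂μ with hΦ
  have hΦm : Measurable Φ := (hk.mul (measurable_shiftKernel i)).lintegral_prod_right'
  set N : Set (E × E) := {w | dist w.2 w.1 < d w.1 / 4} with hN
  have hNm : MeasurableSet N := measurableSet_lt (by fun_prop)
    ((continuous_depth.measurable.comp measurable_fst).div_const 4)
  set ν : E × E → ℝ≥0∞ := N.indicator fun w => (m w.2)⁻¹ with hν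
  have hνm : Measurable ν := ((hmm.comp measurable_snd).inv).indicator hNm
  have h4 : (1 : ℝ) ≤ 4 ^ (i + 1) := one_le_pow₀ (by norm_num)
  have h42 : (4 : ℝ) ^ (i + 2) = 4 * 4 ^ (i + 1) := by ring
  have h43 : (4 : ℝ) ^ (i + 3) = 16 * 4 ^ (i + 1) := by ring
  have hpt : ∀ x, ∫⁻ y in B, D ^ 3 * (Φ y * ν (y, x)) ∂μ ≤ B.indicator (fun x =>
      D ^ 6 * (K * compareConst D q p 2) * (ENNReal.ofReal (d x) ^ q *
        ((m x)⁻¹ * ∫⁻ w in whitneyRegion x₀ r (i + 3) x, G w ∂μ) ^ (q / p))) x := by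
    intro x
    by_cases hx : x ∈ B
    swap
    · rw [indicator_of_notMem hx, nonpos_iff_eq_zero]
      rw [setLIntegral_congr_fun (g := fun _ => 0) hB, lintegral_zero]
      intro y hy
      have : (y, x) ∉ N := by
        intro h
        have h1 : dist x y < d y / 4 := h
        have h2 := depth_le_add (x₀ := x₀) (r := r) y x
        rw [dist_comm y x] at h2
        exact hx (mem_ball_iff_depth_pos.2 (by linarith [dist_nonneg (x := x) (y := y)]))
      simp [hν, indicator_of_notMem this]
    have hdx : 0 < d x := mem_ball_iff_depth_pos.1 hx
    rw [indicator_of_mem hx]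
    set Z : Set E := {z | d x / 2 ≤ d z ∧ dist z x < 4 ^ (i + 2) * d x} with hZ
    have hZm : MeasurableSet Z := (measurableSet_le measurable_const continuous_depth.measurable).inter
      (measurableSet_lt (measurable_id.dist measurable_const) measurable_const)
    have hΦZ : ∀ y, D ^ 3 * (Φ y * ν (y, x)) ≤ Z.indicator (fun y => D ^ 6 * (m x)⁻¹ ^ 2 *
        ∫⁻ z in Z, edist (F y) (F z) ^ q ∂μ) y := by
      intro y
      by_cases hy : (y, x) ∈ N
      swap
      · simp [hν, indicator_of_notMem hy]
      have h1 : dist x y < d y / 4 := hy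
      have h2 := depth_le_add (x₀ := x₀) (r := r) y x
      have h3 := depth_le_add (x₀ := x₀) (r := r) x y
      rw [dist_comm y x] at h2
      rw [← hd] at h2 h3
      have hdy : 0 < d y := by linarith [dist_nonneg (x := x) (y := y)]
      have hyZ : y ∈ Z := ⟨by linarith, by rw [dist_comm]; nlinarith⟩
      have hΦy : Φ y ≤ D ^ 3 * (m x)⁻¹ * ∫⁻ z in Z, edist (F y) (F z) ^ q ∂μ := by
        rw [← lintegral_indicator hZm, ← lintegral_const_mul _
          ((measurable_edist_rpow_right hF q _).indicator hZm)]
        refine lintegral_mono fun z => ?_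
        by_cases hz : (y, z) ∈ shiftSet x₀ r i
        swap
        · simp [shiftKernel, indicator_of_notMem hz]
        have hz1 := hz.1
        have hz2 := hz.2.1
        dsimp only at hz1 hz2
        rw [← hd] at hz1 hz2
        have h5 : (1 : ℝ) ≤ 4 ^ i := one_le_pow₀ (by norm_num)
        have h6 : d y ≤ d z := by nlinarith
        have h7 := dist_triangle z y x
        rw [dist_comm y x] at h7
        have hzZ : z ∈ Z := ⟨by linarith, by nlinarith⟩
        simp only [shiftKernel, indicator_of_mem hz, indicator_of_mem hzZ]
        rw [mul_comm]
        refine mul_le_mul_left (hμ.inv_ball_le hdx (by linarith) 3 ?_) _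
        rw [dist_comm]
        have : (4 : ℝ) ^ (i + 1) = 4 * 4 ^ i := by ring
        nlinarith
      rw [indicator_of_mem hyZ, hν, indicator_of_mem hy]
      calc D ^ 3 * (Φ y * (m x)⁻¹)
          ≤ D ^ 3 * ((D ^ 3 * (m x)⁻¹ * ∫⁻ z in Z, edist (F y) (F z) ^ q ∂μ) * (m x)⁻¹) := by
            gcongr
        _ = _ := by ring
    -- Chaining at scale `ρ = d x / 4`: points of `Z` have depth at least `d x / 2`, so their
    -- `ρ`-balls keep depth above `d x / 4`, and `4^(i+2) · d x = 4^(i+3) · ρ`.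
    have hI : pairIntegral μ q F Z Z ≤ K * (compareConst D q p 2 *
        poincareBound μ q p G x (d x) (whitneyRegion x₀ r (i + 3) x)) := by
      refine (H F G hF hFG (whitneyRegion x₀ r (i + 3) x)
        ((convex_ball _ _).inter (convex_ball _ _)) (d x / 4) (by positivity) x Z ?_ ?_).trans ?_
      · intro z hz
        rw [Metric.mem_ball]
        have := hz.2
        nlinarith
      · intro b hb w hw
        rw [Metric.mem_ball] at hw
        have h1 := depth_le_add (x₀ := x₀) (r := r) b w
        rw [dist_comm, ← hd] at h1
        have h2 := dist_triangle w b x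
        have hb1 := hb.1
        have hb2 := hb.2
        refine mem_whitneyRegion.2 ⟨?_, ?_⟩
        · rw [← hd]; linarith
        · rw [← hd]; nlinarith
      · exact mul_le_mul_right (hμ.poincareBound_le hq0 hp0 (by positivity) hdx 2
          (by rw [dist_self]; linarith) (by rw [dist_self]; linarith) subset_rfl) _
    have hm0 : m x ≠ 0 := hμ.ball_ne_zero x hdx
    have hmt : m x ≠ ∞ := hμ.ball_ne_top x _
    calc ∫⁻ y in B, D ^ 3 * (Φ y * ν (y, x)) ∂μ
        ≤ ∫⁻ y, Z.indicator (fun y => D ^ 6 * (m x)⁻¹ ^ 2 *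
            ∫⁻ z in Z, edist (F y) (F z) ^ q ∂μ) y ∂μ :=
          (setLIntegral_le_lintegral _ _).trans (lintegral_mono hΦZ)
      _ = D ^ 6 * (m x)⁻¹ ^ 2 * pairIntegral μ q F Z Z := by
          rw [lintegral_indicator hZm, lintegral_const_mul _ hk.lintegral_prod_right', pairIntegral]
      _ ≤ D ^ 6 * (m x)⁻¹ ^ 2 * (K * (compareConst D q p 2 *
            poincareBound μ q p G x (d x) (whitneyRegion x₀ r (i + 3) x))) := by gcongr
      _ = ((m x)⁻¹ * m x) ^ 2 * (D ^ 6 * (K * compareConst D q p 2) * (ENNReal.ofReal (d x) ^ q *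
        ((m x)⁻¹ * ∫⁻ w in whitneyRegion x₀ r (i + 3) x, G w ∂μ) ^ (q / p))) := by
          rw [poincareBound, hm, whitneyMeasure]; ring
      _ = _ := by rw [ENNReal.inv_mul_cancel hm0 hmt, one_pow, one_mul]
  calc ∫⁻ y in B, Φ y ∂μ ≤ ∫⁻ y in B, ∫⁻ x, D ^ 3 * (Φ y * ν (y, x)) ∂μ ∂μ := by
        refine setLIntegral_mono' hB fun y hy => ?_
        have hνy : Measurable fun x => ν (y, x) := hνm.comp measurable_prodMk_left
        rw [lintegral_const_mul _ (hνy.const_mul _), lintegral_const_mul _ hνy]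
        have h1 := hμ.one_le_lintegral_ball_inv (mem_ball_iff_depth_pos.1 hy)
        have h2 : ∫⁻ x, ν (y, x) ∂μ =
            ∫⁻ x in Metric.ball y (depth x₀ r y / 4), (whitneyMeasure μ x₀ r x)⁻¹ ∂μ := by
          rw [← lintegral_indicator Metric.isOpen_ball.measurableSet]
          rfl
        calc Φ y ≤ Φ y * (D ^ 3 * ∫⁻ x, ν (y, x) ∂μ) := le_mul_of_one_le_right' (by rwa [h2])
          _ = _ := by ring
    _ = ∫⁻ x, ∫⁻ y in B, D ^ 3 * (Φ y * ν (y, x)) ∂μ ∂μ := by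
        refine lintegral_lintegral_swap (Measurable.aemeasurable ?_)
        exact ((hΦm.comp measurable_fst).mul hνm).const_mul _
    _ ≤ _ := lintegral_mono hpt
    _ = _ := by
        rw [lintegral_indicator hB, lintegral_const_mul' _ _ hKt]

/-- Bounded overlap in integral form, by exchanging the integrals: if `w` is in the region of `x`,
the two depths are comparable and `x` lies in `B(w, 4^(j+1) · depth w)`. -/
lemma DoublingWith.lintegral_whitneyRegion_le (hμ : DoublingWith μ D) (j : ℕ) {G : E → ℝ≥0∞}
    (hG : Measurable G) (x₀ : E) (r : ℝ) :
    ∫⁻ x in Metric.ball x₀ r,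
      (whitneyMeasure μ x₀ r x)⁻¹ * ∫⁻ w in whitneyRegion x₀ r j x, G w ∂μ ∂μ ≤
        D ^ (2 * j + 2) * D ^ (2 * j + 2) * ∫⁻ w in Metric.ball x₀ r, G w ∂μ := by
  set B := Metric.ball x₀ r
  have hB : MeasurableSet B := Metric.isOpen_ball.measurableSet
  set d := depth x₀ r with hd
  set m := whitneyMeasure μ x₀ r with hm
  have hmm : Measurable m := measurable_whitneyMeasure
  have hdm : Measurable d := continuous_depth.measurable
  set V : Set (E × E) := {a | a.2 ∈ whitneyRegion x₀ r j a.1} with hV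
  have hVm : MeasurableSet V := by
    simp only [hV, mem_whitneyRegion]
    exact (measurableSet_lt ((hdm.comp measurable_fst).div_const 4) (hdm.comp measurable_snd)).inter
      (measurableSet_lt (by fun_prop) ((hdm.comp measurable_fst).const_mul _))
  set κ : E × E → ℝ≥0∞ := V.indicator fun a => (m a.1)⁻¹ with hκ
  have hκm : Measurable κ := ((hmm.comp measurable_fst).inv).indicator hVm
  have hκ' : ∀ w, Measurable fun x => κ (x, w) := fun w => hκm.comp measurable_prodMk_right
  have e1 : ∀ x, (m x)⁻¹ * ∫⁻ w in whitneyRegion x₀ r j x, G w ∂μ =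
      ∫⁻ w, G w * κ (x, w) ∂μ := by
    intro x
    have hU : MeasurableSet (whitneyRegion x₀ r j x) :=
      Metric.isOpen_ball.measurableSet.inter Metric.isOpen_ball.measurableSet
    rw [← lintegral_indicator hU, ← lintegral_const_mul _ (hG.indicator hU)]
    refine lintegral_congr fun w => ?_
    by_cases hw : w ∈ whitneyRegion x₀ r j x
    · rw [indicator_of_mem hw, hκ, indicator_of_mem (show (x, w) ∈ V from hw), mul_comm]
    · rw [indicator_of_notMem hw, hκ, indicator_of_notMem (show (x, w) ∉ V from hw)]; simp
  have h4 : (1 : ℝ) ≤ 4 ^ j := one_le_pow₀ (by norm_num)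
  have h2 : (2 : ℝ) ^ (2 * j + 2) = 4 * 4 ^ j := by rw [pow_add, pow_mul]; norm_num; ring
  have key : ∀ w, ∫⁻ x in B, κ (x, w) ∂μ ≤
      B.indicator (fun _ => D ^ (2 * j + 2) * D ^ (2 * j + 2)) w := by
    intro w
    by_cases hw : w ∈ B
    swap
    · rw [indicator_of_notMem hw, nonpos_iff_eq_zero]
      rw [setLIntegral_congr_fun (g := fun _ => 0) hB, lintegral_zero]
      intro x hx
      refine indicator_of_notMem (fun h => hw ?_) _
      have h1 := (mem_whitneyRegion.1 h).1
      have h2 := mem_ball_iff_depth_pos.1 hx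
      exact mem_ball_iff_depth_pos.2 (by linarith)
    have hdw : 0 < d w := mem_ball_iff_depth_pos.1 hw
    rw [indicator_of_mem hw]
    set s := 2 ^ (2 * j + 2) * d w with hs
    calc ∫⁻ x in B, κ (x, w) ∂μ
        ≤ ∫⁻ x, (Metric.ball w s).indicator (fun _ => D ^ (2 * j + 2) * (m w)⁻¹) x ∂μ := by
          rw [← lintegral_indicator hB]
          refine lintegral_mono fun x => ?_
          by_cases hx : x ∈ B
          swap
          · rw [indicator_of_notMem hx]; exact zero_le
          rw [indicator_of_mem hx]
          by_cases hxw : (x, w) ∈ V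
          swap
          · rw [hκ, indicator_of_notMem hxw]; exact zero_le
          obtain ⟨h5, h6⟩ := mem_whitneyRegion.1 hxw
          rw [← hd] at h5 h6
          have hdx : 0 < d x := mem_ball_iff_depth_pos.1 hx
          have h7 := depth_le_add (x₀ := x₀) (r := r) w x
          rw [← hd] at h7
          have hxs : x ∈ Metric.ball w s := by
            rw [Metric.mem_ball, dist_comm, hs, h2]; nlinarith
          rw [hκ, indicator_of_mem hxw, indicator_of_mem hxs]
          refine hμ.inv_ball_le hdw hdx _ ?_
          rw [h2]; nlinarith
      _ = D ^ (2 * j + 2) * (m w)⁻¹ * μ (Metric.ball w s) :=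
          lintegral_indicator_const Metric.isOpen_ball.measurableSet _
      _ ≤ D ^ (2 * j + 2) * (m w)⁻¹ * (D ^ (2 * j + 2) * m w) := by
          gcongr
          exact hμ.ball_le hdw _ (by rw [dist_self, zero_add, hs])
      _ = D ^ (2 * j + 2) * D ^ (2 * j + 2) * ((m w)⁻¹ * m w) := by ring
      _ = _ := by
          rw [hm, whitneyMeasure, ENNReal.inv_mul_cancel (hμ.ball_ne_zero w hdw)
            (hμ.ball_ne_top w _), mul_one]
  calc ∫⁻ x in B, (m x)⁻¹ * ∫⁻ w in whitneyRegion x₀ r j x, G w ∂μ ∂μ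
      = ∫⁻ x in B, ∫⁻ w, G w * κ (x, w) ∂μ ∂μ := lintegral_congr fun x => e1 x
    _ = ∫⁻ w, ∫⁻ x in B, G w * κ (x, w) ∂μ ∂μ :=
        lintegral_lintegral_swap ((hG.comp measurable_snd).mul hκm).aemeasurable
    _ ≤ ∫⁻ w, B.indicator (fun w => D ^ (2 * j + 2) * D ^ (2 * j + 2) * G w) w ∂μ := by
        refine lintegral_mono fun w => ?_
        rw [lintegral_const_mul _ (hκ' w)]
        refine (mul_le_mul_right (key w) _).trans (le_of_eq ?_)
        by_cases hw : w ∈ B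
        · rw [indicator_of_mem hw, indicator_of_mem hw, mul_comm]
        · rw [indicator_of_notMem hw, indicator_of_notMem hw, mul_zero]
    _ = _ := by
        rw [lintegral_indicator hB, lintegral_const_mul _ hG]

end Whitney


/-! ### Removing the dilation. -/

/-- A lower bound for the decay of the measure of balls when the radius decreases. -/
def MeasureDecay {X : Type*} [MetricSpace X] [MeasurableSpace X] (q p : ℝ) (μ : Measure X) :
    Prop :=
  ∃ A : ℝ≥0∞, A ≠ ∞ ∧ ∀ (x₀ x : X) (r s : ℝ), 0 < s → s ≤ r → x ∈ Metric.ball x₀ r →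
    ENNReal.ofReal s ^ q * μ (Metric.ball x₀ r) ^ (q / p - 1) ≤
      A * ENNReal.ofReal r ^ q * μ (Metric.ball x s) ^ (q / p - 1)

section Dilation

variable {E : Type*} [NormedAddCommGroup E] [MeasurableSpace E] [BorelSpace E]
  [SecondCountableTopology E] {μ : Measure E} [SFinite μ] {D : ℝ≥0∞} {q p lam : ℝ}

/-- For `q ≤ p`, bound the depth by `r` and use Jensen for the power `p/q`. For `q > p`, split
`h^(q/p) = h^b · h` with `b = q/p - 1`: in `h^b` the region is enlarged to the whole ball and the
decay condition with `s = depth x` pays for the change of normalization, while the remaining factor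
`h` is integrated by bounded overlap. -/
lemma DoublingWith.exists_lintegral_whitneyRegion_rpow_le (hμ : DoublingWith μ D) (hq : 1 ≤ q)
    (hp : 1 ≤ p) (hdecay : p < q → MeasureDecay q p μ) (j : ℕ) :
    ∃ K : ℝ≥0∞, K ≠ ∞ ∧ ∀ (G : E → ℝ≥0∞), Measurable G → ∀ (x₀ : E) (r : ℝ), 0 < r →
      ∫⁻ x in Metric.ball x₀ r, ENNReal.ofReal (depth x₀ r x) ^ q *
        ((whitneyMeasure μ x₀ r x)⁻¹ * ∫⁻ w in whitneyRegion x₀ r j x, G w ∂μ) ^ (q / p) ∂μ ≤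
      K * (μ (Metric.ball x₀ r) * (ENNReal.ofReal r ^ q *
        ((μ (Metric.ball x₀ r))⁻¹ * ∫⁻ w in Metric.ball x₀ r, G w ∂μ) ^ (q / p))) := by
  have hq0 : 0 < q := by linarith
  have hp0 : 0 < p := by linarith
  have hqp : 0 < q / p := by positivity
  set K₁ : ℝ≥0∞ := D ^ (2 * j + 2) * D ^ (2 * j + 2) with hK₁
  have hK₁t : K₁ ≠ ∞ := ENNReal.mul_ne_top (hμ.pow_ne_top _) (hμ.pow_ne_top _)
  have hmeas : ∀ (G : E → ℝ≥0∞), Measurable G → ∀ x₀ r, Measurable fun x =>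
      (whitneyMeasure μ x₀ r x)⁻¹ * ∫⁻ w in whitneyRegion x₀ r j x, G w ∂μ := by
    intro G hG x₀ r
    have hdm : Measurable (depth x₀ r) := continuous_depth.measurable
    have hVm : MeasurableSet {a : E × E | a.2 ∈ whitneyRegion x₀ r j a.1} := by
      simp only [mem_whitneyRegion]
      exact (measurableSet_lt ((hdm.comp measurable_fst).div_const 4)
        (hdm.comp measurable_snd)).inter
        (measurableSet_lt (by fun_prop) ((hdm.comp measurable_fst).const_mul _))
    have h1 : Measurable fun x => ∫⁻ w, {a : E × E | a.2 ∈ whitneyRegion x₀ r j a.1}.indicator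
        (fun a => G a.2) (x, w) ∂μ := ((hG.comp measurable_snd).indicator hVm).lintegral_prod_right'
    refine measurable_whitneyMeasure.inv.mul ?_
    convert h1 using 2 with x
    have hU : MeasurableSet (whitneyRegion x₀ r j x) :=
      Metric.isOpen_ball.measurableSet.inter Metric.isOpen_ball.measurableSet
    rw [← lintegral_indicator hU]
    rfl
  rcases le_or_gt q p with hqp' | hqp'
  · refine ⟨K₁ ^ (q / p), ENNReal.rpow_ne_top_of_nonneg hqp.le hK₁t, ?_⟩
    intro G hG x₀ r hr
    set B := Metric.ball x₀ r
    set h : E → ℝ≥0∞ := fun x =>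
      (whitneyMeasure μ x₀ r x)⁻¹ * ∫⁻ w in whitneyRegion x₀ r j x, G w ∂μ with hh
    have hB0 : μ B ≠ 0 := hμ.ball_ne_zero x₀ hr
    have hBt : μ B ≠ ∞ := hμ.ball_ne_top x₀ r
    have hhm : Measurable h := hmeas G hG x₀ r
    have hint : ∫⁻ x in B, h x ∂μ ≤ K₁ * ∫⁻ w in B, G w ∂μ := hμ.lintegral_whitneyRegion_le j hG x₀ r
    have hpq : 1 ≤ p / q := (one_le_div hq0).2 hqp'
    have hJ := lintegral_rpow_le_rpow_measure_mul (ν := μ.restrict B) hpq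
      (hhm.pow_const (q / p)).aemeasurable
    have e1 : p / q * (q / p) = 1 := by field_simp
    have e2 : q / p * (p / q) = 1 := by field_simp
    simp_rw [← ENNReal.rpow_mul, e2, ENNReal.rpow_one] at hJ
    have hJ2 := ENNReal.rpow_le_rpow hJ hqp.le
    rw [← ENNReal.rpow_mul, e1, ENNReal.rpow_one, Measure.restrict_apply_univ,
      ENNReal.mul_rpow_of_nonneg _ _ hqp.le, ← ENNReal.rpow_mul] at hJ2
    calc ∫⁻ x in B, ENNReal.ofReal (depth x₀ r x) ^ q * h x ^ (q / p) ∂μ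
        ≤ ∫⁻ x in B, ENNReal.ofReal r ^ q * h x ^ (q / p) ∂μ := by
          refine lintegral_mono fun x => mul_le_mul_left (ENNReal.rpow_le_rpow
            (ENNReal.ofReal_le_ofReal (depth_le x)) hq0.le) _
      _ = ENNReal.ofReal r ^ q * ∫⁻ x in B, h x ^ (q / p) ∂μ :=
          lintegral_const_mul _ (hhm.pow_const _)
      _ ≤ ENNReal.ofReal r ^ q * (μ B ^ ((p / q - 1) * (q / p)) *
            (K₁ * ∫⁻ w in B, G w ∂μ) ^ (q / p)) := by
          refine mul_le_mul_right (hJ2.trans ?_) _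
          exact mul_le_mul_right (ENNReal.rpow_le_rpow hint hqp.le) _
      _ = _ := by
          have e3 : (p / q - 1) * (q / p) = 1 + -(q / p) := by rw [sub_mul, e1]; ring
          rw [e3, ENNReal.rpow_add _ _ hB0 hBt, ENNReal.rpow_one, ENNReal.rpow_neg,
            ← ENNReal.inv_rpow, ENNReal.mul_rpow_of_nonneg K₁ _ hqp.le,
            ENNReal.mul_rpow_of_nonneg (μ B)⁻¹ _ hqp.le]
          ring
  · obtain ⟨A, hA, hdec⟩ := hdecay hqp'
    refine ⟨A * K₁, ENNReal.mul_ne_top hA hK₁t, ?_⟩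
    intro G hG x₀ r hr
    set B := Metric.ball x₀ r
    have hB : MeasurableSet B := Metric.isOpen_ball.measurableSet
    set h : E → ℝ≥0∞ := fun x =>
      (whitneyMeasure μ x₀ r x)⁻¹ * ∫⁻ w in whitneyRegion x₀ r j x, G w ∂μ with hh
    have hB0 : μ B ≠ 0 := hμ.ball_ne_zero x₀ hr
    have hBt : μ B ≠ ∞ := hμ.ball_ne_top x₀ r
    have hhm : Measurable h := hmeas G hG x₀ r
    have hint : ∫⁻ x in B, h x ∂μ ≤ K₁ * ∫⁻ w in B, G w ∂μ := hμ.lintegral_whitneyRegion_le j hG x₀ r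
    set g : ℝ≥0∞ := ∫⁻ w in B, G w ∂μ with hg
    set b : ℝ := q / p - 1 with hb
    have hb0 : 0 ≤ b := by rw [hb, sub_nonneg]; exact (one_le_div hp0).2 hqp'.le
    have e : q / p = b + 1 := by rw [hb]; ring
    have hsplit : ∀ t : ℝ≥0∞, t ^ (q / p) = t ^ b * t := fun t => by
      rw [e, ENNReal.rpow_add_of_nonneg _ _ hb0 zero_le_one, ENNReal.rpow_one]
    calc ∫⁻ x in B, ENNReal.ofReal (depth x₀ r x) ^ q * h x ^ (q / p) ∂μ
        ≤ ∫⁻ x in B, A * ENNReal.ofReal r ^ q * ((μ B)⁻¹ * g) ^ b * h x ∂μ := by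
          refine setLIntegral_mono' hB fun x hx => ?_
          have hdx : 0 < depth x₀ r x := mem_ball_iff_depth_pos.1 hx
          have hm0 : whitneyMeasure μ x₀ r x ≠ 0 := hμ.ball_ne_zero x hdx
          have hmt : whitneyMeasure μ x₀ r x ≠ ∞ := hμ.ball_ne_top x _
          have h1 := hdec x₀ x r _ hdx (depth_le x) hx
          change ENNReal.ofReal (depth x₀ r x) ^ q * μ B ^ b ≤
            A * ENNReal.ofReal r ^ q * whitneyMeasure μ x₀ r x ^ b at h1
          have hBb : μ B ^ b * (μ B)⁻¹ ^ b = 1 := by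
            rw [← ENNReal.mul_rpow_of_nonneg _ _ hb0, ENNReal.mul_inv_cancel hB0 hBt,
              ENNReal.one_rpow]
          have hmb : whitneyMeasure μ x₀ r x ^ b * (whitneyMeasure μ x₀ r x)⁻¹ ^ b = 1 := by
            rw [← ENNReal.mul_rpow_of_nonneg _ _ hb0, ENNReal.mul_inv_cancel hm0 hmt,
              ENNReal.one_rpow]
          have hsub : whitneyRegion x₀ r j x ⊆ B := fun w hw =>
            mem_ball_iff_depth_pos.2 (by linarith [(mem_whitneyRegion.1 hw).1])
          have h2 : h x ^ b ≤ (whitneyMeasure μ x₀ r x)⁻¹ ^ b * g ^ b := by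
            rw [← ENNReal.mul_rpow_of_nonneg _ _ hb0]
            exact ENNReal.rpow_le_rpow (mul_le_mul_right (lintegral_mono_set hsub) _) hb0
          calc ENNReal.ofReal (depth x₀ r x) ^ q * h x ^ (q / p)
              = (ENNReal.ofReal (depth x₀ r x) ^ q * μ B ^ b) * (μ B)⁻¹ ^ b * (h x ^ b * h x) := by
                rw [hsplit, mul_assoc _ (μ B ^ b), hBb, mul_one]
            _ ≤ (A * ENNReal.ofReal r ^ q * whitneyMeasure μ x₀ r x ^ b) * (μ B)⁻¹ ^ b *
                  ((whitneyMeasure μ x₀ r x)⁻¹ ^ b * g ^ b * h x) := by gcongr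
            _ = A * ENNReal.ofReal r ^ q * ((μ B)⁻¹ ^ b * g ^ b) * h x *
                  (whitneyMeasure μ x₀ r x ^ b * (whitneyMeasure μ x₀ r x)⁻¹ ^ b) := by ring
            _ = _ := by rw [hmb, mul_one, ← ENNReal.mul_rpow_of_nonneg _ _ hb0]
      _ = A * ENNReal.ofReal r ^ q * ((μ B)⁻¹ * g) ^ b * ∫⁻ x in B, h x ∂μ :=
          lintegral_const_mul _ hhm
      _ ≤ A * ENNReal.ofReal r ^ q * ((μ B)⁻¹ * g) ^ b * (K₁ * g) := by gcongr
      _ = A * ENNReal.ofReal r ^ q * ((μ B)⁻¹ * g) ^ b * (K₁ * ((μ B * (μ B)⁻¹) * g)) := by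
          rw [ENNReal.mul_inv_cancel hB0 hBt, one_mul]
      _ = _ := by rw [hsplit]; ring

/-- Split the ball into the interior `I` and the boundary layer `O`. On `I × I` chain directly; the
layer is controlled by the shift kernels, with absorption for each fixed constant `c = F b`.
Integrating over `b` in `I` bounds `I × B`, and going through `I` gives `B × B`. -/
lemma DoublingWith.exists_pairIntegral_ball_le_dilation_one [NormedSpace ℝ E]
    [FiniteDimensional ℝ E] (hμ : DoublingWith μ D) (hq : 1 ≤ q)
    (hp : 1 ≤ p) (hlam : 1 ≤ lam) (hdecay : p < q → MeasureDecay q p μ) {C : ℝ≥0∞} (hC : C ≠ ∞) :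
    ∃ K : ℝ≥0∞, K ≠ ∞ ∧ ∀ (F : E → ℝ) (G : E → ℝ≥0∞), Measurable F →
      (∃ N : ℝ, ∀ x, |F x| ≤ N) → Measurable G →
      (∀ (x : E) (r : ℝ), 0 < r → pairIntegral μ q F (Metric.ball x r) (Metric.ball x r) ≤
        C * poincareBound μ q p G x r (Metric.ball x (lam * r))) →
      ∀ (x₀ : E) (r : ℝ), 0 < r → pairIntegral μ q F (Metric.ball x₀ r) (Metric.ball x₀ r) ≤
        K * poincareBound μ q p G x₀ r (Metric.ball x₀ r) := by
  have hq0 : 0 ≤ q := by linarith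
  have hp0 : 0 ≤ p := by linarith
  set P : ℝ≥0∞ := D ^ 4 * 2 ^ (q - 1) with hP
  have hPt : P ≠ ∞ := ENNReal.mul_ne_top (hμ.pow_ne_top 4) (two_rpow_ne_top _)
  have hPa : 2 * (P * D ^ 2) ≠ ∞ :=
    ENNReal.mul_ne_top (by norm_num) (ENNReal.mul_ne_top hPt (hμ.pow_ne_top 2))
  -- The number of scales is fixed by the requirement of `ennreal_absorb`.
  obtain ⟨M, hM⟩ := ENNReal.exists_nat_gt hPa
  have hM1 : 1 ≤ M := by
    rcases Nat.eq_zero_or_pos M with h | h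
    · simp [h] at hM
    · exact h
  choose K₁ hK₁ H₁ using hμ.exists_lintegral_shiftKernel_le hq hp hlam hC
  choose K₂ hK₂ H₂ using hμ.exists_lintegral_whitneyRegion_rpow_le hq hp hdecay
  obtain ⟨K₃, hK₃, H₃⟩ := hμ.exists_pairIntegral_region_le hq hp hlam hC (4 ^ M)
  set Ks : ℝ≥0∞ := ∑ i ∈ Finset.range M, K₁ i * K₂ (i + 3) with hKs
  have hKst : Ks ≠ ∞ := ENNReal.sum_ne_top.2 fun i _ => ENNReal.mul_ne_top (hK₁ i) (hK₂ _)
  set K₄ : ℝ≥0∞ := 2 * M * (K₃ * compareConst D q p (2 * M)) + 2 * P * Ks with hK₄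
  have hK₄t : K₄ ≠ ∞ := by
    refine ENNReal.add_ne_top.2 ⟨ENNReal.mul_ne_top (ENNReal.mul_ne_top (by norm_num)
      (ENNReal.natCast_ne_top M)) (ENNReal.mul_ne_top hK₃ (hμ.compareConst_ne_top hq0 hp0 _)),
      ENNReal.mul_ne_top (ENNReal.mul_ne_top (by norm_num) hPt) hKst⟩
  refine ⟨2 ^ (q - 1) * (2 * (K₄ * D)), ENNReal.mul_ne_top (two_rpow_ne_top _)
    (ENNReal.mul_ne_top (by norm_num) (ENNReal.mul_ne_top hK₄t hμ.ne_top)), ?_⟩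
  intro F G hF hFb hG hFG x₀ r hr
  obtain ⟨N, hN⟩ := hFb
  set B := Metric.ball x₀ r with hBdef
  have hB : MeasurableSet B := Metric.isOpen_ball.measurableSet
  have hB0 : μ B ≠ 0 := hμ.ball_ne_zero x₀ hr
  have hBt : μ B ≠ ∞ := hμ.ball_ne_top x₀ r
  set Q := poincareBound μ q p G x₀ r B with hQ
  -- A point of depth below `η r` can be pushed to depth `2 · 4^i` times larger, for every `i < M`,
  -- without exceeding `r`.
  set η : ℝ := (4 ^ M)⁻¹ with hη
  have h4M : (4 : ℝ) ≤ 4 ^ M := by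
    calc (4 : ℝ) = 4 ^ 1 := by norm_num
      _ ≤ 4 ^ M := pow_le_pow_right₀ (by norm_num) hM1
  have hη0 : 0 < η := by positivity
  have hη4 : 4 ^ M * η = 1 := mul_inv_cancel₀ (by positivity)
  have hη1 : η ≤ 1 / 4 := by nlinarith
  set O : Set E := {y | y ∈ B ∧ depth x₀ r y < η * r} with hO
  set I : Set E := {y | η * r ≤ depth x₀ r y} with hI
  have hOm : MeasurableSet O :=
    hB.inter (measurableSet_lt continuous_depth.measurable measurable_const)
  have hηr : 0 < η * r := by positivity
  have hIB : I ⊆ B := fun y hy => mem_ball_iff_depth_pos.2 (hηr.trans_le hy)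
  have hBIO : B ⊆ I ∪ O := fun y hy => by
    rcases le_or_gt (η * r) (depth x₀ r y) with h | h
    · exact Or.inl h
    · exact Or.inr ⟨hy, h⟩
  have hII : pairIntegral μ q F I I ≤ K₃ * compareConst D q p (2 * M) * Q := by
    refine (H₃ F G hF hFG B (convex_ball _ _) (η * r) hηr x₀ I ?_ ?_).trans ?_
    · rw [← mul_assoc, hη4, one_mul]; exact hIB
    · intro b hb
      refine Metric.ball_subset_ball' ?_
      have : η * r ≤ r - dist b x₀ := hb
      linarith
    · rw [mul_assoc]
      have h2 : (2 : ℝ) ^ (2 * M) = 4 ^ M := by rw [pow_mul]; norm_num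
      refine mul_le_mul_right (hμ.poincareBound_le hq0 hp0 hηr hr (2 * M) ?_ ?_ subset_rfl) _
      · rw [dist_self, h2]; nlinarith
      · rw [dist_self, h2, ← mul_assoc, hη4]; linarith
  have hSle : ∑ i ∈ Finset.range M, ∫⁻ y in O, ∫⁻ z, edist (F y) (F z) ^ q *
      shiftKernel μ x₀ r i (y, z) ∂μ ∂μ ≤ Ks * (μ B * (ENNReal.ofReal r ^ q *
        ((μ B)⁻¹ * ∫⁻ w in B, G w ∂μ) ^ (q / p))) := by
    rw [hKs, Finset.sum_mul]
    refine Finset.sum_le_sum fun i _ => ?_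
    refine (lintegral_mono_set fun y hy => hy.1).trans ((H₁ i F G hF hFG x₀ r).trans ?_)
    rw [mul_assoc]
    exact mul_le_mul_right (H₂ (i + 3) G hG x₀ r hr) _
  set S := ∑ i ∈ Finset.range M, ∫⁻ y in O, ∫⁻ z, edist (F y) (F z) ^ q *
      shiftKernel μ x₀ r i (y, z) ∂μ ∂μ with hS
  have hpt : ∀ c ∈ Set.range F, ∫⁻ y in B, edist c (F y) ^ q ∂μ ≤
      2 * M * (∫⁻ y in I, edist c (F y) ^ q ∂μ) + 2 * P * S := by
    rintro _ ⟨b, rfl⟩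
    simp_rw [edist_comm (F b)]
    refine ennreal_absorb (X := ∫⁻ y in O, edist (F y) (F b) ^ q ∂μ) (a := D ^ 2) ?_
      (ENNReal.natCast_ne_top M) (by exact_mod_cast hM1) hM.le ?_ ?_
    -- Boundedness of `F` enters here: it makes the term to be absorbed finite.
    · refine ((setLIntegral_mono' (g := fun _ => ENNReal.ofReal (2 * N) ^ q) hB
        fun y _ => ENNReal.rpow_le_rpow ?_ hq0).trans_lt ?_).ne
      · rw [edist_dist, Real.dist_eq]
        refine ENNReal.ofReal_le_ofReal ?_
        have h1 := abs_le.1 (hN y)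
        have h2 := abs_le.1 (hN b)
        exact abs_le.2 ⟨by linarith, by linarith⟩
      · simp only [lintegral_const, Measure.restrict_apply_univ]
        exact ENNReal.mul_lt_top (ENNReal.rpow_lt_top_of_nonneg hq0 ENNReal.ofReal_ne_top)
          hBt.lt_top
    · have := lintegral_le_of_kernel (μ := μ) (Finset.range M)
        (κ := shiftKernel μ x₀ r) measurable_shiftKernel hOm hB hF hq (F b)
        (c₁ := D ^ 4) (c₂ := D ^ 2) ?_ ?_ ?_
      · rwa [Finset.card_range] at this
      · intro i hi y hy
        refine hμ.one_le_lintegral_shiftKernel (mem_ball_iff_depth_pos.1 hy.1) ?_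
        have h1 : (4 : ℝ) ^ (i + 1) ≤ 4 ^ M :=
          pow_le_pow_right₀ (by norm_num) (Finset.mem_range.1 hi)
        have h2 := hy.2
        have h3 := mem_ball_iff_depth_pos.1 hy.1
        have h5 : (0 : ℝ) < 4 ^ i := by positivity
        rw [pow_succ] at h1
        calc 2 * (4 ^ i * depth x₀ r y) ≤ 4 ^ M * depth x₀ r y := by nlinarith
          _ ≤ 4 ^ M * (η * r) := by gcongr
          _ = r := by rw [← mul_assoc, hη4, one_mul]
      · intro i y hy z hz
        refine indicator_of_notMem (fun h => hz (mem_ball_iff_depth_pos.2 ?_)) _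
        have h1 := depth_pos_of_mem_shiftSet h
        have h2 := h.2.1
        have h5 : (0 : ℝ) < 4 ^ i := by positivity
        dsimp only at h1 h2
        nlinarith
      · intro z hz
        exact hμ.sum_lintegral_shiftKernel_le M O hz
    · exact (lintegral_mono_set hBIO).trans (lintegral_union_le _ _ _)
  have hk := measurable_edist_rpow hF q
  have hIBle : pairIntegral μ q F I B ≤ K₄ * Q := by
    calc pairIntegral μ q F I B
        ≤ ∫⁻ b in I, (2 * M * (∫⁻ y in I, edist (F b) (F y) ^ q ∂μ) + 2 * P * S) ∂μ :=
          lintegral_mono fun b => hpt _ ⟨b, rfl⟩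
      _ = 2 * M * pairIntegral μ q F I I + 2 * P * S * μ I := by
          rw [lintegral_add_right _ measurable_const, lintegral_const,
            Measure.restrict_apply_univ, lintegral_const_mul _ hk.lintegral_prod_right',
            pairIntegral]
      _ ≤ 2 * M * (K₃ * compareConst D q p (2 * M) * Q) + 2 * P * (Ks * (μ B *
            (ENNReal.ofReal r ^ q * ((μ B)⁻¹ * ∫⁻ w in B, G w ∂μ) ^ (q / p)))) * μ B := by
          gcongr
      _ = K₄ * Q := by rw [hK₄, hQ, poincareBound]; ring
  have hBI : μ B ≤ D * μ I := by
    have h1 := hμ.ball_le (x := x₀) (y := x₀) (r := r) (s := r / 2) (by positivity) 1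
      (by rw [dist_self]; linarith)
    rw [pow_one] at h1
    refine h1.trans (mul_le_mul_right (measure_mono fun y hy => ?_) _)
    rw [Metric.mem_ball] at hy
    change η * r ≤ r - dist y x₀
    nlinarith
  have hI0 : μ I ≠ 0 := fun h => hB0 (by simpa [h] using hBI)
  have hIt : μ I ≠ ∞ := ((measure_mono hIB).trans_lt hBt.lt_top).ne
  refine ennreal_le_of_mul_le_mul hI0 hIt ?_
  calc pairIntegral μ q F B B * μ I
      ≤ 2 ^ (q - 1) * (pairIntegral μ q F B I * μ B + pairIntegral μ q F I B * μ B) :=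
        pairIntegral_trans hF hq B B I
    _ = 2 ^ (q - 1) * (2 * (pairIntegral μ q F I B * μ B)) := by
        rw [pairIntegral_comm hF B I]; ring
    _ ≤ 2 ^ (q - 1) * (2 * (K₄ * Q * (D * μ I))) := by gcongr
    _ = _ := by ring

end Dilation


/-! ### Lipschitz bump functions and their upper gradients. -/

section Bump

variable {X : Type*} [MetricSpace X]

lemma dist_le_of_hasUnitSpeedOn {γ : ℝ → X} {l s t : ℝ} (h : HasUnitSpeedOn γ (Icc 0 l))
    (hs : s ∈ Icc 0 l) (ht : t ∈ Icc 0 l) (hst : s ≤ t) : dist (γ s) (γ t) ≤ t - s := by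
  have h1 := h hs ht
  have h2 := eVariationOn.edist_le γ (s := Icc 0 l ∩ Icc s t) (x := s) (y := t)
    ⟨hs, le_rfl, hst⟩ ⟨ht, hst, le_rfl⟩
  rw [h1, NNReal.coe_one, one_mul, edist_dist] at h2
  exact (ENNReal.ofReal_le_ofReal_iff (by linarith)).1 h2

lemma continuousOn_of_hasUnitSpeedOn {γ : ℝ → X} {l : ℝ} (h : HasUnitSpeedOn γ (Icc 0 l)) :
    ContinuousOn γ (Icc 0 l) := by
  have : LipschitzOnWith 1 γ (Icc 0 l) := LipschitzOnWith.of_dist_le_mul fun s hs t ht => by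
    rw [NNReal.coe_one, one_mul, Real.dist_eq]
    rcases le_total s t with hst | hst
    · rw [abs_sub_comm]
      exact (dist_le_of_hasUnitSpeedOn h hs ht hst).trans (le_abs_self _)
    · rw [dist_comm]
      exact (dist_le_of_hasUnitSpeedOn h ht hs hst).trans (le_abs_self _)
  exact this.continuousOn

/-- The Lipschitz function which is `1` in `B(y,s)` and `0` outside `B(y,2s)`. -/
noncomputable def bump (y : X) (s : ℝ) (z : X) : ℝ := max 0 (min 1 (2 - dist z y / s))

variable {y : X} {s : ℝ}

lemma bump_nonneg (z : X) : 0 ≤ bump y s z := le_max_left _ _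

lemma bump_le_one (z : X) : bump y s z ≤ 1 := max_le zero_le_one (min_le_left _ _)

lemma bump_eq_one (hs : 0 < s) {z : X} (hz : z ∈ Metric.ball y s) : bump y s z = 1 := by
  have : dist z y / s ≤ 1 := (div_le_one hs).2 (Metric.mem_ball.1 hz).le
  rw [bump, min_eq_left (by linarith), max_eq_right zero_le_one]

lemma bump_eq_zero (hs : 0 < s) {z : X} (hz : z ∉ Metric.ball y (2 * s)) : bump y s z = 0 := by
  have : 2 ≤ dist z y / s := by
    rw [le_div_iff₀ hs]; exact not_lt.1 (fun h => hz (Metric.mem_ball.2 h))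
  rw [bump, max_eq_left]
  exact (min_le_right _ _).trans (by linarith)

lemma continuous_bump : Continuous (bump y s) := by unfold bump; fun_prop

lemma abs_bump_sub_le (hs : 0 < s) (z w : X) : |bump y s z - bump y s w| ≤ s⁻¹ * dist z w := by
  have h1 : |bump y s z - bump y s w| ≤ |(2 - dist z y / s) - (2 - dist w y / s)| := by
    have h := ((LipschitzWith.id (α := ℝ)).const_min 1).const_max 0
    have h2 := h.dist_le_mul (2 - dist z y / s) (2 - dist w y / s)
    rwa [NNReal.coe_one, one_mul, Real.dist_eq, Real.dist_eq] at h2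
  refine h1.trans ?_
  have e : (2 - dist z y / s) - (2 - dist w y / s) = s⁻¹ * (dist w y - dist z y) := by
    field_simp; ring
  rw [e, abs_mul, abs_of_pos (inv_pos.2 hs), dist_comm z w]
  exact mul_le_mul_of_nonneg_left (abs_dist_sub_le _ _ _) (inv_pos.2 hs).le

variable [MeasurableSpace X] [BorelSpace X]

/-- The gradient has to vanish outside the support, so a Lipschitz bound along the whole curve is
not enough. Only the time before the first zero and after the last zero of the bump along the curve
is used; there the curve runs inside `B(y,2s)`. -/
lemma isUpperGradient_bump (hs : 0 < s) :
    IsUpperGradient ((Metric.ball y (2 * s)).indicator fun _ => ENNReal.ofReal s⁻¹)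
      (fun z => (bump y s z : EReal)) := by
  refine ⟨measurable_const.indicator Metric.isOpen_ball.measurableSet, fun l γ hl hγ => ?_⟩
  rw [ereal_abs_coe_sub_coe]
  have hs' : 0 < s⁻¹ := inv_pos.2 hs
  set h : ℝ → ℝ := fun t => bump y s (γ t) with hh
  have hlip : ∀ a ∈ Icc 0 l, ∀ b ∈ Icc 0 l, a ≤ b → |h a - h b| ≤ s⁻¹ * (b - a) :=
    fun a ha b hb hab => (abs_bump_sub_le hs _ _).trans
      (mul_le_mul_of_nonneg_left (dist_le_of_hasUnitSpeedOn hγ ha hb hab) hs'.le)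
  have hcont : ContinuousOn h (Icc 0 l) :=
    continuous_bump.comp_continuousOn (continuousOn_of_hasUnitSpeedOn hγ)
  have hlow : ∀ S : Set ℝ, MeasurableSet S → S ⊆ Icc 0 l → (∀ t ∈ S, h t ≠ 0) →
      ENNReal.ofReal s⁻¹ * volume S ≤ ∫⁻ t in Icc 0 l,
        (Metric.ball y (2 * s)).indicator (fun _ => ENNReal.ofReal s⁻¹) (γ t) := by
    intro S hS hSl hSh
    calc ENNReal.ofReal s⁻¹ * volume S = ∫⁻ _ in S, ENNReal.ofReal s⁻¹ := by simp
      _ ≤ ∫⁻ t in S, (Metric.ball y (2 * s)).indicator (fun _ => ENNReal.ofReal s⁻¹) (γ t) := by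
          refine setLIntegral_mono' hS fun t ht => ?_
          rw [indicator_of_mem]
          by_contra hc
          exact hSh t ht (bump_eq_zero hs hc)
      _ ≤ _ := lintegral_mono_set hSl
  have h0 : (0 : ℝ) ∈ Icc 0 l := ⟨le_rfl, hl.le⟩
  have h1 : l ∈ Icc 0 l := ⟨hl.le, le_rfl⟩
  rw [edist_dist, Real.dist_eq]
  change ENNReal.ofReal |h 0 - h l| ≤ _
  -- The zero set is compact, so unless it is empty it has a first and a last element.
  set Z := Icc 0 l ∩ h ⁻¹' {0} with hZ
  have hZc : IsCompact Z :=
    isCompact_Icc.of_isClosed_subset (hcont.preimage_isClosed_of_isClosed isClosed_Icc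
      isClosed_singleton) inter_subset_left
  rcases Z.eq_empty_or_nonempty with hZe | hZn
  · refine le_trans ?_ (hlow (Icc 0 l) measurableSet_Icc subset_rfl fun t ht h => ?_)
    · rw [Real.volume_Icc, ← ENNReal.ofReal_mul hs'.le]
      exact ENNReal.ofReal_le_ofReal (hlip 0 h0 l h1 hl.le)
    · have : t ∈ Z := ⟨ht, h⟩
      simp [hZe] at this
  · obtain ⟨a, ⟨haI, ha0⟩, haz⟩ := hZc.exists_isLeast hZn
    obtain ⟨b, ⟨hbI, hb0⟩, hbz⟩ := hZc.exists_isGreatest hZn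
    have ha0' : h a = 0 := ha0
    have hb0' : h b = 0 := hb0
    have hab : a ≤ b := haz ⟨hbI, hb0⟩
    refine le_trans ?_ (hlow (Ico 0 a ∪ Ioc b l) (measurableSet_Ico.union measurableSet_Ioc) ?_ ?_)
    · rw [measure_union _ measurableSet_Ioc, Real.volume_Ico, Real.volume_Ioc,
        ← ENNReal.ofReal_add (by linarith [haI.1]) (by linarith [hbI.2]),
        ← ENNReal.ofReal_mul hs'.le]
      · refine ENNReal.ofReal_le_ofReal ?_
        have e1 := hlip 0 h0 a haI haI.1
        have e2 := hlip b hbI l h1 hbI.2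
        rw [ha0'] at e1
        rw [hb0'] at e2
        have e3 := abs_sub (h 0 - 0) (h l - 0)
        rw [abs_sub_comm 0] at e2
        simp only [sub_zero] at e1 e2 e3
        linarith
      · rw [Set.disjoint_left]
        intro t ht ht'
        exact absurd ht.2 (not_lt.2 (hab.trans ht'.1.le))
    · rintro t (ht | ht)
      · exact ⟨ht.1, ht.2.le.trans haI.2⟩
      · exact ⟨hbI.1.trans ht.1.le, ht.2⟩
    · rintro t (ht | ht) h
      · exact absurd (haz ⟨⟨ht.1, ht.2.le.trans haI.2⟩, h⟩) (not_le.2 ht.2)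
      · exact absurd (hbz ⟨⟨hbI.1.trans ht.1.le, ht.2⟩, h⟩) (not_le.2 ht.1)

lemma isIntegrable_bump {μ : Measure X} (hs : 0 < s) (hfin : μ (Metric.ball y (2 * s)) < ∞) :
    IsIntegrable (fun z => (bump y s z : EReal)) μ := by
  refine ⟨(measurable_coe_real_ereal.comp continuous_bump.measurable).aemeasurable, ?_⟩
  calc ∫⁻ z, (bump y s z : EReal).abs ∂μ
      ≤ ∫⁻ z, (Metric.ball y (2 * s)).indicator (fun _ => 1) z ∂μ := by
        refine lintegral_mono fun z => ?_
        rw [EReal.abs_def]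
        by_cases hz : z ∈ Metric.ball y (2 * s)
        · rw [indicator_of_mem hz, abs_of_nonneg (bump_nonneg z)]
          exact ENNReal.ofReal_le_one.2 (bump_le_one z)
        · rw [bump_eq_zero hs hz]; simp
    _ < ∞ := by
        rw [lintegral_indicator_const Metric.isOpen_ball.measurableSet, one_mul]
        exact hfin

end Bump

/-! ### Measure decay from the Poincaré inequality. -/

section DilationOne

variable {E : Type*} [NormedAddCommGroup E] [NormedSpace ℝ E] [MeasurableSpace E] [BorelSpace E]
  {μ : Measure E} {D : ℝ≥0∞} {q p lam : ℝ}

/-- Test with the bump at `B(x,s)` on the ball `B(x,4r)`. The pairs in `B(x,s) × B(w,r)` contribute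
1 each, and the gradient integral is at most `s^(-p) D μ(B(x,s))` whatever the dilation; solving for
`μ(B(x,s))` gives the decay. -/
lemma PairPoincare.measureDecay [Nontrivial E] (hμ : DoublingWith μ D) (hp : 1 ≤ p) (hpq : p < q)
    (h : PairPoincare q p lam μ) : MeasureDecay q p μ := by
  obtain ⟨C, hC, h⟩ := h
  have hp0 : 0 < p := by linarith
  have hq0 : 0 < q := by linarith
  have hqp : 0 < q / p := by positivity
  set b : ℝ := q / p - 1 with hb
  have hb0 : 0 ≤ b := by rw [hb, sub_nonneg]; exact (one_le_div hp0).2 hpq.le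
  have hsplit : ∀ t : ℝ≥0∞, t ^ (q / p) = t ^ b * t := fun t => by
    rw [show q / p = b + 1 by rw [hb]; ring, ENNReal.rpow_add_of_nonneg _ _ hb0 zero_le_one,
      ENNReal.rpow_one]
  refine ⟨D ^ 3 * C * ENNReal.ofReal 4 ^ q * D ^ (q / p), ENNReal.mul_ne_top (ENNReal.mul_ne_top
    (ENNReal.mul_ne_top (hμ.pow_ne_top 3) hC) (ENNReal.rpow_ne_top_of_nonneg hq0.le
      ENNReal.ofReal_ne_top)) (ENNReal.rpow_ne_top_of_nonneg hqp.le hμ.ne_top), ?_⟩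
  intro x₀ x r s hs hsr hx
  have hr : 0 < r := hs.trans_le hsr
  -- At distance `3r` from `x`, the ball `B(w,r)` is disjoint from `B(x,2s)` and still contained in
  -- `B(x,4r)`.
  obtain ⟨e, he⟩ := exists_norm_eq E (c := 3 * r) (by positivity)
  set w := x + e with hw
  have hwx : dist w x = 3 * r := by rw [dist_eq_norm, hw, add_sub_cancel_left, he]
  set m := μ (Metric.ball x s) with hm
  set N := μ (Metric.ball x (4 * r)) with hN
  have hm0 : m ≠ 0 := hμ.ball_ne_zero x hs
  have hmt : m ≠ ∞ := hμ.ball_ne_top x s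
  have hN0 : N ≠ 0 := hμ.ball_ne_zero x (by positivity)
  have hNt : N ≠ ∞ := hμ.ball_ne_top x _
  have hpair := h _ _ (bump x s) (isIntegrable_bump hs (hμ.lt_top x _)) (isUpperGradient_bump hs)
    continuous_bump.measurable ⟨1, fun z => by
      rw [abs_of_nonneg (bump_nonneg z)]; exact bump_le_one z⟩ (ae_of_all _ fun _ => rfl)
    x (4 * r) (by positivity)
  have hlow : m * μ (Metric.ball w r) ≤
      pairIntegral μ q (bump x s) (Metric.ball x (4 * r)) (Metric.ball x (4 * r)) := by
    calc m * μ (Metric.ball w r)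
        = ∫⁻ _ in Metric.ball x s, ∫⁻ _ in Metric.ball w r, 1 ∂μ ∂μ := by simp [hm, mul_comm]
      _ ≤ ∫⁻ a in Metric.ball x s, ∫⁻ b in Metric.ball w r,
            edist (bump x s a) (bump x s b) ^ q ∂μ ∂μ := by
          refine setLIntegral_mono' Metric.isOpen_ball.measurableSet fun a ha =>
            setLIntegral_mono' Metric.isOpen_ball.measurableSet fun c hc => ?_
          have hc' : c ∉ Metric.ball x (2 * s) := by
            rw [Metric.mem_ball] at hc ⊢
            have := dist_triangle w c x
            rw [dist_comm w c] at this
            linarith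
          rw [bump_eq_one hs ha, bump_eq_zero hs hc']
          simp [edist_dist]
      _ ≤ _ := pairIntegral_mono (Metric.ball_subset_ball (by linarith))
          (Metric.ball_subset_ball' (by linarith))
  have hNw : N ≤ D ^ 3 * μ (Metric.ball w r) :=
    hμ.ball_le hr 3 (by rw [dist_comm, hwx]; linarith)
  have hg : ∫⁻ z in Metric.ball x (lam * (4 * r)), (Metric.ball x (2 * s)).indicator
      (fun _ => ENNReal.ofReal s⁻¹) z ^ p ∂μ ≤ ENNReal.ofReal s⁻¹ ^ p * (D * m) := by
    calc _ ≤ ∫⁻ z, (Metric.ball x (2 * s)).indicator (fun _ => ENNReal.ofReal s⁻¹ ^ p) z ∂μ := by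
          refine (setLIntegral_le_lintegral _ _).trans (lintegral_mono fun z => ?_)
          by_cases hz : z ∈ Metric.ball x (2 * s)
          · rw [indicator_of_mem hz, indicator_of_mem hz]
          · rw [indicator_of_notMem hz, indicator_of_notMem hz, ENNReal.zero_rpow_of_pos hp0]
      _ = ENNReal.ofReal s⁻¹ ^ p * μ (Metric.ball x (2 * s)) :=
          lintegral_indicator_const Metric.isOpen_ball.measurableSet _
      _ ≤ _ := mul_le_mul_right (hμ.le x s hs) _
  set σ := ENNReal.ofReal s with hσ
  have hσ0 : σ ≠ 0 := by simpa [hσ] using hs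
  have hσt : σ ≠ ∞ := ENNReal.ofReal_ne_top
  have hσq : σ ^ q * σ⁻¹ ^ q = 1 := by
    rw [← ENNReal.mul_rpow_of_nonneg _ _ hq0.le, ENNReal.mul_inv_cancel hσ0 hσt, ENNReal.one_rpow]
  have hNb : N ^ b * N⁻¹ ^ b = 1 := by
    rw [← ENNReal.mul_rpow_of_nonneg _ _ hb0, ENNReal.mul_inv_cancel hN0 hNt, ENNReal.one_rpow]
  have hNN : N * N⁻¹ = 1 := ENNReal.mul_inv_cancel hN0 hNt
  rw [ENNReal.ofReal_inv_of_pos hs] at hg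
  have hBN : μ (Metric.ball x₀ r) ≤ N := by
    refine measure_mono (Metric.ball_subset_ball' ?_)
    rw [dist_comm]
    linarith [Metric.mem_ball.1 hx]
  refine (mul_le_mul_right (ENNReal.rpow_le_rpow hBN hb0) _).trans ?_
  refine ennreal_le_of_mul_le_mul (mul_ne_zero hm0 hN0) (ENNReal.mul_ne_top hmt hNt) ?_
  calc σ ^ q * N ^ b * (m * N) ≤ σ ^ q * N ^ b * (m * (D ^ 3 * μ (Metric.ball w r))) := by gcongr
    _ = σ ^ q * N ^ b * D ^ 3 * (m * μ (Metric.ball w r)) := by ring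
    _ ≤ σ ^ q * N ^ b * D ^ 3 * (C * (N ^ 2 * ENNReal.ofReal (4 * r) ^ q *
          (N⁻¹ * (σ⁻¹ ^ p * (D * m))) ^ (q / p))) := by
        refine mul_le_mul_right (hlow.trans (hpair.trans (mul_le_mul_right ?_ _))) _
        rw [poincareBound, ENNReal.ofReal_inv_of_pos hs]
        exact mul_le_mul_right (ENNReal.rpow_le_rpow (mul_le_mul_right hg _) hqp.le) _
    _ = (σ ^ q * σ⁻¹ ^ q) * (N ^ b * N⁻¹ ^ b) * (N * N⁻¹) * (D ^ 3 * C * ENNReal.ofReal 4 ^ q *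
          D ^ (q / p) * ENNReal.ofReal r ^ q * m ^ b * (m * N)) := by
        rw [ENNReal.mul_rpow_of_nonneg N⁻¹ _ hqp.le, ENNReal.mul_rpow_of_nonneg _ (D * m) hqp.le,
          ENNReal.mul_rpow_of_nonneg D m hqp.le, ← ENNReal.rpow_mul, mul_div_cancel₀ q hp0.ne',
          hsplit N⁻¹, hsplit m, ENNReal.ofReal_mul (by norm_num),
          ENNReal.mul_rpow_of_nonneg _ _ hq0.le]
        ring
    _ = _ := by rw [hσq, hNb, hNN]; ring

lemma PairPoincare.dilation_one [FiniteDimensional ℝ E] [Nontrivial E] [SFinite μ]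
    (hμ : DoublingWith μ D) (hq : 1 ≤ q) (hp : 1 ≤ p) (hlam : 1 ≤ lam)
    (h : PairPoincare q p lam μ) : PairPoincare q p 1 μ := by
  have hdecay : p < q → MeasureDecay q p μ := fun hpq => h.measureDecay hμ hp hpq
  have : ProperSpace E := FiniteDimensional.proper_real E
  obtain ⟨C, hC, h⟩ := h
  obtain ⟨K, hK, H⟩ := hμ.exists_pairIntegral_ball_le_dilation_one hq hp hlam hdecay hC
  refine ⟨K, hK, fun f g F hf hg hF hFb hfF x r hr => ?_⟩
  rw [one_mul]
  exact H F _ hF hFb (hg.1.pow_const p) (h f g F hf hg hF hFb hfF) x r hr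

end DilationOne


/-! ### Composition of functions and upper gradients with a map. -/

section Pullback

variable {X Y : Type*} [MeasurableSpace X] [MeasurableSpace Y] {ν : Measure X} {μ : Measure Y}
  {Φ : X → Y} {c : ℝ≥0∞} {q : ℝ}

lemma quasiMeasurePreserving_of_map_le (hΦ : Measurable Φ) (hle : ν.map Φ ≤ c • μ) :
    Measure.QuasiMeasurePreserving Φ ν μ :=
  ⟨hΦ, (Measure.absolutelyContinuous_of_le hle).trans Measure.smul_absolutelyContinuous⟩

lemma IsIntegrable.comp {f : Y → EReal} (hf : IsIntegrable f μ) (hΦ : Measurable Φ)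
    (hc : c ≠ ∞) (hle : ν.map Φ ≤ c • μ) : IsIntegrable (fun x => f (Φ x)) ν := by
  have hqm := quasiMeasurePreserving_of_map_le hΦ hle
  refine ⟨hf.1.comp_quasiMeasurePreserving hqm, ?_⟩
  have hm : AEMeasurable (fun y => (f y).abs) (ν.map Φ) :=
    (measurable_ereal_abs.comp_aemeasurable hf.1).mono_ac hqm.absolutelyContinuous
  rw [← lintegral_map' hm hΦ.aemeasurable]
  refine (lintegral_mono' hle le_rfl).trans_lt ?_
  rw [lintegral_smul_measure]
  exact ENNReal.mul_lt_top hc.lt_top hf.2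

lemma setLIntegral_comp_le {h : Y → ℝ≥0∞} (hh : Measurable h) (hΦ : Measurable Φ)
    (hle : ν.map Φ ≤ c • μ) {A : Set X} {B : Set Y} (hB : MeasurableSet B) (hAB : MapsTo Φ A B) :
    ∫⁻ x in A, h (Φ x) ∂ν ≤ c * ∫⁻ y in B, h y ∂μ := by
  calc ∫⁻ x in A, h (Φ x) ∂ν ≤ ∫⁻ x in Φ ⁻¹' B, h (Φ x) ∂ν := lintegral_mono_set hAB
    _ = ∫⁻ y in B, h y ∂(ν.map Φ) := (setLIntegral_map hB hh hΦ).symm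
    _ ≤ ∫⁻ y in B, h y ∂(c • μ) := lintegral_mono' (Measure.restrict_mono subset_rfl hle) le_rfl
    _ = _ := by rw [Measure.restrict_smul, lintegral_smul_measure, smul_eq_mul]

lemma pairIntegral_map [SFinite ν] {F : Y → ℝ} (hF : Measurable F) (hΦ : Measurable Φ)
    {A B : Set Y} (hA : MeasurableSet A) (hB : MeasurableSet B) :
    pairIntegral (ν.map Φ) q F A B = pairIntegral ν q (fun x => F (Φ x)) (Φ ⁻¹' A) (Φ ⁻¹' B) := by
  unfold pairIntegral
  rw [setLIntegral_map hA (measurable_edist_rpow hF q).lintegral_prod_right' hΦ]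
  refine lintegral_congr fun a => ?_
  exact setLIntegral_map hB (measurable_edist_rpow_right hF q (F (Φ a))) hΦ

lemma pairIntegral_restrict {F : Y → ℝ} {A S : Set Y} (hA : MeasurableSet A) :
    pairIntegral (μ.restrict S) q F A A = pairIntegral μ q F (A ∩ S) (A ∩ S) := by
  unfold pairIntegral
  rw [Measure.restrict_restrict hA]

end Pullback

section UpperGradientComp

variable {X Y : Type*} [MetricSpace X] [MeasurableSpace X] [MetricSpace Y] [MeasurableSpace Y]

lemma IsUpperGradient.comp {f : Y → EReal} {g : Y → ℝ≥0∞} (hg : IsUpperGradient g f)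
    {Φ : X → Y} (hΦ : Measurable Φ)
    (hcurve : ∀ (l : ℝ) (γ : ℝ → X), HasUnitSpeedOn γ (Icc 0 l) →
      HasUnitSpeedOn (fun t => Φ (γ t)) (Icc 0 l)) :
    IsUpperGradient (fun x => g (Φ x)) (fun x => f (Φ x)) :=
  ⟨hg.1.comp hΦ, fun l γ hl hγ => hg.2 l (fun t => Φ (γ t)) hl (hcurve l γ hγ)⟩

omit [MeasurableSpace X] [MeasurableSpace Y] in
lemma hasUnitSpeedOn_isometry_comp {Φ : X → Y} (hΦ : Isometry Φ) {γ : ℝ → X} {s : Set ℝ}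
    (h : HasUnitSpeedOn γ s) : HasUnitSpeedOn (fun t => Φ (γ t)) s := by
  intro x hx y hy
  rw [← h hx hy]
  simp only [eVariationOn, hΦ.edist_eq]

end UpperGradientComp

/-! ### Rotated copies of the positive hyperquadrant. -/

section Quadrant

variable {n : ℕ}

lemma IsRadialMeasure.map_eq {μ : Measure (EuclideanSpace ℝ (Fin n))} (h : IsRadialMeasure μ)
    (T : EuclideanSpace ℝ (Fin n) ≃ₗᵢ[ℝ] EuclideanSpace ℝ (Fin n)) : μ.map T = μ := by
  obtain ⟨w, -, -, rfl⟩ := h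
  ext S hS
  rw [Measure.map_apply T.continuous.measurable hS, withDensity_apply _ hS,
    withDensity_apply _ (T.continuous.measurable hS)]
  simpa using T.measurePreserving.setLIntegral_comp_preimage_emb
    T.toHomeomorph.measurableEmbedding (fun x => w ‖x‖₊) S

lemma isClosed_posHyperquadrant (n : ℕ) : IsClosed (posHyperquadrant n) := by
  simp only [posHyperquadrant, ofPred_forall]
  exact isClosed_iInter fun j => isClosed_le continuous_const (by fun_prop)

lemma measurableSet_posHyperquadrant (n : ℕ) : MeasurableSet (posHyperquadrant n) :=
  (isClosed_posHyperquadrant n).measurableSet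

/-- The unit vector on the diagonal of the positive hyperquadrant. -/
noncomputable def diagonal (n : ℕ) : EuclideanSpace ℝ (Fin n) :=
  WithLp.toLp 2 fun _ => (√n)⁻¹

lemma norm_diagonal (hn : n ≠ 0) : ‖diagonal n‖ = 1 := by
  have h : (0 : ℝ) < n := by exact_mod_cast Nat.pos_of_ne_zero hn
  rw [EuclideanSpace.norm_eq]
  simp [diagonal, Real.sq_sqrt h.le, h.ne']

/-- Moving by `t` along the diagonal raises every coordinate by `t/√n`, which leaves room for an
error of norm at most `s`. -/
lemma mem_posHyperquadrant_of_norm_sub_le {x y : EuclideanSpace ℝ (Fin n)} {s t : ℝ}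
    (hx : x ∈ posHyperquadrant n) (hst : s ≤ t * (√n)⁻¹) (h : ‖y - (x + t • diagonal n)‖ ≤ s) :
    y ∈ posHyperquadrant n := by
  intro j
  have h1 := (PiLp.norm_apply_le (y - (x + t • diagonal n)) j).trans h
  rw [Real.norm_eq_abs, abs_le] at h1
  have h2 : (y - (x + t • diagonal n)) j = y j - (x j + t * (√n)⁻¹) := by simp [diagonal]
  rw [h2] at h1
  linarith [hx j, h1.1]

lemma zero_mem_posHyperquadrant : (0 : EuclideanSpace ℝ (Fin n)) ∈ posHyperquadrant n :=
  fun _ => le_rfl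

lemma diagonal_mem_posHyperquadrant {t : ℝ} (ht : 0 ≤ t) : t • diagonal n ∈ posHyperquadrant n :=
  mem_posHyperquadrant_of_norm_sub_le (s := 0) (t := t) zero_mem_posHyperquadrant (by positivity)
    (by simp)

lemma exists_isometry_diagonal (hn : n ≠ 0) {u : EuclideanSpace ℝ (Fin n)} (hu : ‖u‖ = 1) :
    ∃ T : EuclideanSpace ℝ (Fin n) ≃ₗᵢ[ℝ] EuclideanSpace ℝ (Fin n), T (diagonal n) = u :=
  ⟨_, Submodule.reflection_sub ((norm_diagonal hn).trans hu.symm)⟩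

variable {μ : Measure (EuclideanSpace ℝ (Fin n))} {D : ℝ≥0∞} {q p lam : ℝ}

lemma map_isometry_comp_coe (hrad : IsRadialMeasure μ)
    (T : EuclideanSpace ℝ (Fin n) ≃ₗᵢ[ℝ] EuclideanSpace ℝ (Fin n)) :
    (onPosHyperquadrant μ).map (fun x : posHyperquadrant n => T x) = μ.restrict (T '' posHyperquadrant n) := by
  have h1 : (onPosHyperquadrant μ).map (fun x : posHyperquadrant n => T x) =
      ((onPosHyperquadrant μ).map Subtype.val).map T :=
    (Measure.map_map T.continuous.measurable measurable_subtype_coe).symm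
  rw [h1, onPosHyperquadrant, map_comap_subtype_coe (measurableSet_posHyperquadrant n)]
  conv_rhs => rw [← hrad.map_eq T]
  have h2 := T.toHomeomorph.measurableEmbedding.restrict_map μ (T '' posHyperquadrant n)
  rw [LinearIsometryEquiv.coe_toHomeomorph, preimage_image_eq _ T.injective] at h2
  exact h2.symm

lemma onPosHyperquadrant_ball_le (hrad : IsRadialMeasure μ) (x : posHyperquadrant n) (r : ℝ)
    (T : EuclideanSpace ℝ (Fin n) ≃ₗᵢ[ℝ] EuclideanSpace ℝ (Fin n)) :
    onPosHyperquadrant μ (Metric.ball x r) ≤ μ (Metric.ball (T x) r) := by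
  have hm : Measurable fun x : posHyperquadrant n => T x :=
    T.continuous.measurable.comp measurable_subtype_coe
  have h : Metric.ball x r = (fun x : posHyperquadrant n => T x) ⁻¹' Metric.ball (T x) r := by
    ext y; simp [Subtype.dist_eq]
  rw [h, ← Measure.map_apply hm Metric.isOpen_ball.measurableSet, map_isometry_comp_coe hrad]
  exact Measure.restrict_apply_le _ _

/-- A ball of `X₊` contains the Euclidean ball of radius `r/(2√n)` about `x + (r/2) diagonal`;
doubling compares it with the full ball. -/
lemma DoublingWith.exists_ball_le_onPosHyperquadrant (hμ : DoublingWith μ D)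
    (hrad : IsRadialMeasure μ) (hn : n ≠ 0) :
    ∃ k : ℕ, ∀ (x : posHyperquadrant n) (r : ℝ), 0 < r →
      ∀ T : EuclideanSpace ℝ (Fin n) ≃ₗᵢ[ℝ] EuclideanSpace ℝ (Fin n),
      μ (Metric.ball (T x) r) ≤ D ^ k * onPosHyperquadrant μ (Metric.ball x r) := by
  have h : (0 : ℝ) < n := by exact_mod_cast Nat.pos_of_ne_zero hn
  have h1 : (1 : ℝ) ≤ √n := Real.one_le_sqrt.2 (by exact_mod_cast Nat.one_le_iff_ne_zero.2 hn)
  have h0 : (0 : ℝ) < √n := by positivity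
  obtain ⟨k, hk⟩ := pow_unbounded_of_one_lt (4 * √n) (one_lt_two)
  refine ⟨k, fun x r hr T => ?_⟩
  set s := r / 2 * (√n)⁻¹ with hs
  have hs0 : 0 < s := by positivity
  have hsr : s ≤ r / 2 := mul_le_of_le_one_right (by positivity) (inv_le_one_of_one_le₀ h1)
  set z := (x : EuclideanSpace ℝ (Fin n)) + (r / 2) • diagonal n with hz
  have hzx : dist (x : EuclideanSpace ℝ (Fin n)) z = r / 2 := by
    rw [dist_comm, dist_eq_norm, hz, add_sub_cancel_left, norm_smul, norm_diagonal hn, mul_one,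
      Real.norm_of_nonneg (by positivity)]
  have hm : Measurable fun x : posHyperquadrant n => T x :=
    T.continuous.measurable.comp measurable_subtype_coe
  have hb : Metric.ball x r = (fun x : posHyperquadrant n => T x) ⁻¹' Metric.ball (T x) r := by
    ext y; simp [Subtype.dist_eq]
  have e : 2 * r = 4 * √n * s := by rw [hs]; field_simp; ring
  refine (hμ.ball_le (y := T z) hs0 k ?_).trans (mul_le_mul_right ?_ _)
  · rw [T.dist_map, hzx]
    nlinarith
  · rw [hb, ← Measure.map_apply hm Metric.isOpen_ball.measurableSet, map_isometry_comp_coe hrad,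
      Measure.restrict_apply Metric.isOpen_ball.measurableSet]
    refine measure_mono fun w hw => ⟨?_, T.symm w, ?_, T.apply_symm_apply w⟩
    · rw [Metric.mem_ball] at hw ⊢
      have := dist_triangle w (T z) (T x)
      rw [T.dist_map, dist_comm z, hzx] at this
      linarith
    · refine mem_posHyperquadrant_of_norm_sub_le (s := s) (t := r / 2) x.2 le_rfl ?_
      rw [← hz, ← T.norm_map, map_sub, T.apply_symm_apply, ← dist_eq_norm]
      exact (Metric.mem_ball.1 hw).le

lemma DoublingWith.onPosHyperquadrant_ball_pos (hμ : DoublingWith μ D) (hrad : IsRadialMeasure μ)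
    (hn : n ≠ 0) (x : posHyperquadrant n) (r : ℝ) (hr : 0 < r) :
    0 < onPosHyperquadrant μ (Metric.ball x r) := by
  obtain ⟨k, hk⟩ := hμ.exists_ball_le_onPosHyperquadrant hrad hn
  have h1 := hk x r hr (LinearIsometryEquiv.refl ℝ _)
  refine pos_iff_ne_zero.2 fun h => ?_
  rw [h, mul_zero] at h1
  exact hμ.ball_ne_zero _ hr (nonpos_iff_eq_zero.1 h1)

lemma DoublingWith.onPosHyperquadrant_ball_lt_top (hμ : DoublingWith μ D)
    (hrad : IsRadialMeasure μ) (x : posHyperquadrant n) (r : ℝ) :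
    onPosHyperquadrant μ (Metric.ball x r) < ∞ :=
  (onPosHyperquadrant_ball_le hrad x r (LinearIsometryEquiv.refl ℝ _)).trans_lt (hμ.lt_top _ r)

/-- The Poincaré inequality for `F` and `G` on all images of the positive hyperquadrant under
linear isometries. -/
def QuadrantBound (μ : Measure (EuclideanSpace ℝ (Fin n))) (q p lam : ℝ) (C : ℝ≥0∞)
    (F : EuclideanSpace ℝ (Fin n) → ℝ) (G : EuclideanSpace ℝ (Fin n) → ℝ≥0∞) : Prop :=
  ∀ (T : EuclideanSpace ℝ (Fin n) ≃ₗᵢ[ℝ] EuclideanSpace ℝ (Fin n)), ∀ x ∈ posHyperquadrant n,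
    ∀ r : ℝ, 0 < r → pairIntegral μ q F (Metric.ball (T x) r ∩ T '' posHyperquadrant n)
      (Metric.ball (T x) r ∩ T '' posHyperquadrant n) ≤
        C * poincareBound μ q p G (T x) r (Metric.ball (T x) (lam * r))

/-- Apply the inequality on `X₊` to `f ∘ T` and `g ∘ T`: an isometry preserves unit speed curves,
and a radial measure is `T`-invariant. -/
lemma PairPoincare.exists_quadrantBound (hμ : DoublingWith μ D) (hrad : IsRadialMeasure μ)
    (hn : n ≠ 0) (hq : 1 ≤ q) (hp : 1 ≤ p) (h : PairPoincare q p lam (onPosHyperquadrant μ)) :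
    ∃ C : ℝ≥0∞, C ≠ ∞ ∧ ∀ (f : EuclideanSpace ℝ (Fin n) → EReal)
      (g : EuclideanSpace ℝ (Fin n) → ℝ≥0∞) (F : EuclideanSpace ℝ (Fin n) → ℝ), IsIntegrable f μ →
      IsUpperGradient g f → Measurable F → (∃ N : ℝ, ∀ x, |F x| ≤ N) → (∀ᵐ x ∂μ, f x = F x) →
      QuadrantBound μ q p lam C F (fun y => g y ^ p) := by
  have hq0 : 0 ≤ q := by linarith
  have hqp : 0 ≤ q / p := div_nonneg hq0 (by linarith)
  obtain ⟨C, hC, h⟩ := h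
  obtain ⟨k, hk⟩ := hμ.exists_ball_le_onPosHyperquadrant hrad hn
  have : SigmaFinite (onPosHyperquadrant μ) :=
    sigmaFinite_of_ball_lt_top (hμ.onPosHyperquadrant_ball_lt_top hrad)
  refine ⟨C * (D ^ k) ^ (q / p), ENNReal.mul_ne_top hC
    (ENNReal.rpow_ne_top_of_nonneg hqp (hμ.pow_ne_top k)), ?_⟩
  intro f g F hf hg hF hFb hfF T x hx r hr
  obtain ⟨N, hN⟩ := hFb
  have hiso : Isometry fun x : posHyperquadrant n => T x := T.isometry.comp isometry_subtype_coe
  have hm : Measurable fun x : posHyperquadrant n => T x := hiso.continuous.measurable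
  have hmap := map_isometry_comp_coe hrad T
  have hle : (onPosHyperquadrant μ).map (fun x : posHyperquadrant n => T x) ≤ (1 : ℝ≥0∞) • μ := by
    rw [hmap, one_smul]; exact Measure.restrict_le_self
  have hqm := quasiMeasurePreserving_of_map_le hm hle
  have hball : ∀ s, (fun x : posHyperquadrant n => T x) ⁻¹' Metric.ball (T x) s =
      Metric.ball (⟨x, hx⟩ : posHyperquadrant n) s := fun s => by ext y; simp [Subtype.dist_eq]
  have key := h _ _ (fun x => F (T x)) (hf.comp hm ENNReal.one_ne_top hle)
    (hg.comp hm fun l γ hγ => hasUnitSpeedOn_isometry_comp hiso hγ) (hF.comp hm)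
    ⟨N, fun _ => hN _⟩ (hqm.ae hfF) ⟨x, hx⟩ r hr
  rw [← pairIntegral_restrict Metric.isOpen_ball.measurableSet, ← hmap,
    pairIntegral_map hF hm Metric.isOpen_ball.measurableSet Metric.isOpen_ball.measurableSet, hball]
  refine key.trans ?_
  rw [mul_assoc]
  refine mul_le_mul_right ?_ _
  have hinv : (onPosHyperquadrant μ (Metric.ball (⟨x, hx⟩ : posHyperquadrant n) r))⁻¹ ≤
      D ^ k * (μ (Metric.ball (T x) r))⁻¹ :=
    ennreal_inv_le_mul_inv (hμ.ball_ne_zero _ hr) (hμ.ball_ne_top _ r)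
      (hμ.onPosHyperquadrant_ball_pos hrad hn _ r hr).ne'
      (hμ.onPosHyperquadrant_ball_lt_top hrad _ r).ne (hk ⟨x, hx⟩ r hr T)
  have hint := setLIntegral_comp_le (hg.1.pow_const p) hm hle
    (A := Metric.ball (⟨x, hx⟩ : posHyperquadrant n) (lam * r)) (B := Metric.ball (T x) (lam * r))
    Metric.isOpen_ball.measurableSet (by rw [← hball]; exact mapsTo_preimage _ _)
  rw [one_mul] at hint
  calc poincareBound (onPosHyperquadrant μ) q p (fun y => g (T y) ^ p) ⟨x, hx⟩ r
        (Metric.ball ⟨x, hx⟩ (lam * r))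
      ≤ μ (Metric.ball (T x) r) ^ 2 * ENNReal.ofReal r ^ q *
        (D ^ k * (μ (Metric.ball (T x) r))⁻¹ *
          ∫⁻ w in Metric.ball (T x) (lam * r), g w ^ p ∂μ) ^ (q / p) := by
        unfold poincareBound
        exact mul_le_mul' (mul_le_mul_left (pow_le_pow_left'
          (onPosHyperquadrant_ball_le hrad ⟨x, hx⟩ r T) 2) _)
          (ENNReal.rpow_le_rpow (mul_le_mul' hinv hint) hqp)
    _ = _ := by
        rw [poincareBound, mul_assoc (D ^ k), ENNReal.mul_rpow_of_nonneg _ _ hqp]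
        ring

end Quadrant


/-! ### From the hyperquadrant to the whole space. -/

section Sector

variable {n : ℕ}

/-- The cone of points in directions close to `u`. -/
def sector (u : EuclideanSpace ℝ (Fin n)) (δ : ℝ) : Set (EuclideanSpace ℝ (Fin n)) :=
  {x | ‖x - ‖x‖ • u‖ ≤ δ * ‖x‖}

lemma sector_subset_sector_add {u v : EuclideanSpace ℝ (Fin n)} {δ ε : ℝ} (h : ‖v - u‖ ≤ ε) :
    sector v δ ⊆ sector u (δ + ε) := by
  intro x hx
  have h1 : ‖x - ‖x‖ • v‖ ≤ δ * ‖x‖ := hx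
  have e : x - ‖x‖ • u = (x - ‖x‖ • v) + ‖x‖ • (v - u) := by module
  have h2 : ‖‖x‖ • (v - u)‖ ≤ ‖x‖ * ε := by
    rw [norm_smul, norm_norm]
    exact mul_le_mul_of_nonneg_left h (norm_nonneg x)
  change ‖x - ‖x‖ • u‖ ≤ (δ + ε) * ‖x‖
  rw [e]
  have h3 := norm_add_le (x - ‖x‖ • v) (‖x‖ • (v - u))
  linarith

lemma sector_subset_image_posHyperquadrant {u : EuclideanSpace ℝ (Fin n)}
    (T : EuclideanSpace ℝ (Fin n) ≃ₗᵢ[ℝ] EuclideanSpace ℝ (Fin n)) (hT : T (diagonal n) = u) :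
    sector u (√n)⁻¹ ⊆ T '' posHyperquadrant n := by
  intro x hx
  refine ⟨T.symm x, ?_, T.apply_symm_apply x⟩
  refine mem_posHyperquadrant_of_norm_sub_le (x := 0) (s := (√n)⁻¹ * ‖x‖) (t := ‖x‖)
    zero_mem_posHyperquadrant (by rw [mul_comm]) ?_
  rw [← T.norm_map, map_sub, T.apply_symm_apply, zero_add, map_smul, hT]
  exact hx

lemma ball_subset_sector {v : EuclideanSpace ℝ (Fin n)} (hv : ‖v‖ = 1) {δ R : ℝ} (hδ0 : 0 < δ)
    (hδ : δ ≤ 1 / 2) (hR : 0 < R) :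
    Metric.ball ((R / 2) • v) (δ * R / 8) ⊆ sector v δ ∩ Metric.ball 0 R := by
  intro x hx
  rw [mem_ball_iff_norm] at hx
  have hnv : ‖(R / 2) • v‖ = R / 2 := by
    rw [norm_smul, hv, mul_one, Real.norm_of_nonneg (by positivity)]
  have h1 := abs_norm_sub_norm_le x ((R / 2) • v)
  rw [hnv] at h1
  have h2 := abs_le.1 (h1.trans hx.le)
  have hδR : δ * R ≤ 1 / 2 * R := by gcongr
  refine ⟨?_, ?_⟩
  · have e : x - ‖x‖ • v = (x - (R / 2) • v) - (‖x‖ - R / 2) • v := by module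
    have h3 := norm_sub_le (x - (R / 2) • v) ((‖x‖ - R / 2) • v)
    rw [← e, norm_smul, hv, mul_one, Real.norm_eq_abs] at h3
    change ‖x - ‖x‖ • v‖ ≤ δ * ‖x‖
    have h4 : R / 4 ≤ ‖x‖ := by linarith [h2.1]
    have h5 : δ * (R / 4) ≤ δ * ‖x‖ := by gcongr
    linarith
  · rw [mem_ball_zero_iff]
    linarith [h2.2]

variable {μ : Measure (EuclideanSpace ℝ (Fin n))} [SFinite μ] {D : ℝ≥0∞} {q p lam : ℝ}

/-- Call two directions related if the estimate holds between their sectors. Nearby directions are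
related through a common rotated quadrant, and the relation is transitive because each truncated
sector carries a fixed share of the ball's measure. Connectedness of the unit sphere relates all
directions, and compactness reduces the ball to finitely many sectors. -/
lemma DoublingWith.exists_pairIntegral_ball_zero_le (hμ : DoublingWith μ D) (hn : 2 ≤ n)
    (hq : 1 ≤ q) {C : ℝ≥0∞} (hC : C ≠ ∞) :
    ∃ K : ℝ≥0∞, K ≠ ∞ ∧ ∀ (F : EuclideanSpace ℝ (Fin n) → ℝ)
      (G : EuclideanSpace ℝ (Fin n) → ℝ≥0∞), Measurable F → QuadrantBound μ q p lam C F G →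
      ∀ R : ℝ, 0 < R → pairIntegral μ q F (Metric.ball 0 R) (Metric.ball 0 R) ≤
        K * poincareBound μ q p G 0 R (Metric.ball 0 (lam * R)) := by
  have hn0 : n ≠ 0 := by omega
  have h1n : (1 : ℝ) ≤ √n := Real.one_le_sqrt.2 (by exact_mod_cast (by omega : 1 ≤ n))
  -- Half the aperture that fits into a rotated quadrant: sectors of aperture `δ` whose axes are
  -- within `δ` of `w` lie in the sector of aperture `(√n)⁻¹` about `w`.
  set δ : ℝ := (√n)⁻¹ / 2 with hδ
  have hδ0 : 0 < δ := by positivity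
  have hδ2 : δ ≤ 1 / 2 := by
    rw [hδ]; linarith [inv_le_one_of_one_le₀ h1n]
  set P : EuclideanSpace ℝ (Fin n) → EuclideanSpace ℝ (Fin n) → Prop := fun u v =>
    ∃ K : ℝ≥0∞, K ≠ ∞ ∧ ∀ (F : EuclideanSpace ℝ (Fin n) → ℝ)
      (G : EuclideanSpace ℝ (Fin n) → ℝ≥0∞), Measurable F → QuadrantBound μ q p lam C F G →
      ∀ R : ℝ, 0 < R →
      pairIntegral μ q F (sector u δ ∩ Metric.ball 0 R) (sector v δ ∩ Metric.ball 0 R) ≤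
        K * poincareBound μ q p G 0 R (Metric.ball 0 (lam * R)) with hP
  have hnear : ∀ w u v : EuclideanSpace ℝ (Fin n), ‖w‖ = 1 → ‖u - w‖ ≤ δ → ‖v - w‖ ≤ δ →
      P u v := by
    intro w u v hw hu hv
    obtain ⟨T, hT⟩ := exists_isometry_diagonal hn0 hw
    refine ⟨C, hC, fun F G _ hFG R hR => ?_⟩
    have h1 := hFG T 0 zero_mem_posHyperquadrant R hR
    rw [map_zero] at h1
    have e : δ + δ = (√n)⁻¹ := by rw [hδ]; ring
    have hsub : ∀ y : EuclideanSpace ℝ (Fin n), ‖y - w‖ ≤ δ → sector y δ ∩ Metric.ball 0 R ⊆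
        Metric.ball 0 R ∩ T '' posHyperquadrant n := by
      rintro y hy x ⟨hx, hxR⟩
      have := sector_subset_sector_add (δ := δ) hy hx
      rw [e] at this
      exact ⟨hxR, sector_subset_image_posHyperquadrant T hT this⟩
    exact (pairIntegral_mono (hsub u hu) (hsub v hv)).trans h1
  obtain ⟨k, hk⟩ := pow_unbounded_of_one_lt (12 / δ) (one_lt_two)
  have htrans : ∀ u v w : EuclideanSpace ℝ (Fin n), ‖v‖ = 1 → P u v → P v w → P u w := by
    rintro u v w hv ⟨K₁, hK₁, H₁⟩ ⟨K₂, hK₂, H₂⟩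
    refine ⟨2 ^ (q - 1) * ((K₁ + K₂) * D ^ k), ENNReal.mul_ne_top (two_rpow_ne_top _)
      (ENNReal.mul_ne_top (ENNReal.add_ne_top.2 ⟨hK₁, hK₂⟩) (hμ.pow_ne_top k)), ?_⟩
    intro F G hF hFG R hR
    set Q := poincareBound μ q p G 0 R (Metric.ball 0 (lam * R))
    set M := sector v δ ∩ Metric.ball 0 R with hM
    have hsub := ball_subset_sector hv hδ0 hδ2 hR
    have hs : 0 < δ * R / 8 := by positivity
    have hMR : μ (Metric.ball 0 R) ≤ D ^ k * μ M := by
      refine (hμ.ball_le (y := (R / 2) • v) hs k ?_).trans (mul_le_mul_right (measure_mono hsub) _)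
      rw [dist_zero_left, norm_smul, hv, mul_one, Real.norm_of_nonneg (by positivity)]
      have e : R / 2 + R = 12 / δ * (δ * R / 8) := by field_simp; norm_num
      rw [e]
      gcongr
    have hM0 : μ M ≠ 0 := (lt_of_lt_of_le (hμ.pos _ _ hs) (measure_mono hsub)).ne'
    have hMt : μ M ≠ ∞ := ((measure_mono inter_subset_right).trans_lt (hμ.lt_top 0 R)).ne
    have hA : ∀ y, μ (sector y δ ∩ Metric.ball 0 R) ≤ D ^ k * μ M := fun y =>
      (measure_mono inter_subset_right).trans hMR
    refine ennreal_le_of_mul_le_mul hM0 hMt ?_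
    calc _ ≤ 2 ^ (q - 1) * (K₁ * Q * (D ^ k * μ M) + K₂ * Q * (D ^ k * μ M)) :=
          (pairIntegral_trans hF hq _ _ M).trans (mul_le_mul_right (add_le_add
            (mul_le_mul' (H₁ F G hF hFG R hR) (hA w)) (mul_le_mul' (H₂ F G hF hFG R hR) (hA u))) _)
      _ = _ := by ring
  have hrank : 1 < Module.rank ℝ (EuclideanSpace ℝ (Fin n)) := by
    rw [← Module.finrank_eq_rank, finrank_euclideanSpace_fin]
    exact_mod_cast hn
  have hall : ∀ u v : EuclideanSpace ℝ (Fin n), ‖u‖ = 1 → ‖v‖ = 1 → P u v := by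
    intro u v hu hv
    -- The dimension hypothesis `2 ≤ n` is needed here: for `n = 1` the sphere is two points.
    refine (isPreconnected_sphere hrank (0 : EuclideanSpace ℝ (Fin n)) 1).induction₂' P ?_ ?_
      (by simpa using hu) (by simpa using hv)
    · intro x hx
      have hx1 : ‖x‖ = 1 := by simpa using hx
      filter_upwards [mem_nhdsWithin_of_mem_nhds (Metric.ball_mem_nhds x hδ0)] with y hy
      have hy' : ‖y - x‖ ≤ δ := (mem_ball_iff_norm.1 hy).le
      have hxx : ‖x - x‖ ≤ δ := by simpa using hδ0.le
      exact ⟨hnear x x y hx1 hxx hy', hnear x y x hx1 hy' hxx⟩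
    · intro x y z _ hy _
      exact htrans x y z (by simpa using hy)
  obtain ⟨t, hts, ht⟩ := (isCompact_sphere (0 : EuclideanSpace ℝ (Fin n)) 1).elim_nhds_subcover
    (fun c => Metric.ball c δ) fun c _ => Metric.ball_mem_nhds c hδ0
  have hcov : ∀ R, Metric.ball (0 : EuclideanSpace ℝ (Fin n)) R ⊆
      ⋃ u ∈ t, sector u δ ∩ Metric.ball 0 R := by
    intro R x hx
    rcases eq_or_ne x 0 with rfl | hx0
    · obtain ⟨u, hu, -⟩ := mem_iUnion₂.1 (ht (show diagonal n ∈ Metric.sphere 0 1 by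
        simpa using norm_diagonal hn0))
      exact mem_iUnion₂.2 ⟨u, hu, by simp [sector], hx⟩
    · have hxn : 0 < ‖x‖ := norm_pos_iff.2 hx0
      obtain ⟨u, hu, hxu⟩ := mem_iUnion₂.1 (ht (show ‖x‖⁻¹ • x ∈ Metric.sphere 0 1 by
        rw [mem_sphere_zero_iff_norm, norm_smul, norm_inv, norm_norm, inv_mul_cancel₀ hxn.ne']))
      refine mem_iUnion₂.2 ⟨u, hu, ?_, hx⟩
      have e : x - ‖x‖ • u = ‖x‖ • (‖x‖⁻¹ • x - u) := by
        rw [smul_sub, smul_inv_smul₀ hxn.ne']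
      change ‖x - ‖x‖ • u‖ ≤ δ * ‖x‖
      rw [e, norm_smul, norm_norm, mul_comm]
      exact mul_le_mul_of_nonneg_right (mem_ball_iff_norm.1 hxu).le (norm_nonneg _)
  have ht1 : ∀ u ∈ t, ‖u‖ = 1 := fun u hu => by simpa using hts u hu
  choose! K hK H using fun (u : EuclideanSpace ℝ (Fin n)) (hu : u ∈ t)
    (v : EuclideanSpace ℝ (Fin n)) (hv : v ∈ t) => hall u v (ht1 u hu) (ht1 v hv)
  set S : ℝ≥0∞ := ∑ u ∈ t, ∑ v ∈ t, K u v with hS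
  have hSt : S ≠ ∞ := ENNReal.sum_ne_top.2 fun u hu => ENNReal.sum_ne_top.2 fun v hv => hK u hu v hv
  refine ⟨t.card * (t.card * S), ENNReal.mul_ne_top (by simp) (ENNReal.mul_ne_top (by simp) hSt), ?_⟩
  intro F G hF hFG R hR
  refine (pairIntegral_mono (hcov R) (hcov R)).trans ?_
  rw [mul_assoc, mul_assoc]
  refine pairIntegral_biUnion_le t t _ _ hF fun u hu v hv => ?_
  refine (H u hu v hv F G hF hFG R hR).trans (mul_le_mul_left ?_ _)
  exact (Finset.single_le_sum (f := fun v => K u v) (fun _ _ => zero_le) hv).trans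
    (Finset.single_le_sum (f := fun u => ∑ v ∈ t, K u v) (fun _ _ => zero_le) hu)

-- Far from the origin, relative to its radius, a ball fits into one rotated quadrant; otherwise it
-- is comparable to a ball about the origin. The dilation may grow, which is harmless as it is
-- removed afterwards.
omit [SFinite μ] in
lemma PairPoincare.of_onPosHyperquadrant (hμ : DoublingWith μ D) (hrad : IsRadialMeasure μ)
    (hn : 2 ≤ n) (hq : 1 ≤ q) (hp : 1 ≤ p) (hlam : 1 ≤ lam)
    (h : PairPoincare q p lam (onPosHyperquadrant μ)) : ∃ lam', 1 ≤ lam' ∧ PairPoincare q p lam' μ := by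
  have : SigmaFinite μ := sigmaFinite_of_ball_lt_top hμ.lt_top
  have hn0 : n ≠ 0 := by omega
  have hq0 : 0 ≤ q := by linarith
  have hp0 : 0 ≤ p := by linarith
  obtain ⟨C, hC, HC⟩ := h.exists_quadrantBound hμ hrad hn0 hq hp
  obtain ⟨K, hK, HK⟩ := hμ.exists_pairIntegral_ball_zero_le (p := p) (lam := lam) hn hq hC
  have h0 : (0 : ℝ) < √n := Real.sqrt_pos.2 (by exact_mod_cast Nat.pos_of_ne_zero hn0)
  obtain ⟨k, hk⟩ := pow_unbounded_of_one_lt (1 + 2 * √n) (one_lt_two)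
  -- Chosen so that `B(0, lam * R) ⊆ B(x, lam' * r)` when `|x| < √n r` and `R = (1 + √n) r`.
  set lam' := lam * (1 + √n) + √n with hlam'
  have hll : lam ≤ lam' := by nlinarith
  refine ⟨lam', by linarith, C + K * compareConst D q p k, ENNReal.add_ne_top.2 ⟨hC,
    ENNReal.mul_ne_top hK (hμ.compareConst_ne_top hq0 hp0 k)⟩, ?_⟩
  intro f g F hf hg hF hFb hfF x r hr
  have hQ := HC f g F hf hg hF hFb hfF
  rw [add_mul]
  rcases le_or_gt (√n * r) ‖x‖ with hx | hx
  · refine le_trans ?_ le_self_add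
    have hxn : 0 < ‖x‖ := lt_of_lt_of_le (by positivity) hx
    obtain ⟨T, hT⟩ := exists_isometry_diagonal hn0 (u := ‖x‖⁻¹ • x)
      (by rw [norm_smul, norm_inv, norm_norm, inv_mul_cancel₀ hxn.ne'])
    have hTx : T (‖x‖ • diagonal n) = x := by rw [map_smul, hT, smul_inv_smul₀ hxn.ne']
    have h1 := hQ T (‖x‖ • diagonal n) (diagonal_mem_posHyperquadrant hxn.le) r hr
    rw [hTx] at h1
    have hsub : Metric.ball x r ⊆ Metric.ball x r ∩ T '' posHyperquadrant n := by
      intro z hz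
      refine ⟨hz, T.symm z, ?_, T.apply_symm_apply z⟩
      refine mem_posHyperquadrant_of_norm_sub_le (x := 0) (s := r) (t := ‖x‖)
        zero_mem_posHyperquadrant ?_ ?_
      · rw [← div_eq_mul_inv, le_div_iff₀ h0]; linarith
      · rw [zero_add, ← T.norm_map, map_sub, T.apply_symm_apply, hTx]
        exact (mem_ball_iff_norm.1 hz).le
    refine (pairIntegral_mono hsub hsub).trans (h1.trans (mul_le_mul_right ?_ _))
    unfold poincareBound
    gcongr
  · refine le_trans ?_ le_add_self
    set R := (1 + √n) * r with hR
    have hR0 : 0 < R := by positivity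
    have hsub : Metric.ball x r ⊆ Metric.ball 0 R :=
      Metric.ball_subset_ball' (by rw [dist_zero_right, hR]; linarith)
    refine (pairIntegral_mono hsub hsub).trans ((HK F _ hF hQ R hR0).trans ?_)
    rw [mul_assoc]
    refine mul_le_mul_right (hμ.poincareBound_le hq0 hp0 hR0 hr k ?_ ?_ ?_) _
    · rw [dist_zero_left, hR]; nlinarith
    · rw [dist_zero_left, hR]
      have : (1 : ℝ) ≤ 2 ^ k := one_le_pow₀ (by norm_num)
      nlinarith
    · refine Metric.ball_subset_ball' ?_
      rw [dist_zero_left, hlam', hR]; linarith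

end Sector


/-! ### Folding the space onto the hyperquadrant. -/

section Fold

variable {n : ℕ}

/-- Sum the hypothesis over a partition and use additivity of the variation. -/
lemma eVariationOn_le_of_edist_le {X Y : Type*} [PseudoEMetricSpace X] [PseudoEMetricSpace Y]
    {γ : ℝ → X} {η : ℝ → Y} {s : Set ℝ}
    (h : ∀ a ∈ s, ∀ b ∈ s, a ≤ b → edist (γ a) (γ b) ≤ eVariationOn η (s ∩ Icc a b)) :
    eVariationOn γ s ≤ eVariationOn η s := by
  refine iSup_le fun ⟨m, u, hu, hus⟩ => ?_
  calc ∑ i ∈ Finset.range m, edist (γ (u (i + 1))) (γ (u i))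
      ≤ ∑ i ∈ Finset.range m, eVariationOn η (s ∩ Icc (u i) (u (i + 1))) :=
        Finset.sum_le_sum fun i _ => by
          rw [edist_comm]; exact h _ (hus i) _ (hus (i + 1)) (hu i.le_succ)
    _ = eVariationOn η (s ∩ Icc (u 0) (u m)) := eVariationOn.sum η hu fun i _ _ => hus i
    _ ≤ eVariationOn η s := eVariationOn.mono η inter_subset_left

/-- The map which replaces the coordinates in `s` by their absolute values. -/
noncomputable def foldOn (s : Finset (Fin n)) (x : EuclideanSpace ℝ (Fin n)) :
    EuclideanSpace ℝ (Fin n) :=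
  WithLp.toLp 2 fun j => if j ∈ s then |x j| else x j

lemma foldOn_apply (s : Finset (Fin n)) (x : EuclideanSpace ℝ (Fin n)) (j : Fin n) :
    foldOn s x j = if j ∈ s then |x j| else x j := rfl

lemma dist_foldOn_le (s : Finset (Fin n)) (x y : EuclideanSpace ℝ (Fin n)) :
    dist (foldOn s x) (foldOn s y) ≤ dist x y := by
  rw [EuclideanSpace.dist_eq, EuclideanSpace.dist_eq]
  refine Real.sqrt_le_sqrt (Finset.sum_le_sum fun j _ => ?_)
  refine pow_le_pow_left₀ dist_nonneg ?_ 2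
  rw [foldOn_apply, foldOn_apply, Real.dist_eq, Real.dist_eq]
  split_ifs
  · exact abs_abs_sub_abs_le _ _
  · exact le_rfl

lemma dist_foldOn_singleton {j : Fin n} {x y : EuclideanSpace ℝ (Fin n)} (h : 0 ≤ x j * y j) :
    dist (foldOn {j} x) (foldOn {j} y) = dist x y := by
  rw [EuclideanSpace.dist_eq, EuclideanSpace.dist_eq]
  congr 1
  refine Finset.sum_congr rfl fun i _ => ?_
  congr 1
  rw [foldOn_apply, foldOn_apply, Real.dist_eq, Real.dist_eq]
  split_ifs with hi
  · rw [Finset.mem_singleton.1 hi]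
    rcases mul_nonneg_iff.1 h with ⟨h1, h2⟩ | ⟨h1, h2⟩
    · rw [abs_of_nonneg h1, abs_of_nonneg h2]
    · rw [abs_of_nonpos h1, abs_of_nonpos h2, neg_sub_neg, abs_sub_comm]
  · rfl

lemma lipschitzWith_foldOn (s : Finset (Fin n)) : LipschitzWith 1 (foldOn s) :=
  LipschitzWith.of_dist_le_mul fun x y => by simpa using dist_foldOn_le s x y

/-- Folding one coordinate cannot increase length. Conversely, distances are preserved between
points on the same side of the hyperplane, and a curve that changes sides meets the hyperplane,
where it can be split. -/
lemma HasUnitSpeedOn.foldOn_singleton {γ : ℝ → EuclideanSpace ℝ (Fin n)} {l : ℝ}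
    (h : HasUnitSpeedOn γ (Icc 0 l)) (j : Fin n) :
    HasUnitSpeedOn (fun t => foldOn {j} (γ t)) (Icc 0 l) := by
  intro x hx y hy
  rw [← h hx hy]
  refine le_antisymm ?_ (eVariationOn_le_of_edist_le ?_)
  · have := (lipschitzWith_foldOn {j}).lipschitzOnWith (s := univ) |>.comp_eVariationOn_le
      (mapsTo_univ γ (Icc 0 l ∩ Icc x y))
    rw [ENNReal.coe_one, one_mul] at this
    exact this
  · intro a ha b hb hab
    set S := Icc 0 l ∩ Icc x y
    have hle : ∀ c d, c ∈ S → d ∈ S → c ≤ d → 0 ≤ γ c j * γ d j →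
        edist (γ c) (γ d) ≤ eVariationOn (fun t => foldOn {j} (γ t)) (S ∩ Icc c d) := by
      intro c d hc hd hcd hs
      rw [edist_dist, ← dist_foldOn_singleton hs, ← edist_dist]
      exact eVariationOn.edist_le (fun t => foldOn {j} (γ t)) ⟨hc, le_rfl, hcd⟩ ⟨hd, hcd, le_rfl⟩
    rcases le_or_gt 0 (γ a j * γ b j) with hs | hs
    · exact hle a b ha hb hab hs
    · have hsub : Icc a b ⊆ S := fun t ht =>
        ⟨⟨ha.1.1.trans ht.1, ht.2.trans hb.1.2⟩, ⟨ha.2.1.trans ht.1, ht.2.trans hb.2.2⟩⟩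
      have hcont : ContinuousOn (fun t => γ t j) (Icc a b) := by
        have h1 := (continuousOn_of_hasUnitSpeedOn h).mono fun t ht => (hsub ht).1
        have h2 : Continuous fun z : EuclideanSpace ℝ (Fin n) => z j := by fun_prop
        exact h2.comp_continuousOn h1
      obtain ⟨z, hz, hz0⟩ : ∃ z ∈ Icc a b, γ z j = 0 := by
        rcases mul_neg_iff.1 hs with ⟨h1, h2⟩ | ⟨h1, h2⟩
        · exact intermediate_value_Icc' hab hcont ⟨h2.le, h1.le⟩
        · exact intermediate_value_Icc hab hcont ⟨h1.le, h2.le⟩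
      rw [← eVariationOn.Icc_add_Icc _ hz.1 hz.2 (hsub hz)]
      exact (edist_triangle _ (γ z) _).trans (add_le_add
        (hle a z ha (hsub hz) hz.1 (by rw [hz0, mul_zero]))
        (hle z b (hsub hz) hb hz.2 (by rw [hz0, zero_mul])))

lemma HasUnitSpeedOn.foldOn {γ : ℝ → EuclideanSpace ℝ (Fin n)} {l : ℝ}
    (h : HasUnitSpeedOn γ (Icc 0 l)) (s : Finset (Fin n)) :
    HasUnitSpeedOn (fun t => foldOn s (γ t)) (Icc 0 l) := by
  induction s using Finset.induction_on with
  | empty =>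
    convert h using 2 with t
    ext j; simp [foldOn_apply]
  | insert j s hj ih =>
    convert HasUnitSpeedOn.foldOn_singleton ih j using 2 with t
    ext i
    simp only [foldOn_apply, Finset.mem_insert, Finset.mem_singleton]
    rcases eq_or_ne i j with rfl | h1
    · simp [hj]
    · by_cases h2 : i ∈ s <;> simp [h1, h2]

/-- The folding map of `ℝⁿ` onto the positive hyperquadrant. -/
noncomputable def fold (x : EuclideanSpace ℝ (Fin n)) : posHyperquadrant n :=
  ⟨foldOn Finset.univ x, fun j => by simp [foldOn_apply]⟩

lemma fold_coe (x : posHyperquadrant n) : fold (x : EuclideanSpace ℝ (Fin n)) = x := by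
  ext j
  simp [fold, foldOn_apply, abs_of_nonneg (x.2 j)]

lemma measurable_fold : Measurable (fold (n := n)) :=
  (lipschitzWith_foldOn Finset.univ).continuous.measurable.subtype_mk

lemma dist_fold_coe_le (y : EuclideanSpace ℝ (Fin n)) (x : posHyperquadrant n) :
    dist (fold y) x ≤ dist y x := by
  conv_lhs => rw [← fold_coe x]
  exact dist_foldOn_le _ _ _

/-- The preimage of a set is covered by its images under the `2^n` sign changes, each of which
preserves `μ`. -/
lemma map_fold_le {μ : Measure (EuclideanSpace ℝ (Fin n))} (hrad : IsRadialMeasure μ) :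
    μ.map fold ≤ (2 ^ n : ℝ≥0∞) • onPosHyperquadrant μ := by
  refine Measure.le_iff.2 fun S hS => ?_
  rw [Measure.map_apply measurable_fold hS]
  set T : (Fin n → Bool) → EuclideanSpace ℝ (Fin n) ≃ₗᵢ[ℝ] EuclideanSpace ℝ (Fin n) := fun σ =>
    LinearIsometryEquiv.piLpCongrRight 2 fun j =>
      if σ j then LinearIsometryEquiv.refl ℝ ℝ else LinearIsometryEquiv.neg ℝ with hT
  have hSm : MeasurableSet (Subtype.val '' S : Set (EuclideanSpace ℝ (Fin n))) :=
    (measurableSet_posHyperquadrant n).subtype_image hS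
  have hsub : fold ⁻¹' S ⊆ ⋃ σ : Fin n → Bool, T σ ⁻¹' (Subtype.val '' S) := by
    intro x hx
    refine mem_iUnion.2 ⟨fun j => decide (0 ≤ x j), fold x, hx, ?_⟩
    ext j
    by_cases h : 0 ≤ x j
    · simp [hT, fold, foldOn_apply, h, abs_of_nonneg h]
    · simp [hT, fold, foldOn_apply, h, abs_of_neg (not_le.1 h)]
  calc μ (fold ⁻¹' S) ≤ ∑ σ : Fin n → Bool, μ (T σ ⁻¹' (Subtype.val '' S)) :=
        (measure_mono hsub).trans (measure_iUnion_fintype_le _ _)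
    _ = ∑ _σ : Fin n → Bool, onPosHyperquadrant μ S := by
        refine Finset.sum_congr rfl fun σ _ => ?_
        rw [← Measure.map_apply (T σ).continuous.measurable hSm, hrad.map_eq, onPosHyperquadrant,
          comap_subtype_coe_apply (measurableSet_posHyperquadrant n)]
    _ = _ := by simp

/-- Apply the inequality on `ℝⁿ` to `f ∘ fold` and `g ∘ fold`. For `x` in `X₊` folding maps `B(x,r)`
into the ball of `X₊` with the same centre and radius, so the dilation stays 1. -/
lemma PairPoincare.onPosHyperquadrant {μ : Measure (EuclideanSpace ℝ (Fin n))} {D : ℝ≥0∞}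
    {q p : ℝ} (hμ : DoublingWith μ D) (hrad : IsRadialMeasure μ) (hn : n ≠ 0) (hq : 1 ≤ q)
    (hp : 1 ≤ p) (h : PairPoincare q p 1 μ) : PairPoincare q p 1 (onPosHyperquadrant μ) := by
  have hqp : 0 ≤ q / p := div_nonneg (by linarith) (by linarith)
  obtain ⟨C, hC, h⟩ := h
  obtain ⟨k, hk⟩ := hμ.exists_ball_le_onPosHyperquadrant hrad hn
  have : SigmaFinite (BowTie.onPosHyperquadrant μ) :=
    sigmaFinite_of_ball_lt_top (hμ.onPosHyperquadrant_ball_lt_top hrad)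
  have h2n : (2 ^ n : ℝ≥0∞) ≠ ∞ := ENNReal.pow_ne_top (by norm_num)
  refine ⟨C * ((D ^ k) ^ 2 * (2 ^ n) ^ (q / p)), ENNReal.mul_ne_top hC (ENNReal.mul_ne_top
    (ENNReal.pow_ne_top (hμ.pow_ne_top k)) (ENNReal.rpow_ne_top_of_nonneg hqp h2n)), ?_⟩
  intro f g F hf hg hF hFb hfF x r hr
  obtain ⟨N, hN⟩ := hFb
  have hle := map_fold_le hrad
  have hqm := quasiMeasurePreserving_of_map_le measurable_fold hle
  have key := h _ _ (fun y => F (fold y)) (hf.comp measurable_fold h2n hle)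
    (hg.comp measurable_fold fun l γ hγ x hx y hy => by
      rw [← HasUnitSpeedOn.foldOn hγ Finset.univ hx hy]; rfl)
    (hF.comp measurable_fold) ⟨N, fun _ => hN _⟩ (hqm.ae hfF) x r hr
  have hball : ∀ s, Subtype.val ⁻¹' Metric.ball (x : EuclideanSpace ℝ (Fin n)) s =
      Metric.ball x s := fun s => by ext y; simp [Subtype.dist_eq]
  have hleft : pairIntegral (BowTie.onPosHyperquadrant μ) q F (Metric.ball x r) (Metric.ball x r) ≤
      pairIntegral μ q (fun y => F (fold y)) (Metric.ball x r) (Metric.ball x r) := by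
    have h1 := pairIntegral_map (ν := BowTie.onPosHyperquadrant μ) (q := q)
      (hF.comp measurable_fold) measurable_subtype_coe
      (A := Metric.ball (x : EuclideanSpace ℝ (Fin n)) r)
      (B := Metric.ball (x : EuclideanSpace ℝ (Fin n)) r)
      Metric.isOpen_ball.measurableSet Metric.isOpen_ball.measurableSet
    rw [BowTie.onPosHyperquadrant, map_comap_subtype_coe (measurableSet_posHyperquadrant n),
      pairIntegral_restrict Metric.isOpen_ball.measurableSet, hball] at h1
    simp only [Function.comp_apply, fold_coe] at h1
    rw [BowTie.onPosHyperquadrant, ← h1]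
    exact pairIntegral_mono inter_subset_left inter_subset_left
  refine hleft.trans (key.trans ?_)
  rw [mul_assoc]
  refine mul_le_mul_right ?_ _
  have hinv := ENNReal.inv_le_inv.2
    (onPosHyperquadrant_ball_le hrad x r (LinearIsometryEquiv.refl ℝ _))
  have hint := setLIntegral_comp_le (hg.1.pow_const p) measurable_fold hle
    (A := Metric.ball (x : EuclideanSpace ℝ (Fin n)) (1 * r)) (B := Metric.ball x (1 * r))
    Metric.isOpen_ball.measurableSet fun y hy => by
      rw [Metric.mem_ball] at hy ⊢
      exact (dist_fold_coe_le y x).trans_lt hy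
  calc poincareBound μ q p (fun y => g (fold y) ^ p) x r (Metric.ball x (1 * r))
      ≤ (D ^ k * BowTie.onPosHyperquadrant μ (Metric.ball x r)) ^ 2 * ENNReal.ofReal r ^ q *
          ((BowTie.onPosHyperquadrant μ (Metric.ball x r))⁻¹ * (2 ^ n *
            ∫⁻ w in Metric.ball x (1 * r), g w ^ p ∂BowTie.onPosHyperquadrant μ)) ^ (q / p) := by
        unfold poincareBound
        exact mul_le_mul' (mul_le_mul_left (pow_le_pow_left'
          (hk x r hr (LinearIsometryEquiv.refl ℝ _)) 2) _)
          (ENNReal.rpow_le_rpow (mul_le_mul' hinv hint) hqp)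
    _ = _ := by
        rw [poincareBound, mul_left_comm _ (2 ^ n : ℝ≥0∞), ENNReal.mul_rpow_of_nonneg (2 ^ n) _ hqp]
        ring

end Fold

end BowTie

theorem mainTheorem6 (n : ℕ) (hn : 2 ≤ n) (p q : ℝ) (hp : 1 ≤ p) (hq : 1 ≤ q)
    (μ : MeasureTheory.Measure (EuclideanSpace ℝ (Fin n)))
    (hrad : BowTie.IsRadialMeasure μ) (hdoub : BowTie.IsDoubling μ) :
    List.TFAE [
      BowTie.SupportsPoincare q p (BowTie.onPosHyperquadrant μ),
      BowTie.SupportsPoincareWithDilation q p 1 (BowTie.onPosHyperquadrant μ),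
      BowTie.SupportsPoincare q p μ,
      BowTie.SupportsPoincareWithDilation q p 1 μ] := by
  obtain ⟨D, hμ⟩ := hdoub.exists_doublingWith
  have hn0 : n ≠ 0 := by omega
  have : Nontrivial (EuclideanSpace ℝ (Fin n)) := by
    have : Nonempty (Fin n) := ⟨⟨0, by omega⟩⟩
    infer_instance
  have : SigmaFinite μ := BowTie.sigmaFinite_of_ball_lt_top hμ.lt_top
  have hνpos := hμ.onPosHyperquadrant_ball_pos hrad hn0
  have hνfin := hμ.onPosHyperquadrant_ball_lt_top hrad
  have : SigmaFinite (BowTie.onPosHyperquadrant μ) := BowTie.sigmaFinite_of_ball_lt_top hνfin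
  tfae_have 2 → 1 := fun h => ⟨1, le_rfl, h⟩
  tfae_have 4 → 3 := fun h => ⟨1, le_rfl, h⟩
  -- The return to the mean value form is available for dilation 1 only, so the dilation is removed
  -- already here.
  tfae_have 1 → 3 := by
    rintro ⟨lam, hlam, h⟩
    obtain ⟨lam', hlam', h'⟩ :=
      (BowTie.pairPoincare_of_supportsPoincare hq hp hlam hνpos hνfin h).of_onPosHyperquadrant
        hμ hrad hn hq hp hlam
    exact ⟨1, le_rfl, BowTie.supportsPoincare_of_pairPoincare hq hp hμ.pos hμ.lt_top
      (h'.dilation_one hμ hq hp hlam')⟩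
  tfae_have 3 → 4 := by
    rintro ⟨lam, hlam, h⟩
    exact BowTie.supportsPoincare_of_pairPoincare hq hp hμ.pos hμ.lt_top
      ((BowTie.pairPoincare_of_supportsPoincare hq hp hlam hμ.pos hμ.lt_top h).dilation_one
        hμ hq hp hlam)
  tfae_have 4 → 2 := fun h =>
    BowTie.supportsPoincare_of_pairPoincare hq hp hνpos hνfin
      ((BowTie.pairPoincare_of_supportsPoincare hq hp le_rfl hμ.pos hμ.lt_top h).onPosHyperquadrant
        hμ hrad hn0 hq hp)
  tfae_finish
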